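/- **Setting.** Let $d,p\ge 1$ and $k\ge 0$ be integers, and let $\Omega\subset\mathbb R^d$ be a bounded Lipschitz domain which is triangulated by a hierarchy of conforming simplicial meshes $\mathcal T_0,\dots,\mathcal T_L$ (each facet of a cell is a facet of another cell or lies in $\partial\Omega$), each cell of $\mathcal T_{\ell-1}$ being a union of cells of $\mathcal T_\ell$. Let $h_\ell$ be the largest diameter of a cell of $\mathcal T_\ell$. The meshes are uniformly shape regular and quasi-uniform, and $h_\ell\ge c_{\rm ref}h_{\ell-1}$ with a constant $c_{\rm ref}>0$. Let $\mathcal F_\ell$ be the set of faces of $\mathcal T_\ell$, and let $\|\cdot\|_0$ be the norm of $L^2(\Omega)$. For functions on the boundaries of the cells (possibly with different values from the two sides of a face) put $$\|\mu\|_\ell^2=\sum_{T\in\mathcal T_\ell}\frac{|T|}{|\partial T|}\int_{\partial T}\mu^2\,d\sigma .$$ Let $M_\ell$ be the space of functions on the faces in $\mathcal F_\ell$ that are polynomial of degree at most $p$ on each face and vanish on the faces in $\partial\Omega$, let $\overline V^c_\ell=\{w\in H^1_0(\Omega): w|_T\in\mathcal P_1(T)\ \forall T\in\mathcal T_\ell\}$,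 and let $\gamma_\ell$ be the trace on the skeleton. On each level let $\tau_\ell\ge 0$, and for $T\in\mathcal T_\ell$ let $V_T$ and $\vec W_T$ be spaces of scalar and vector valued polynomials of degree at most $k$ such that for every $\lambda\in M_\ell$ there is a unique $(u_T,\vec q_T)\in V_T\times\vec W_T$ with $$\int_T\vec q_T\cdot\vec r\,dx-\int_T u_T\nabla\!\cdot\vec r\,dx=-\int_{\partial T}\lambda\,\vec r\cdot\vec\nu\,d\sigma,\qquad \int_{\partial T}(\vec q_T\cdot\vec\nu+\tau_\ell u_T)v\,d\sigma-\int_T\vec q_T\cdot\nabla v\,dx=\tau_\ell\int_{\partial T}\lambda v\,d\sigma$$ for all $\vec r\in\vec W_T$, $v\in V_T$. Define $\mathcal U_\ell\lambda$ and $\vec{\mathcal Q}_\ell\lambda$ on $\Omega$ by $\mathcal U_\ell\lambda|_T=u_T$, $\vec{\mathcal Q}_\ell\lambda|_T=\vec q_T$, and $$a_\ell(\lambda,\mu)=\int_\Omega\vec{\mathcal Q}_\ell\lambda\cdot\vec{\mathcal Q}_\ell\mu\,dx+\sum_{T\in\mathcal T_\ell}\int_{\partial T}\tau_\ell(\mathcal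 U_\ell\lambda-\lambda)(\mathcal U_\ell\mu-\mu)\,d\sigma .$$ Let $I_\ell\colon M_{\ell-1}\to M_\ell$ be linear, $\ell=1,\dots,L$. **Assumptions.** With constants independent of $\ell$: * (IA1) $\|I_\ell\lambda\|_\ell\lesssim\|\lambda\|_{\ell-1}$ for all $\lambda\in M_{\ell-1}$; * (IA2) $I_\ell\gamma_{\ell-1}w=\gamma_\ell w$ for all $w\in\overline V^c_{\ell-1}$; and on every level $\ell$, for all $\mu\in M_\ell$: * (LS1) $\|\mathcal U_\ell\mu-\mu\|_\ell\lesssim h_\ell\|\vec{\mathcal Q}_\ell\mu\|_0$; * (LS2) $\|\vec{\mathcal Q}_\ell\mu\|_0\lesssim h_\ell^{-1}\|\mu\|_\ell$ and $\|\mathcal U_\ell\mu\|_0\lesssim\|\mu\|_\ell$; * (LS3) $\|\vec{\mathcal Q}_\ell\mu+\nabla\mathcal U_\ell\mu\|_0\lesssim h_\ell^{-1}\|\mathcal U_\ell\mu-\mu\|_\ell$ (with the cellwise gradient); * (LS4) if $\mu=\gamma_\ell w$ with $w\in\overline V^c_\ell$, then $\vec{\mathcal Q}_\ell\mu=-\nabla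 w$ and $\mathcal U_\ell\mu=w$. **Claim.** There is a constant $C$, depending only on $d,p,k$, the shape regularity and quasi-uniformity constants, $c_{\rm ref}$ and the constants in (IA1), (LS1)–(LS3) (in particular not on $\ell$, $L$ or the mesh sizes), such that for all $1\le\ell\le L$ and $\lambda\in M_{\ell-1}$ $$\|\vec{\mathcal Q}_\ell I_\ell\lambda\|_0\le C\|\vec{\mathcal Q}_{\ell-1}\lambda\|_0,$$ $$\|\mathcal U_{\ell-1}\lambda-\mathcal U_\ell I_\ell\lambda\|_0\le C h_{\ell-1}\|\vec{\mathcal Q}_{\ell-1}\lambda\|_0\quad\text{and}\quad \|\mathcal U_{\ell-1}\lambda-\mathcal U_\ell I_\ell\lambda\|_0\le C h_\ell\|\vec{\mathcal Q}_{\ell-1}\lambda\|_0 .$$ There is exactly one linear $P_{\ell-1}\colon M_\ell\to M_{\ell-1}$ with $a_{\ell-1}(P_{\ell-1}\lambda,\mu)=a_\ell(\lambda,I_\ell\mu)$ for all $\lambda\in M_\ell$, $\mu\in M_{\ell-1}$. If in addition $\tau_\ell h_\ell\le c_\tau$, then, with a constant $C'$ depending only on the quantities above and on $c_\tau$, $$a_\ell(I_\ell\lambda,I_\ell\lambda)\le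 C'a_{\ell-1}(\lambda,\lambda)\quad\forall\lambda\in M_{\ell-1},\qquad a_{\ell-1}(P_{\ell-1}\lambda,P_{\ell-1}\lambda)\le C'a_\ell(\lambda,\lambda)\quad\forall\lambda\in M_\ell .$$ -/

import Mathlib

open MeasureTheory Filter Topology
open scoped ENNReal NNReal ContDiff Gradient

noncomputable section

namespace HDG

/-- The Euclidean space `ℝ^d`. -/
abbrev Pt (d : ℕ) := EuclideanSpace ℝ (Fin d)

/-- Real polynomials in `d` variables. -/
abbrev Poly (d : ℕ) := MvPolynomial (Fin d) ℝ

/-- Polynomials of total degree at most `p`. -/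
abbrev PolyDeg (d p : ℕ) : Submodule ℝ (Poly d) := MvPolynomial.restrictTotalDegree (Fin d) ℝ p

variable {d : ℕ}

/-- Value of a polynomial at a point. -/
def val (u : Poly d) (x : Pt d) : ℝ := MvPolynomial.eval (fun i => x i) u

/-- Value of a polynomial vector field at a point. -/
def vecVal (q : Fin d → Poly d) (x : Pt d) : Pt d := WithLp.toLp 2 (fun i => val (q i) x)

/-- Gradient of a polynomial. -/
def polyGrad (u : Poly d) : Fin d → Poly d := fun i => MvPolynomial.pderiv i u

/-- Divergence of a polynomial vector field. -/
def polyDiv (q : Fin d → Poly d) : Poly d := ∑ i, MvPolynomial.pderiv i (q i)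

/-! ### Domain, `L²` norm and `H¹₀` -/

/-- Bounded Lipschitz domain: near each boundary point, `Ω` is the strict epigraph, in some unit
direction `e`, of a Lipschitz function of the component orthogonal to `e`. -/
structure IsLipschitzDomain (Ω : Set (Pt d)) : Prop where
  isOpen : IsOpen Ω
  isConnected : IsConnected Ω
  isBounded : Bornology.IsBounded Ω
  graph : ∀ x ∈ frontier Ω, ∃ (e : Pt d) (φ : Pt d → ℝ) (K : ℝ≥0) (r : ℝ),
    ‖e‖ = 1 ∧ LipschitzWith K φ ∧ (∀ (y : Pt d) (t : ℝ), φ (y + t • e) = φ y) ∧ 0 < r ∧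
      ∀ y ∈ Metric.ball x r, (y ∈ Ω ↔ φ y < inner ℝ e y)

/-- The `L²(Ω)` norm of a scalar or vector valued function. -/
def l2norm {F : Type*} [NormedAddCommGroup F] (Ω : Set (Pt d)) (f : Pt d → F) : ℝ :=
  Real.sqrt (∫ x in Ω, ‖f x‖ ^ 2)

/-- `u ∈ H¹₀(Ω)`, the closure of the smooth functions with compact support in `Ω` with respect to
the `H¹(Ω)` norm; `g` is the weak gradient of `u`. -/
def MemH10 (Ω : Set (Pt d)) (u : Pt d → ℝ) : Prop :=
  MemLp u 2 (volume.restrict Ω) ∧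
  ∃ g : Pt d → Pt d, MemLp g 2 (volume.restrict Ω) ∧
  ∃ φ : ℕ → Pt d → ℝ,
    (∀ n, ContDiff ℝ ∞ (φ n) ∧ HasCompactSupport (φ n) ∧ tsupport (φ n) ⊆ Ω) ∧
    Tendsto (fun n => eLpNorm (fun x => φ n x - u x) 2 (volume.restrict Ω)) atTop (𝓝 0) ∧
    Tendsto (fun n => eLpNorm (fun x => ∇ (φ n) x - g x) 2 (volume.restrict Ω)) atTop (𝓝 0)

/-! ### Simplices, given by their sets of vertices -/

/-- The closed simplex with vertex set `T` (a cell if `T` has `d + 1` points, a face if `d`). -/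
abbrev hull (T : Finset (Pt d)) : Set (Pt d) := convexHull ℝ (T : Set (Pt d))

/-- The vertex sets of the faces (of codimension one) of the cell with vertex set `T`. -/
def facets (T : Finset (Pt d)) : Finset (Finset (Pt d)) := T.powersetCard d

/-- The surface measure `dσ` on faces: the `(d-1)`-dimensional Hausdorff measure, normalized to
agree with Lebesgue measure on hyperplanes. -/
abbrev surf (d : ℕ) : Measure (Pt d) := Measure.euclideanHausdorffMeasure (d - 1)

/-- `∫_{∂T} f dσ`, where `f` may take different values on different faces. -/
def bdryIntegral (T : Finset (Pt d)) (f : Finset (Pt d) → Pt d → ℝ) : ℝ :=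
  ∑ F ∈ facets T, ∫ x in hull F, f F x ∂(surf d)

/-- `|T| / |∂T|`. -/
def volRatio (T : Finset (Pt d)) : ℝ :=
  volume.real (hull T) / ∑ F ∈ facets T, (surf d).real (hull F)

/-- Arithmetic mean of a finite set of points. -/
def barycenter (S : Finset (Pt d)) : Pt d := (S.card : ℝ)⁻¹ • ∑ x ∈ S, x

/-- The outward unit normal of the cell `T` on its face `F`: the vector from the barycenter of `T`
to that of `F`, made orthogonal to `F` and normalized. -/
def outerNormal (T F : Finset (Pt d)) : Pt d :=
  let n := (vectorSpan ℝ (F : Set (Pt d)))ᗮ.starProjection (barycenter F - barycenter T)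
  ‖n‖⁻¹ • n

/-! ### Meshes -/

/-- A regular (conforming) subdivision of `Ω` into simplices. -/
structure SimplicialMesh (d : ℕ) (Ω : Set (Pt d)) where
  /-- the vertex sets of the cells -/
  cells : Finset (Finset (Pt d))
  card_eq : ∀ T ∈ cells, T.card = d + 1
  indep : ∀ T ∈ cells, AffineIndependent ℝ ((↑) : T → Pt d)
  cover : ⋃ T ∈ cells, hull T = closure Ω
  inter : ∀ T ∈ cells, ∀ T' ∈ cells,
    hull T ∩ hull T' = convexHull ℝ ((T : Set (Pt d)) ∩ (T' : Set (Pt d)))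
  facet : ∀ T ∈ cells, ∀ F ∈ facets T,
    (∃ T' ∈ cells, T' ≠ T ∧ F ∈ facets T') ∨ hull F ⊆ frontier Ω

namespace SimplicialMesh

variable {Ω : Set (Pt d)} (𝒯 : SimplicialMesh d Ω)

/-- `F` is a face of the mesh. -/
def IsFace (F : Finset (Pt d)) : Prop := ∃ T ∈ 𝒯.cells, F ∈ facets T

/-- The mesh size: the largest diameter of a cell. -/
def h : ℝ := sSup ((fun T : Finset (Pt d) => Metric.diam (hull T)) '' (𝒯.cells : Set (Finset (Pt d))))

/-- Shape regularity with constant `s`: each cell contains a ball of radius comparable to the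
diameter of the cell. -/
def ShapeRegular (s : ℝ) : Prop :=
  ∀ T ∈ 𝒯.cells, ∃ (c : Pt d) (r : ℝ),
    0 < r ∧ Metric.closedBall c r ⊆ hull T ∧ Metric.diam (hull T) ≤ s * r

/-- Quasi-uniformity with constant `s`: the diameters of all cells are comparable to `h`. -/
def QuasiUniform (s : ℝ) : Prop := ∀ T ∈ 𝒯.cells, 𝒯.h ≤ s * Metric.diam (hull T)

/-- The skeletal space `M`: `λ F` is the function on the face `F`, extended by zero off `F`.
It is polynomial of degree at most `p` on every face and vanishes on the faces in `∂Ω`. -/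
def M (p : ℕ) : Submodule ℝ (Finset (Pt d) → Pt d → ℝ) where
  carrier := {lam | (∀ F, 𝒯.IsFace F → ∃ P ∈ PolyDeg d p, lam F = (hull F).indicator (val P)) ∧
    (∀ F, 𝒯.IsFace F → hull F ⊆ frontier Ω → lam F = 0) ∧
    (∀ F, ¬ 𝒯.IsFace F → lam F = 0)}
  add_mem' := by
    rintro a b ⟨ha, ha', ha''⟩ ⟨hb, hb', hb''⟩
    refine ⟨fun F hF => ?_, fun F hF hF' => ?_, fun F hF => ?_⟩
    · obtain ⟨P, hP, hP'⟩ := ha F hF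
      obtain ⟨R, hR, hR'⟩ := hb F hF
      refine ⟨P + R, add_mem hP hR, ?_⟩
      funext x
      by_cases hx : x ∈ hull F <;> simp [hP', hR', hx, val]
    · simp [ha' F hF hF', hb' F hF hF']
    · simp [ha'' F hF, hb'' F hF]
  zero_mem' := by
    refine ⟨fun F _ => ⟨0, zero_mem _, ?_⟩, fun F _ _ => rfl, fun F _ => rfl⟩
    funext x
    by_cases hx : x ∈ hull F <;> simp [hx, val]
  smul_mem' := by
    rintro c a ⟨ha, ha', ha''⟩
    refine ⟨fun F hF => ?_, fun F hF hF' => ?_, fun F hF => ?_⟩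
    · obtain ⟨P, hP, hP'⟩ := ha F hF
      refine ⟨c • P, Submodule.smul_mem _ c hP, ?_⟩
      funext x
      by_cases hx : x ∈ hull F <;> simp [hP', hx, val]
    · simp [ha' F hF hF']
    · simp [ha'' F hF]

/-- The function on `Ω` which on each (open) cell `T` equals the polynomial `u T`. -/
def fn (u : Finset (Pt d) → Poly d) (x : Pt d) : ℝ :=
  ∑ T ∈ 𝒯.cells, (interior (hull T)).indicator (val (u T)) x

/-- The vector field on `Ω` which on each (open) cell `T` equals the polynomial field `q T`. -/
def vecFn (q : Finset (Pt d) → Fin d → Poly d) (x : Pt d) : Pt d :=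
  ∑ T ∈ 𝒯.cells, (interior (hull T)).indicator (vecVal (q T)) x

/-- The norm `‖f‖_ℓ`, that is the square root of `∑_T |T|/|∂T| ∫_{∂T} f² dσ`. The function
`f T F` is the trace on the face `F` from the side of the cell `T`. -/
def skelNorm (f : Finset (Pt d) → Finset (Pt d) → Pt d → ℝ) : ℝ :=
  Real.sqrt (∑ T ∈ 𝒯.cells, volRatio T * bdryIntegral T (fun F x => f T F x ^ 2))

/-- The conforming linear finite element space `V̄^c = {w ∈ H¹₀(Ω) : w|_T ∈ P₁(T) for all T}`. Its
elements are represented by the function which is affine on every closed cell. -/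
def ConformingP1 (w : Pt d → ℝ) : Prop :=
  MemH10 Ω w ∧ ∀ T ∈ 𝒯.cells, ∃ P ∈ PolyDeg d 1, ∀ x ∈ hull T, w x = val P x

open Classical in
/-- The trace `γ w` on the skeleton. -/
def trace (w : Pt d → ℝ) : Finset (Pt d) → Pt d → ℝ :=
  fun F => if 𝒯.IsFace F then (hull F).indicator w else 0

/-- `𝒯'` is a refinement of `𝒯`: each cell of `𝒯` is a union of cells of `𝒯'`. -/
def IsRefinedBy (𝒯' : SimplicialMesh d Ω) : Prop :=
  ∀ T ∈ 𝒯.cells, ∃ S ⊆ 𝒯'.cells, hull T = ⋃ T' ∈ S, hull T'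

end SimplicialMesh

/-- A hierarchy of meshes on the levels `0, …, L`, obtained by successive refinement. -/
structure MeshHierarchy (d : ℕ) (Ω : Set (Pt d)) (L : ℕ) where
  mesh : Fin (L + 1) → SimplicialMesh d Ω
  refined : ∀ ℓ : Fin L, (mesh ℓ.castSucc).IsRefinedBy (mesh ℓ.succ)

/-! ### HDG methods -/

/-- `(u, q)` solves the local problem on the cell `T` with local spaces `V`, `W`, penalty `τ` and
skeletal data `lam`. -/
structure IsLocalSolution (V : Submodule ℝ (Poly d)) (W : Submodule ℝ (Fin d → Poly d)) (τ : ℝ)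
    (T : Finset (Pt d)) (lam : Finset (Pt d) → Pt d → ℝ)
    (u : Poly d) (q : Fin d → Poly d) : Prop where
  mem_V : u ∈ V
  mem_W : q ∈ W
  primary : ∀ r ∈ W,
    (∫ x in hull T, inner ℝ (vecVal q x) (vecVal r x)) - ∫ x in hull T, val u x * val (polyDiv r) x
      = - bdryIntegral T (fun F x => lam F x * inner ℝ (vecVal r x) (outerNormal T F))
  flux : ∀ v ∈ V,
    bdryIntegral T (fun F x => (inner ℝ (vecVal q x) (outerNormal T F) + τ * val u x) * val v x)
      - ∫ x in hull T, inner ℝ (vecVal q x) (vecVal (polyGrad v) x)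
      = τ * bdryIntegral T (fun F x => lam F x * val v x)

/-- An HDG method on a mesh with skeletal polynomial degree `p`: local spaces `V_T`, `W_T` of
polynomials of degree at most `k`, a penalty coefficient `τ` (`τ = 0` gives hybridized mixed
methods), such that the local problems define a mapping `λ ↦ (u_T, q_T)`. -/
structure Method {Ω : Set (Pt d)} (𝒯 : SimplicialMesh d Ω) (p k : ℕ) where
  V : Finset (Pt d) → Submodule ℝ (Poly d)
  W : Finset (Pt d) → Submodule ℝ (Fin d → Poly d)
  τ : ℝ
  V_le : ∀ T ∈ 𝒯.cells, V T ≤ PolyDeg d k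
  W_le : ∀ T ∈ 𝒯.cells, ∀ q ∈ W T, ∀ i, q i ∈ PolyDeg d k
  τ_nonneg : 0 ≤ τ
  solvable : ∀ T ∈ 𝒯.cells, ∀ lam ∈ 𝒯.M p,
    ∃! uq : Poly d × (Fin d → Poly d), IsLocalSolution (V T) (W T) τ T lam uq.1 uq.2

namespace Method

variable {Ω : Set (Pt d)} {𝒯 : SimplicialMesh d Ω} {p k : ℕ} (S : Method 𝒯 p k)

open Classical in
/-- The local solution on the cell `T` (zero if `T` is not a cell). -/
def sol (lam : 𝒯.M p) (T : Finset (Pt d)) : Poly d × (Fin d → Poly d) :=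
  if hT : T ∈ 𝒯.cells then (S.solvable T hT lam lam.2).choose else 0

/-- The local solver `𝒰`, cell by cell. -/
def U (lam : 𝒯.M p) (T : Finset (Pt d)) : Poly d := (S.sol lam T).1

/-- The local solver `𝒬`, cell by cell. -/
def Q (lam : 𝒯.M p) (T : Finset (Pt d)) : Fin d → Poly d := (S.sol lam T).2

/-- `𝒰 λ - λ` on the face `F` from the side of the cell `T`. -/
def jump (lam : 𝒯.M p) (T F : Finset (Pt d)) (x : Pt d) : ℝ :=
  val (S.U lam T) x - (lam : Finset (Pt d) → Pt d → ℝ) F x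

/-- `‖𝒬 λ‖₀`. -/
def normQ (lam : 𝒯.M p) : ℝ := l2norm Ω (𝒯.vecFn (S.Q lam))

/-- The condensed bilinear form `a(λ, μ)`. -/
def a (lam mu : 𝒯.M p) : ℝ :=
  (∫ x in Ω, inner ℝ (𝒯.vecFn (S.Q lam) x) (𝒯.vecFn (S.Q mu) x)) +
    ∑ T ∈ 𝒯.cells, bdryIntegral T (fun F x => S.τ * S.jump lam T F x * S.jump mu T F x)

end Method

/-- The norm `‖λ‖_ℓ` of a skeletal function. -/
def normM {Ω : Set (Pt d)} {𝒯 : SimplicialMesh d Ω} {p : ℕ} (lam : 𝒯.M p) : ℝ :=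
  𝒯.skelNorm (fun _ F x => (lam : Finset (Pt d) → Pt d → ℝ) F x)

namespace Method

variable {Ω : Set (Pt d)} {𝒯 : SimplicialMesh d Ω} {p k : ℕ} (S : Method 𝒯 p k)

/-- `‖𝒰 μ - μ‖_ℓ ≤ c h ‖𝒬 μ‖₀`. -/
def LS1 (c : ℝ) : Prop := ∀ mu : 𝒯.M p, 𝒯.skelNorm (S.jump mu) ≤ c * 𝒯.h * S.normQ mu

/-- `‖𝒬 μ‖₀ ≤ c h⁻¹ ‖μ‖_ℓ` and `‖𝒰 μ‖₀ ≤ c ‖μ‖_ℓ`. -/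
def LS2 (c : ℝ) : Prop := ∀ mu : 𝒯.M p,
  S.normQ mu ≤ c * (𝒯.h)⁻¹ * normM mu ∧ l2norm Ω (𝒯.fn (S.U mu)) ≤ c * normM mu

/-- `‖𝒬 μ + ∇ 𝒰 μ‖₀ ≤ c h⁻¹ ‖𝒰 μ - μ‖_ℓ`, with the cellwise gradient. -/
def LS3 (c : ℝ) : Prop := ∀ mu : 𝒯.M p,
  l2norm Ω (𝒯.vecFn (fun T => S.Q mu T + polyGrad (S.U mu T)))
    ≤ c * (𝒯.h)⁻¹ * 𝒯.skelNorm (S.jump mu)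

/-- `𝒬 μ = -∇ w` and `𝒰 μ = w` if `μ = γ w` for a conforming linear finite element
function `w`. -/
def LS4 : Prop := ∀ w : Pt d → ℝ, 𝒯.ConformingP1 w → ∀ mu : 𝒯.M p,
  (mu : Finset (Pt d) → Pt d → ℝ) = 𝒯.trace w → ∀ T ∈ 𝒯.cells,
    (∀ x ∈ interior (hull T), vecVal (S.Q mu T) x = - ∇ w x) ∧
    (∀ x ∈ hull T, val (S.U mu T) x = w x)

end Method

section Injection

variable {Ω : Set (Pt d)} {𝒯c 𝒯f : SimplicialMesh d Ω} {p : ℕ}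

/-- `‖I λ‖_ℓ ≤ c ‖λ‖_{ℓ-1}`. -/
def IA1 (I : 𝒯c.M p →ₗ[ℝ] 𝒯f.M p) (c : ℝ) : Prop := ∀ lam : 𝒯c.M p, normM (I lam) ≤ c * normM lam

/-- `I γ_{ℓ-1} w = γ_ℓ w` for all conforming linear finite element functions `w` on the
coarse mesh. -/
def IA2 (I : 𝒯c.M p →ₗ[ℝ] 𝒯f.M p) : Prop := ∀ w : Pt d → ℝ, 𝒯c.ConformingP1 w → ∀ mu : 𝒯c.M p,
  (mu : Finset (Pt d) → Pt d → ℝ) = 𝒯c.trace w →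
    (I mu : Finset (Pt d) → Pt d → ℝ) = 𝒯f.trace w

/-- `P` is the Ritz quasi-projection: `a_{ℓ-1}(P λ, μ) = a_ℓ(λ, I μ)` for all `λ`, `μ`. -/
def IsRitz {k : ℕ} (Sc : Method 𝒯c p k) (Sf : Method 𝒯f p k) (I : 𝒯c.M p →ₗ[ℝ] 𝒯f.M p)
    (P : 𝒯f.M p →ₗ[ℝ] 𝒯c.M p) : Prop :=
  ∀ (lam : 𝒯f.M p) (mu : 𝒯c.M p), Sc.a (P lam) mu = Sf.a lam (I mu)

end Injection

end HDG

end

/-!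
Every `λ` in `M` is close to the trace of a conforming function. Choose for each interior vertex `z`
one of the values `𝒰λ|_T(z)` with `z ∈ T`, choose zero at the boundary vertices, and interpolate to
get `w ∈ V̄^c`. Two cells with a common facet see the same `λ` there, so the jump of `𝒰λ` between
them is bounded through (LS1), and the variation of `𝒰λ` within a cell through (LS3). Any two cells
at `z` are joined by a chain of cells at `z` with common facets, because a Lipschitz domain is
locally connected from inside and a generic segment avoids the faces of codimension two. Hence
`‖λ - γw‖ ≤ C h ‖𝒬λ‖₀`. Now split `λ = (λ - γw) + γw`. On the conforming part (IA2) and (LS4)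
produce the same `𝒬` and the same `𝒰` on both levels. On the remainder, (IA1) and (LS2) lose at most
the factor `h⁻¹` that the approximation estimate has gained.

If `a(λ, λ) = 0`, then `𝒬λ = 0`, so `λ = γw` for a conforming `w` with `∇w = -𝒬λ = 0`. Hence
`w = 0` and `λ = 0`, so `a` is an inner product on a finite-dimensional space and the Ritz
projection exists. The penalty term of `a` is at most `C τ h ‖𝒬λ‖₀²` by (LS1), which turns the
estimate for `𝒬` into the energy estimate, and Cauchy–Schwarz transfers that estimate to the
projection.
-/

noncomputable section

namespace HDG

variable {d : ℕ}

/-! ### Barycentric coordinates -/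

/-- `T` is the vertex set of a nondegenerate `d`-simplex. -/
structure IsSimplex (T : Finset (Pt d)) : Prop where
  card_eq : T.card = d + 1
  indep : AffineIndependent ℝ ((↑) : T → Pt d)

/-- The affine basis formed by the vertices of a simplex. -/
def IsSimplex.affineBasis {T : Finset (Pt d)} (hT : IsSimplex T) : AffineBasis T ℝ (Pt d) where
  toFun := (↑)
  ind' := hT.indep
  tot' := by
    rw [hT.indep.affineSpan_eq_top_iff_card_eq_finrank_add_one]
    simp [hT.card_eq]

open Classical in
/-- The barycentric coordinate with respect to the vertex `v` of the simplex `T`, as an affine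
function; it is zero if `T` is not a simplex or `v` is not a vertex of `T`. -/
def bary (T : Finset (Pt d)) (v : Pt d) : Pt d →ᵃ[ℝ] ℝ :=
  if h : IsSimplex T ∧ v ∈ T then h.1.affineBasis.coord ⟨v, h.2⟩ else 0

namespace IsSimplex

variable {T : Finset (Pt d)} (hT : IsSimplex T)
include hT

theorem bary_apply (v : T) (x : Pt d) : bary T v x = hT.affineBasis.coord v x := by
  simp [bary, hT]

theorem bary_self {v : Pt d} (hv : v ∈ T) : bary T v v = 1 := by
  rw [hT.bary_apply ⟨v, hv⟩]
  exact hT.affineBasis.coord_apply_eq ⟨v, hv⟩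

theorem bary_ne {v w : Pt d} (hv : v ∈ T) (hw : w ∈ T) (h : v ≠ w) : bary T v w = 0 := by
  rw [hT.bary_apply ⟨v, hv⟩]
  exact hT.affineBasis.coord_apply_ne (i := ⟨v, hv⟩) (j := ⟨w, hw⟩) (by simpa using h)

theorem sum_bary (x : Pt d) : ∑ v ∈ T, bary T v x = 1 := by
  rw [← Finset.sum_coe_sort, ← hT.affineBasis.sum_coord_apply_eq_one x]
  exact Finset.sum_congr rfl fun v _ => hT.bary_apply v x

theorem sum_bary_smul (x : Pt d) : ∑ v ∈ T, bary T v x • v = x := by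
  rw [← Finset.sum_coe_sort]
  conv_rhs => rw [← hT.affineBasis.linear_combination_coord_eq_self x]
  exact Finset.sum_congr rfl fun v _ => by rw [hT.bary_apply v x]; rfl

theorem range_affineBasis : Set.range hT.affineBasis = (T : Set (Pt d)) :=
  Subtype.range_coe

theorem mem_hull_iff {x : Pt d} : x ∈ hull T ↔ ∀ v ∈ T, 0 ≤ bary T v x := by
  rw [hull, ← hT.range_affineBasis, AffineBasis.convexHull_eq_nonneg_coord]
  exact ⟨fun h v hv => hT.bary_apply ⟨v, hv⟩ x ▸ h ⟨v, hv⟩,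
    fun h v => hT.bary_apply v x ▸ h v v.2⟩

theorem mem_interior_iff {x : Pt d} : x ∈ interior (hull T) ↔ ∀ v ∈ T, 0 < bary T v x := by
  rw [hull, ← hT.range_affineBasis, AffineBasis.interior_convexHull]
  exact ⟨fun h v hv => hT.bary_apply ⟨v, hv⟩ x ▸ h ⟨v, hv⟩,
    fun h v => hT.bary_apply v x ▸ h v v.2⟩

theorem affineMap_apply (f : Pt d →ᵃ[ℝ] ℝ) (x : Pt d) : f x = ∑ v ∈ T, bary T v x * f v := by
  have h := Finset.map_affineCombination T (fun v => v) (fun v => bary T v x) (hT.sum_bary x) f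
  rw [Finset.affineCombination_eq_linear_combination _ _ _ (hT.sum_bary x), hT.sum_bary_smul,
    Finset.affineCombination_eq_linear_combination _ _ _ (hT.sum_bary x)] at h
  simpa using h

theorem mem_hull_of_bary_eq_zero {S : Finset (Pt d)} {x : Pt d} (hx : x ∈ hull T)
    (hS : S ⊆ T) (h : ∀ v ∈ T, v ∉ S → bary T v x = 0) : x ∈ hull S := by
  have sum_eq_one : ∑ v ∈ S, bary T v x = 1 := by
    rw [← hT.sum_bary x]
    exact Finset.sum_subset hS h
  have sum_smul_eq : ∑ v ∈ S, bary T v x • v = x := by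
    conv_rhs => rw [← hT.sum_bary_smul x]
    exact Finset.sum_subset hS fun v hv hv' => by rw [h v hv hv', zero_smul]
  rw [← sum_smul_eq]
  exact (convex_convexHull ℝ _).sum_mem (fun v hv => hT.mem_hull_iff.1 hx v (hS hv)) sum_eq_one
    fun v hv => subset_convexHull ℝ _ hv

theorem bary_eq_zero_of_mem_hull {S : Finset (Pt d)} {x v : Pt d} (hx : x ∈ hull S)
    (hS : S ⊆ T) (hv : v ∈ T) (hvS : v ∉ S) : bary T v x = 0 := by
  have hull_subset : hull S ⊆ bary T v ⁻¹' {0} :=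
    convexHull_min (fun w hw => hT.bary_ne hv (hS hw) fun h => hvS (h ▸ hw))
      ((convex_singleton 0).affine_preimage _)
  exact hull_subset hx

theorem mem_of_mem_hull {S : Finset (Pt d)} {v : Pt d} (hS : S ⊆ T) (hv : v ∈ T)
    (hx : v ∈ hull S) : v ∈ S := by
  by_contra h
  exact one_ne_zero ((hT.bary_self hv).symm.trans (hT.bary_eq_zero_of_mem_hull hx hS hv h))

theorem interior_nonempty : (interior (hull T)).Nonempty := by
  rw [interior_convexHull_nonempty_iff_affineSpan_eq_top, ← hT.range_affineBasis]
  exact hT.affineBasis.tot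

theorem closure_interior : closure (interior (hull T)) = hull T := by
  rw [(convex_convexHull ℝ _).closure_interior_eq_closure_of_nonempty_interior hT.interior_nonempty]
  exact (T.finite_toSet.isCompact_convexHull (𝕜 := ℝ)).isClosed.closure_eq

theorem inter_interior_nonempty {U : Set (Pt d)} (hU : IsOpen U) (h : (U ∩ hull T).Nonempty) :
    (U ∩ interior (hull T)).Nonempty := by
  obtain ⟨x, hxU, hx⟩ := h
  rw [← hT.closure_interior] at hx
  exact mem_closure_iff.1 hx U hU hxU

end IsSimplex

theorem continuous_bary (T : Finset (Pt d)) (v : Pt d) : Continuous (bary T v) :=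
  (bary T v).continuous_of_finiteDimensional

theorem isCompact_hull (S : Finset (Pt d)) : IsCompact (hull S) :=
  S.finite_toSet.isCompact_convexHull (𝕜 := ℝ)

theorem isClosed_hull (S : Finset (Pt d)) : IsClosed (hull S) := (isCompact_hull S).isClosed

theorem hull_mono {S S' : Finset (Pt d)} (h : S ⊆ S') : hull S ⊆ hull S' :=
  convexHull_mono (by exact_mod_cast h)

theorem mem_hull_of_mem {S : Finset (Pt d)} {v : Pt d} (h : v ∈ S) : v ∈ hull S :=
  subset_convexHull ℝ _ h

theorem affineSpan_ne_top_of_card_le {S : Finset (Pt d)} (h : S.card ≤ d) :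
    affineSpan ℝ (S : Set (Pt d)) ≠ ⊤ := by
  intro htop
  rcases S.eq_empty_or_nonempty with rfl | hne
  · simp at htop
  · have vectorSpan_eq_top : vectorSpan ℝ (S : Set (Pt d)) = ⊤ := by
      rw [← direction_affineSpan, htop, AffineSubspace.direction_top]
    have card_eq : S.card = (S.card - 1) + 1 := by have := hne.card_pos; omega
    have finrank_le := finrank_vectorSpan_image_finset_le ℝ (id : Pt d → Pt d) S card_eq
    rw [Finset.image_id, vectorSpan_eq_top, finrank_top, finrank_euclideanSpace_fin] at finrank_le
    omega

theorem volume_affineSpan_eq_zero {S : Finset (Pt d)} (h : S.card ≤ d) :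
    volume (affineSpan ℝ (S : Set (Pt d)) : Set (Pt d)) = 0 :=
  Measure.addHaar_affineSubspace _ _ (affineSpan_ne_top_of_card_le h)

theorem interior_hull_eq_empty {S : Finset (Pt d)} (h : S.card ≤ d) : interior (hull S) = ∅ := by
  rw [← Set.not_nonempty_iff_eq_empty, interior_convexHull_nonempty_iff_affineSpan_eq_top]
  exact affineSpan_ne_top_of_card_le h

theorem volume_frontier_hull (S : Finset (Pt d)) : volume (frontier (hull S)) = 0 :=
  (convex_convexHull ℝ _).addHaar_frontier _

/-! ### Lipschitz domains -/

/-- Near `x`, the set `Ω` is the strict epigraph, in the unit direction `e`, of the `K`-Lipschitz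
function `φ` of the component orthogonal to `e`. These are the data which
`IsLipschitzDomain.graph` provides at a boundary point. -/
structure IsEpigraphNear (Ω : Set (Pt d)) (x e : Pt d) (φ : Pt d → ℝ) (K : ℝ≥0) (r : ℝ) :
    Prop where
  norm_eq : ‖e‖ = 1
  lipschitz : LipschitzWith K φ
  add_smul_eq : ∀ (y : Pt d) (t : ℝ), φ (y + t • e) = φ y
  radius_pos : 0 < r
  mem_iff : ∀ y ∈ Metric.ball x r, (y ∈ Ω ↔ φ y < inner ℝ e y)

namespace IsEpigraphNear

variable {Ω : Set (Pt d)} {x e : Pt d} {φ : Pt d → ℝ} {K : ℝ≥0} {r : ℝ}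
  (h : IsEpigraphNear Ω x e φ K r)
include h

theorem inner_add_smul (y : Pt d) (t : ℝ) : inner ℝ e (y + t • e) = inner ℝ e y + t := by
  rw [inner_add_right, inner_smul_right, real_inner_self_eq_norm_sq, h.norm_eq]
  ring

theorem le_inner_of_mem_closure {y : Pt d} (hy : y ∈ Metric.ball x r) (hyΩ : y ∈ closure Ω) :
    φ y ≤ inner ℝ e y := by
  by_contra! hlt
  obtain ⟨z, ⟨hzb, hz⟩, hzΩ⟩ := mem_closure_iff.1 hyΩ
    (Metric.ball x r ∩ {z | inner ℝ e z < φ z})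
    (Metric.isOpen_ball.inter
      (isOpen_lt (continuous_const.inner continuous_id) h.lipschitz.continuous)) ⟨hy, hlt⟩
  exact lt_asymm hz ((h.mem_iff z hzb).1 hzΩ)

theorem add_smul_mem_ball {z : Pt d} {δ s t : ℝ} (hz : z ∈ Metric.ball x δ) (hs : 0 ≤ s)
    (hst : s ≤ t) : z + s • e ∈ Metric.ball x (δ + t) := by
  rw [mem_ball_iff_norm] at hz ⊢
  calc ‖z + s • e - x‖ = ‖(z - x) + s • e‖ := by rw [add_sub_right_comm]
    _ ≤ ‖z - x‖ + ‖s • e‖ := norm_add_le _ _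
    _ < δ + t := by rw [norm_smul, h.norm_eq, Real.norm_of_nonneg hs]; linarith

theorem segment_add_smul_subset {z : Pt d} {δ t : ℝ} (ht : 0 ≤ t) (hδt : δ + t ≤ r)
    (hz : z ∈ Metric.ball x δ) (hzΩ : z ∈ Ω) :
    segment ℝ z (z + t • e) ⊆ Ω ∩ Metric.ball x (δ + t) := by
  rw [segment_eq_image']
  rintro _ ⟨θ, ⟨hθ, hθ'⟩, rfl⟩
  have hθt : 0 ≤ θ * t := mul_nonneg hθ ht
  have hball := h.add_smul_mem_ball hz hθt (mul_le_of_le_one_left ht hθ')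
  simp only [add_sub_cancel_left, smul_smul]
  refine ⟨(h.mem_iff _ (Metric.ball_subset_ball hδt hball)).2 ?_, hball⟩
  have := (h.mem_iff z (Metric.ball_subset_ball (by linarith) hz)).1 hzΩ
  rw [h.add_smul_eq, h.inner_add_smul]
  linarith

theorem add_smul_mem {z : Pt d} {δ t : ℝ} (hx : x ∈ closure Ω) (ht : (K + 1) * δ ≤ t)
    (hδt : δ + t ≤ r) (hz : z ∈ Metric.ball x δ) : z + t • e ∈ Ω ∩ Metric.ball x (δ + t) := by
  have hδ : 0 ≤ δ := (Metric.pos_of_mem_ball hz).le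
  have hball := h.add_smul_mem_ball hz (le_trans (by positivity) ht) le_rfl
  refine ⟨(h.mem_iff _ (Metric.ball_subset_ball hδt hball)).2 ?_, hball⟩
  rw [h.add_smul_eq, h.inner_add_smul]
  have dist_lt : ‖z - x‖ < δ := mem_ball_iff_norm.1 hz
  have φ_le : φ z - φ x ≤ K * δ := by
    refine (le_abs_self _).trans ((h.lipschitz.dist_le_mul z x).trans ?_)
    rw [dist_eq_norm]
    gcongr
  have inner_lt : inner ℝ e x - inner ℝ e z < δ := by
    have := real_inner_le_norm e (x - z)
    rw [inner_sub_right, h.norm_eq, one_mul, norm_sub_rev] at this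
    linarith
  have := h.le_inner_of_mem_closure (Metric.mem_ball_self h.radius_pos) hx
  linarith

theorem exists_joinedIn (hx : x ∈ closure Ω) {ε : ℝ} (hε : 0 < ε) :
    ∃ δ > 0, ∀ y ∈ Ω ∩ Metric.ball x δ, ∀ z ∈ Ω ∩ Metric.ball x δ,
      JoinedIn (Ω ∩ Metric.ball x ε) y z := by
  set δ : ℝ := min r ε / (K + 2)
  set t : ℝ := (K + 1) * δ
  have hδ : 0 < δ := div_pos (lt_min h.radius_pos hε) (by positivity)
  have ht : 0 ≤ t := by positivity
  have hδt : δ + t = min r ε := by simp only [t, δ]; field_simp; ring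
  have hball : Ω ∩ Metric.ball x (δ + t) ⊆ Ω ∩ Metric.ball x ε :=
    Set.inter_subset_inter_right _ (Metric.ball_subset_ball (hδt ▸ min_le_right _ _))
  have hr : δ + t ≤ r := hδt ▸ min_le_left _ _
  refine ⟨δ, hδ, fun y hy z hz => ?_⟩
  have horizontal : segment ℝ (y + t • e) (z + t • e) ⊆ Ω ∩ Metric.ball x (δ + t) := by
    rw [add_comm y, add_comm z, ← segment_translate_image]
    rintro _ ⟨w, hw, rfl⟩
    simp only [add_comm (t • e) w]
    exact h.add_smul_mem hx le_rfl hr ((convex_ball x δ).segment_subset hy.2 hz.2 hw)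
  -- The path climbs from `y`, moves horizontally above the graph, and descends to `z`.
  exact ((JoinedIn.of_segment_subset (h.segment_add_smul_subset ht hr hy.2 hy.1)).trans
    ((JoinedIn.of_segment_subset horizontal).trans
      (JoinedIn.of_segment_subset (h.segment_add_smul_subset ht hr hz.2 hz.1)).symm)).mono hball

end IsEpigraphNear

namespace IsLipschitzDomain

variable {Ω : Set (Pt d)} (hΩ : IsLipschitzDomain Ω)
include hΩ

theorem exists_isEpigraphNear {x : Pt d} (hx : x ∈ frontier Ω) :
    ∃ e φ K r, IsEpigraphNear Ω x e φ K r := by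
  obtain ⟨e, φ, K, r, he, hφ, hinv, hr, hmem⟩ := hΩ.graph x hx
  exact ⟨e, φ, K, r, he, hφ, hinv, hr, hmem⟩

theorem mem_frontier_iff {x : Pt d} : x ∈ frontier Ω ↔ x ∈ closure Ω ∧ x ∉ Ω := by
  rw [frontier, hΩ.isOpen.interior_eq, Set.mem_sdiff]

theorem exists_notMem_closure {x : Pt d} (hx : x ∈ frontier Ω) {ε : ℝ} (hε : 0 < ε) :
    ∃ y ∈ Metric.ball x ε, y ∉ closure Ω := by
  obtain ⟨e, φ, K, r, h⟩ := hΩ.exists_isEpigraphNear hx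
  set t : ℝ := min ε r / 2
  have ht : 0 < t := half_pos (lt_min hε h.radius_pos)
  have hball : x + (-t) • e ∈ Metric.ball x (min ε r) := by
    rw [mem_ball_iff_norm, add_sub_cancel_left, norm_smul, norm_neg, h.norm_eq, mul_one,
      Real.norm_of_nonneg ht.le]
    exact half_lt_self (lt_min hε h.radius_pos)
  refine ⟨x + (-t) • e, Metric.ball_subset_ball (min_le_left _ _) hball, fun hcl => ?_⟩
  have hle := h.le_inner_of_mem_closure (Metric.ball_subset_ball (min_le_right _ _) hball) hcl
  rw [h.add_smul_eq, h.inner_add_smul] at hle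
  exact (hΩ.mem_frontier_iff.1 hx).2
    ((h.mem_iff x (Metric.mem_ball_self h.radius_pos)).2 (by linarith))

theorem interior_closure : interior (closure Ω) = Ω := by
  refine subset_antisymm (fun x hx => ?_) (hΩ.isOpen.subset_interior_iff.2 subset_closure)
  by_contra hxΩ
  obtain ⟨ε, hε, hball⟩ := Metric.isOpen_iff.1 isOpen_interior x hx
  obtain ⟨y, hy, hyc⟩ :=
    hΩ.exists_notMem_closure (hΩ.mem_frontier_iff.2 ⟨interior_subset hx, hxΩ⟩) hε
  exact hyc (interior_subset (hball hy))

theorem exists_joinedIn {x : Pt d} (hx : x ∈ closure Ω) {ε : ℝ} (hε : 0 < ε) :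
    ∃ δ > 0, ∀ y ∈ Ω ∩ Metric.ball x δ, ∀ z ∈ Ω ∩ Metric.ball x δ,
      JoinedIn (Ω ∩ Metric.ball x ε) y z := by
  by_cases hxΩ : x ∈ Ω
  · obtain ⟨r, hr, hball⟩ := Metric.isOpen_iff.1 hΩ.isOpen x hxΩ
    refine ⟨min r ε, lt_min hr hε, fun y hy z hz => JoinedIn.of_segment_subset ?_⟩
    exact ((convex_ball x (min r ε)).segment_subset hy.2 hz.2).trans (Set.subset_inter
      ((Metric.ball_subset_ball (min_le_left _ _)).trans hball)
      (Metric.ball_subset_ball (min_le_right _ _)))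
  · obtain ⟨e, φ, K, r, h⟩ := hΩ.exists_isEpigraphNear (hΩ.mem_frontier_iff.2 ⟨hx, hxΩ⟩)
    exact h.exists_joinedIn hx hε

end IsLipschitzDomain

/-! ### Cells of a mesh -/

namespace SimplicialMesh

variable {Ω : Set (Pt d)} (𝒯 : SimplicialMesh d Ω)

theorem isSimplex {T : Finset (Pt d)} (hT : T ∈ 𝒯.cells) : IsSimplex T :=
  ⟨𝒯.card_eq T hT, 𝒯.indep T hT⟩

open Classical in
theorem hull_inter_hull {T T' : Finset (Pt d)} (hT : T ∈ 𝒯.cells) (hT' : T' ∈ 𝒯.cells) :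
    hull T ∩ hull T' = hull (T ∩ T') := by
  rw [𝒯.inter T hT T' hT']; simp [hull]

open Classical in
theorem card_inter_le {T T' : Finset (Pt d)} (hT : T ∈ 𝒯.cells) (hT' : T' ∈ 𝒯.cells)
    (h : T ≠ T') : (T ∩ T').card ≤ d := by
  by_contra hc
  have inter_eq_left : T ∩ T' = T := Finset.eq_of_subset_of_card_le Finset.inter_subset_left
    (by rw [𝒯.card_eq T hT]; omega)
  have inter_eq_right : T ∩ T' = T' := Finset.eq_of_subset_of_card_le Finset.inter_subset_right
    (by rw [𝒯.card_eq T' hT']; omega)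
  exact h (inter_eq_left.symm.trans inter_eq_right)

theorem eq_of_isOpen_subset {T T' : Finset (Pt d)} (hT : T ∈ 𝒯.cells) (hT' : T' ∈ 𝒯.cells)
    {U : Set (Pt d)} (hU : IsOpen U) (hne : U.Nonempty) (hUT : U ⊆ hull T) (hUT' : U ⊆ hull T') :
    T = T' := by
  classical
  by_contra h
  have hsub : U ⊆ interior (hull (T ∩ T')) := by
    rw [hU.subset_interior_iff, ← 𝒯.hull_inter_hull hT hT']
    exact Set.subset_inter hUT hUT'
  rw [interior_hull_eq_empty (𝒯.card_inter_le hT hT' h)] at hsub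
  exact hne.not_subset_empty hsub

theorem eq_of_interior_inter_nonempty {T T' : Finset (Pt d)} (hT : T ∈ 𝒯.cells)
    (hT' : T' ∈ 𝒯.cells) (h : (interior (hull T) ∩ hull T').Nonempty) : T = T' :=
  𝒯.eq_of_isOpen_subset hT hT' (isOpen_interior.inter isOpen_interior)
    ((𝒯.isSimplex hT').inter_interior_nonempty isOpen_interior h)
    (Set.inter_subset_left.trans interior_subset) (Set.inter_subset_right.trans interior_subset)

theorem hull_subset_closure {T : Finset (Pt d)} (hT : T ∈ 𝒯.cells) : hull T ⊆ closure Ω := by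
  rw [← 𝒯.cover]; exact Set.subset_biUnion_of_mem (u := fun T => hull T) hT

theorem exists_cell {x : Pt d} (hx : x ∈ closure Ω) : ∃ T ∈ 𝒯.cells, x ∈ hull T := by
  rw [← 𝒯.cover] at hx
  simpa using hx

theorem interior_hull_subset (hΩ : IsLipschitzDomain Ω) {T : Finset (Pt d)} (hT : T ∈ 𝒯.cells) :
    interior (hull T) ⊆ Ω := by
  rw [← hΩ.interior_closure]
  exact interior_mono (𝒯.hull_subset_closure hT)

end SimplicialMesh

/-! ### Generic segments -/

theorem exists_notMem_affineSpan {C : Finset (Finset (Pt d))} (hC : ∀ S ∈ C, S.card ≤ d)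
    {U : Set (Pt d)} (hU : IsOpen U) (hne : U.Nonempty) :
    ∃ x ∈ U, ∀ S ∈ C, x ∉ affineSpan ℝ (S : Set (Pt d)) := by
  have null : volume (⋃ S ∈ C, (affineSpan ℝ (S : Set (Pt d)) : Set (Pt d))) = 0 :=
    (measure_biUnion_null_iff C.countable_toSet).2 fun S hS => volume_affineSpan_eq_zero (hC S hS)
  by_contra! h
  refine (hU.measure_pos volume hne).ne' (measure_mono_null (fun x hx => ?_) null)
  obtain ⟨S, hS, hxS⟩ := h x hx
  exact Set.mem_biUnion hS hxS

theorem exists_segment_avoiding_affineSpan {C : Finset (Finset (Pt d))}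
    (hC : ∀ S ∈ C, S.card < d) {y : Pt d} (hy : ∀ S ∈ C, y ∉ affineSpan ℝ (S : Set (Pt d)))
    {U : Set (Pt d)} (hU : IsOpen U) (hne : U.Nonempty) :
    ∃ x ∈ U, ∀ z ∈ segment ℝ x y, ∀ S ∈ C, z ∉ affineSpan ℝ (S : Set (Pt d)) := by
  classical
  -- It suffices that `x` avoids the spans of the sets `insert y S`, which are still null sets.
  obtain ⟨x, hxU, hx⟩ := exists_notMem_affineSpan (C := C.image (insert y))
    (Finset.forall_mem_image.2 fun S hS => (Finset.card_insert_le _ _).trans (hC S hS)) hU hne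
  refine ⟨x, hxU, fun z hz S hS hzS => hx _ (Finset.mem_image_of_mem _ hS) ?_⟩
  have hzy : z ≠ y := fun h => hy S hS (h ▸ hzS)
  rw [segment_symm, segment_eq_image_lineMap] at hz
  obtain ⟨θ, -, rfl⟩ := hz
  have hθ : θ ≠ 0 := by rintro rfl; simp at hzy
  have hy_mem : y ∈ affineSpan ℝ ((insert y S : Finset (Pt d)) : Set (Pt d)) :=
    subset_affineSpan ℝ _ (by simp)
  have hz_mem : AffineMap.lineMap y x θ ∈
      affineSpan ℝ ((insert y S : Finset (Pt d)) : Set (Pt d)) :=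
    affineSpan_mono ℝ (by simp) hzS
  have hx_eq : AffineMap.lineMap y (AffineMap.lineMap y x θ) θ⁻¹ = x := by
    simp [AffineMap.lineMap_apply, smul_smul, hθ]
  exact hx_eq ▸ AffineMap.lineMap_mem θ⁻¹ hy_mem hz_mem

theorem exists_ball_avoiding (C : Finset (Finset (Pt d))) (v : Pt d) :
    ∃ ε > 0, ∀ S ∈ C, (Metric.ball v ε ∩ hull S).Nonempty → v ∈ hull S := by
  classical
  have hclosed : IsClosed (⋃ S ∈ C.filter (fun S => v ∉ hull S), hull S) :=
    (Finset.finite_toSet _).isClosed_biUnion fun T _ => isClosed_hull T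
  obtain ⟨ε, hε, hball⟩ := Metric.isOpen_iff.1 hclosed.isOpen_compl v (by simp)
  refine ⟨ε, hε, fun S hS ⟨x, hx, hxS⟩ => ?_⟩
  by_contra h
  exact hball hx (Set.mem_biUnion (x := S) (by simp [hS, h]) hxS)

/-! ### Facets of a simplex -/

theorem mem_facets_iff {T F : Finset (Pt d)} (hT : IsSimplex T) :
    F ∈ facets T ↔ ∃ a ∈ T, F = T.erase a := by
  rw [facets, Finset.mem_powersetCard]
  constructor
  · rintro ⟨hF, hcard⟩
    have card_sdiff : (T \ F).card = 1 := by
      rw [Finset.card_sdiff_of_subset hF, hT.card_eq, hcard]; omega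
    obtain ⟨a, ha⟩ := Finset.card_eq_one.1 card_sdiff
    refine ⟨a, (Finset.mem_sdiff.1 (ha ▸ Finset.mem_singleton_self a)).1, ?_⟩
    rw [Finset.erase_eq, ← ha, Finset.sdiff_sdiff_eq_self hF]
  · rintro ⟨a, ha, rfl⟩
    exact ⟨Finset.erase_subset _ _, by rw [Finset.card_erase_of_mem ha, hT.card_eq]; simp⟩

namespace IsSimplex

variable {T : Finset (Pt d)} (hT : IsSimplex T)
include hT

theorem exists_facet_of_notMem_interior {z : Pt d} (hz : z ∈ hull T)
    (hz' : z ∉ interior (hull T)) : ∃ F ∈ facets T, z ∈ hull F := by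
  rw [hT.mem_interior_iff] at hz'
  push Not at hz'
  obtain ⟨a, ha, hle⟩ := hz'
  refine ⟨T.erase a, (mem_facets_iff hT).2 ⟨a, ha, rfl⟩,
    hT.mem_hull_of_bary_eq_zero hz (Finset.erase_subset _ _) fun v hv hv' => ?_⟩
  obtain rfl : v = a := by
    by_contra hne
    exact hv' (Finset.mem_erase.2 ⟨hne, hv⟩)
  exact le_antisymm hle (hT.mem_hull_iff.1 hz v ha)

theorem eventually_mem_hull_iff {a z : Pt d} (ha : a ∈ T)
    (hpos : ∀ v ∈ T.erase a, 0 < bary T v z) :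
    ∀ᶠ y in 𝓝 z, (y ∈ hull T ↔ 0 ≤ bary T a y) := by
  have : ∀ᶠ y in 𝓝 z, ∀ v ∈ T.erase a, 0 < bary T v y :=
    (Filter.eventually_all_finset _).2 fun v hv =>
      (continuous_bary T v).continuousAt.eventually_const_lt (hpos v hv)
  filter_upwards [this] with y hy
  rw [hT.mem_hull_iff]
  refine ⟨fun h => h a ha, fun h v hv => ?_⟩
  by_cases hva : v = a
  · rwa [hva]
  · exact (hy v (Finset.mem_erase.2 ⟨hva, hv⟩)).le

theorem bary_eq_mul_of_erase_eq {T' : Finset (Pt d)} (hT' : IsSimplex T') {a a' : Pt d}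
    (ha : a ∈ T) (ha' : a' ∈ T') (h : T.erase a = T'.erase a') (y : Pt d) :
    bary T' a' y = bary T a y * bary T' a' a := by
  rw [hT.affineMap_apply (bary T' a') y]
  refine Finset.sum_eq_single a (fun v hv hva => ?_) (fun h => absurd ha h)
  obtain ⟨hva', hv'⟩ := Finset.mem_erase.1 (h ▸ Finset.mem_erase.2 ⟨hva, hv⟩)
  rw [hT'.bary_ne ha' hv' hva'.symm, mul_zero]

end IsSimplex

namespace SimplicialMesh

variable {Ω : Set (Pt d)} (𝒯 : SimplicialMesh d Ω)

/-! ### The skeleton of codimension two -/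

open Classical in
/-- The sets of at most `d - 1` vertices of a cell. -/
def codimTwoFaces : Finset (Finset (Pt d)) :=
  𝒯.cells.biUnion fun T => T.powerset.filter fun S => S.card < d

/-- The union of the affine spans of the faces of codimension at least two. A generic segment
avoids this set, hence passes from one cell to the next through the relative interior of a common
facet. -/
def codimTwoSkeleton : Set (Pt d) :=
  ⋃ S ∈ 𝒯.codimTwoFaces, (affineSpan ℝ (S : Set (Pt d)) : Set (Pt d))

theorem notMem_codimTwoSkeleton {x : Pt d} :
    x ∉ 𝒯.codimTwoSkeleton ↔ ∀ S ∈ 𝒯.codimTwoFaces, x ∉ affineSpan ℝ (S : Set (Pt d)) := by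
  simp only [codimTwoSkeleton, Set.mem_iUnion, SetLike.mem_coe, exists_prop, not_exists, not_and]

theorem card_lt_of_mem_codimTwoFaces {S : Finset (Pt d)} (hS : S ∈ 𝒯.codimTwoFaces) :
    S.card < d := by
  simp only [codimTwoFaces, Finset.mem_biUnion, Finset.mem_filter] at hS
  obtain ⟨T, -, -, hcard⟩ := hS
  exact hcard

theorem mem_codimTwoSkeleton {T S : Finset (Pt d)} (hT : T ∈ 𝒯.cells) (hS : S ⊆ T)
    (hcard : S.card < d) {x : Pt d} (hx : x ∈ hull S) : x ∈ 𝒯.codimTwoSkeleton := by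
  refine Set.mem_biUnion (x := S) ?_ (convexHull_subset_affineSpan _ hx)
  simp only [codimTwoFaces, SetLike.mem_coe, Finset.mem_biUnion, Finset.mem_filter,
    Finset.mem_powerset]
  exact ⟨T, hT, hS, hcard⟩

theorem exists_notMem_codimTwoSkeleton {U : Set (Pt d)} (hU : IsOpen U) (hne : U.Nonempty) :
    ∃ x ∈ U, x ∉ 𝒯.codimTwoSkeleton := by
  simp only [notMem_codimTwoSkeleton]
  exact exists_notMem_affineSpan (fun S hS => (𝒯.card_lt_of_mem_codimTwoFaces hS).le) hU hne

theorem exists_segment_avoiding_codimTwoSkeleton {y : Pt d} (hy : y ∉ 𝒯.codimTwoSkeleton)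
    {U : Set (Pt d)} (hU : IsOpen U) (hne : U.Nonempty) :
    ∃ x ∈ U, ∀ z ∈ segment ℝ x y, z ∉ 𝒯.codimTwoSkeleton := by
  simp only [notMem_codimTwoSkeleton] at hy ⊢
  exact exists_segment_avoiding_affineSpan (fun S hS => 𝒯.card_lt_of_mem_codimTwoFaces hS) hy hU hne

theorem bary_pos_of_notMem_codimTwoSkeleton {T : Finset (Pt d)} (hT : T ∈ 𝒯.cells)
    {a : Pt d} (ha : a ∈ T) {x : Pt d} (hx : x ∈ hull (T.erase a))
    (hxs : x ∉ 𝒯.codimTwoSkeleton) {v : Pt d} (hv : v ∈ T.erase a) : 0 < bary T v x := by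
  have hS := 𝒯.isSimplex hT
  have hsub : (T.erase a).erase v ⊆ T :=
    (Finset.erase_subset _ _).trans (Finset.erase_subset _ _)
  have hxT : x ∈ hull T := hull_mono (Finset.erase_subset _ _) hx
  refine (hS.mem_hull_iff.1 hxT v (Finset.mem_of_mem_erase hv)).lt_of_ne fun h => hxs ?_
  refine 𝒯.mem_codimTwoSkeleton hT hsub ?_ (hS.mem_hull_of_bary_eq_zero hxT hsub ?_)
  · have card_erase : (T.erase a).card = d := by
      rw [Finset.card_erase_of_mem ha, hS.card_eq, Nat.add_sub_cancel]
    exact (Finset.card_erase_lt_of_mem hv).trans_eq card_erase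
  · intro w hw hw'
    by_cases hwv : w = v
    · rw [hwv, ← h]
    · exact hS.bary_eq_zero_of_mem_hull hx (Finset.erase_subset _ _) hw
        fun hwa => hw' (Finset.mem_erase.2 ⟨hwv, hwa⟩)

/-! ### Stars are connected through facets -/

theorem isClosed_biUnion_hull (A : Finset (Finset (Pt d))) : IsClosed (⋃ T ∈ A, hull T) :=
  A.finite_toSet.isClosed_biUnion fun T _ => isClosed_hull T

theorem exists_inter_interior_nonempty {A : Finset (Finset (Pt d))} (hA : A ⊆ 𝒯.cells)
    {O : Set (Pt d)} (hO : IsOpen O) (h : (O ∩ ⋃ T ∈ A, hull T).Nonempty) :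
    ∃ T ∈ A, (O ∩ interior (hull T)).Nonempty := by
  obtain ⟨x, hxO, hx⟩ := h
  simp only [Set.mem_iUnion, exists_prop] at hx
  obtain ⟨T, hT, hxT⟩ := hx
  exact ⟨T, hT, (𝒯.isSimplex (hA hT)).inter_interior_nonempty hO ⟨x, hxO, hxT⟩⟩

open Classical in
theorem exists_le_card_inter_of_convex {A B : Finset (Finset (Pt d))} (hA : A ⊆ 𝒯.cells)
    (hB : B ⊆ 𝒯.cells) {O : Set (Pt d)} (hO : IsOpen O) (hconv : Convex ℝ O)
    (hcov : O ⊆ (⋃ T ∈ A, hull T) ∪ ⋃ T ∈ B, hull T)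
    (hOA : (O ∩ ⋃ T ∈ A, hull T).Nonempty) (hOB : (O ∩ ⋃ T ∈ B, hull T).Nonempty) :
    ∃ T ∈ A, ∃ T' ∈ B, d ≤ (T ∩ T').card := by
  obtain ⟨TA, hTA, hneA⟩ := 𝒯.exists_inter_interior_nonempty hA hO hOA
  obtain ⟨TB, hTB, hneB⟩ := 𝒯.exists_inter_interior_nonempty hB hO hOB
  obtain ⟨y, hy, hys⟩ := 𝒯.exists_notMem_codimTwoSkeleton (hO.inter isOpen_interior) hneB
  obtain ⟨x, hx, hseg⟩ :=
    𝒯.exists_segment_avoiding_codimTwoSkeleton hys (hO.inter isOpen_interior) hneA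
  obtain ⟨z, hz, hzA, hzB⟩ := isPreconnected_closed_iff.1 (convex_segment x y).isPreconnected _ _
    (isClosed_biUnion_hull A) (isClosed_biUnion_hull B)
    ((hconv.segment_subset hx.1 hy.1).trans hcov)
    ⟨x, left_mem_segment ℝ _ _, Set.mem_biUnion hTA (interior_subset hx.2)⟩
    ⟨y, right_mem_segment ℝ _ _, Set.mem_biUnion hTB (interior_subset hy.2)⟩
  simp only [Set.mem_iUnion, exists_prop] at hzA hzB
  obtain ⟨T, hT, hzT⟩ := hzA
  obtain ⟨T', hT', hzT'⟩ := hzB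
  refine ⟨T, hT, T', hT', ?_⟩
  by_contra! hcard
  exact hseg z hz (𝒯.mem_codimTwoSkeleton (hA hT) Finset.inter_subset_left hcard
    (𝒯.hull_inter_hull (hA hT) (hB hT') ▸ ⟨hzT, hzT'⟩))

open Classical in
theorem exists_le_card_inter_of_joinedIn {A B : Finset (Finset (Pt d))} (hA : A ⊆ 𝒯.cells)
    (hB : B ⊆ 𝒯.cells) {O : Set (Pt d)} (hO : IsOpen O)
    (hcov : O ⊆ (⋃ T ∈ A, hull T) ∪ ⋃ T ∈ B, hull T) {x y : Pt d} (hxy : JoinedIn O x y)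
    (hx : x ∈ ⋃ T ∈ A, hull T) (hy : y ∈ ⋃ T ∈ B, hull T) :
    ∃ T ∈ A, ∃ T' ∈ B, d ≤ (T ∩ T').card := by
  obtain ⟨γ, hγ⟩ := hxy
  have hrange : Set.range γ ⊆ O := Set.range_subset_iff.2 hγ
  obtain ⟨z, hz, hzA, hzB⟩ := isPreconnected_closed_iff.1
    (isPreconnected_range γ.continuous) _ _ (isClosed_biUnion_hull A) (isClosed_biUnion_hull B)
    (hrange.trans hcov) ⟨x, ⟨0, γ.source⟩, hx⟩ ⟨y, ⟨1, γ.target⟩, hy⟩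
  obtain ⟨r, hr, hball⟩ := Metric.isOpen_iff.1 hO z (hrange hz)
  exact 𝒯.exists_le_card_inter_of_convex hA hB Metric.isOpen_ball (convex_ball z r)
    (hball.trans hcov) ⟨z, Metric.mem_ball_self hr, hzA⟩ ⟨z, Metric.mem_ball_self hr, hzB⟩

open Classical in
/-- The star of `v`: the cells which contain `v`. -/
def star (v : Pt d) : Finset (Finset (Pt d)) := 𝒯.cells.filter fun T => v ∈ hull T

theorem mem_star {v : Pt d} {T : Finset (Pt d)} :
    T ∈ 𝒯.star v ↔ T ∈ 𝒯.cells ∧ v ∈ hull T := by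
  classical
  exact Finset.mem_filter

/-- The dual graph of the star of `v`: two cells are adjacent if they share a facet which
contains `v`. -/
def starGraph (v : Pt d) : SimpleGraph (𝒯.star v) where
  Adj T T' := T ≠ T' ∧ ∃ F ∈ facets T.1, F ∈ facets T'.1 ∧ v ∈ hull F
  symm := ⟨fun _ _ ⟨hne, F, hF, hF', hv⟩ => ⟨hne.symm, F, hF', hF, hv⟩⟩
  loopless := ⟨fun _ h => h.1 rfl⟩

open Classical in
theorem starGraph_adj {v : Pt d} {T T' : 𝒯.star v} (hne : T ≠ T')
    (hcard : d ≤ (T.1 ∩ T'.1).card) : (𝒯.starGraph v).Adj T T' := by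
  obtain ⟨hT, hv⟩ := 𝒯.mem_star.1 T.2
  obtain ⟨hT', hv'⟩ := 𝒯.mem_star.1 T'.2
  have card_eq : (T.1 ∩ T'.1).card = d :=
    (𝒯.card_inter_le hT hT' (Subtype.coe_ne_coe.2 hne)).antisymm hcard
  exact ⟨hne, T.1 ∩ T'.1, Finset.mem_powersetCard.2 ⟨Finset.inter_subset_left, card_eq⟩,
    Finset.mem_powersetCard.2 ⟨Finset.inter_subset_right, card_eq⟩,
    𝒯.hull_inter_hull hT hT' ▸ ⟨hv, hv'⟩⟩

theorem exists_mem_hull_of_mem_star (hΩ : IsLipschitzDomain Ω) {v : Pt d} {T : Finset (Pt d)}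
    (hT : T ∈ 𝒯.star v) {δ : ℝ} (hδ : 0 < δ) : ∃ x ∈ Ω ∩ Metric.ball v δ, x ∈ hull T := by
  obtain ⟨hT, hv⟩ := 𝒯.mem_star.1 hT
  obtain ⟨x, hx, hxT⟩ := (𝒯.isSimplex hT).inter_interior_nonempty Metric.isOpen_ball
    ⟨v, Metric.mem_ball_self hδ, hv⟩
  exact ⟨x, ⟨𝒯.interior_hull_subset hΩ hT hxT, hx⟩, interior_subset hxT⟩

theorem starGraph_preconnected (hΩ : IsLipschitzDomain Ω) (v : Pt d) :
    (𝒯.starGraph v).Preconnected := by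
  classical
  intro T₀ T₁
  by_contra hreach
  obtain ⟨ε, hε, havoid⟩ := exists_ball_avoiding 𝒯.cells v
  obtain ⟨δ, hδ, hjoined⟩ := hΩ.exists_joinedIn
    (𝒯.hull_subset_closure (𝒯.mem_star.1 T₀.2).1 (𝒯.mem_star.1 T₀.2).2) hε
  obtain ⟨x, hx, hxT₀⟩ := 𝒯.exists_mem_hull_of_mem_star hΩ T₀.2 hδ
  obtain ⟨y, hy, hyT₁⟩ := 𝒯.exists_mem_hull_of_mem_star hΩ T₁.2 hδ
  set A := (𝒯.star v).filter fun T => ∃ h : T ∈ 𝒯.star v, (𝒯.starGraph v).Reachable T₀ ⟨T, h⟩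
  set B := 𝒯.star v \ A
  have hA : ∀ T : 𝒯.star v, T.1 ∈ A ↔ (𝒯.starGraph v).Reachable T₀ T := fun T => by simp [A]
  have hAB : Ω ∩ Metric.ball v ε ⊆ (⋃ T ∈ A, hull T) ∪ ⋃ T ∈ B, hull T := by
    rintro z ⟨hzΩ, hz⟩
    obtain ⟨T, hT, hzT⟩ := 𝒯.exists_cell (subset_closure hzΩ)
    have hTv : T ∈ 𝒯.star v := 𝒯.mem_star.2 ⟨hT, havoid T hT ⟨z, hz, hzT⟩⟩
    by_cases hTA : T ∈ A
    · exact Or.inl (Set.mem_biUnion (x := T) hTA hzT)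
    · exact Or.inr (Set.mem_biUnion (x := T) (Finset.mem_sdiff.2 ⟨hTv, hTA⟩) hzT)
  have hstar : 𝒯.star v ⊆ 𝒯.cells := fun T hT => (𝒯.mem_star.1 hT).1
  obtain ⟨T, hT, T', hT', hcard⟩ := 𝒯.exists_le_card_inter_of_joinedIn
    ((Finset.filter_subset _ _).trans hstar) (Finset.sdiff_subset.trans hstar)
    (hΩ.isOpen.inter Metric.isOpen_ball) hAB (hjoined x hx y hy)
    (Set.mem_biUnion (x := T₀.1) ((hA T₀).2 (.refl _)) hxT₀)
    (Set.mem_biUnion (x := T₁.1) (Finset.mem_sdiff.2 ⟨T₁.2, mt (hA T₁).1 hreach⟩) hyT₁)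
  obtain ⟨hT'v, hT'A⟩ := Finset.mem_sdiff.1 hT'
  have hTv := (Finset.mem_filter.1 hT).1
  have hadj : (𝒯.starGraph v).Adj ⟨T, hTv⟩ ⟨T', hT'v⟩ :=
    𝒯.starGraph_adj (fun h => by cases h; exact hT'A hT) hcard
  exact hT'A ((hA ⟨T', hT'v⟩).2 (((hA ⟨T, hTv⟩).1 hT).trans hadj.reachable))

/-! ### Boundary faces -/

theorem bary_neg_of_erase_eq {T T' : Finset (Pt d)} (hT : T ∈ 𝒯.cells) (hT' : T' ∈ 𝒯.cells)
    (hne : T ≠ T') {a a' : Pt d} (ha : a ∈ T) (ha' : a' ∈ T') (h : T.erase a = T'.erase a')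
    {z : Pt d} (hz : z ∈ hull (T.erase a)) (hzs : z ∉ 𝒯.codimTwoSkeleton) :
    bary T' a' a < 0 := by
  have hS := 𝒯.isSimplex hT
  have hS' := 𝒯.isSimplex hT'
  have bary_eq := hS.bary_eq_mul_of_erase_eq hS' ha ha' h
  by_contra! hle
  rcases hle.eq_or_lt with hzero | hpos
  · have := bary_eq a'
    rw [← hzero, mul_zero, hS'.bary_self ha'] at this
    exact one_ne_zero this
  -- If `a` and `a'` were on the same side of the face, then `T` and `T'` would agree near `z`.
  have same_side : ∀ᶠ y in 𝓝 z, (y ∈ hull T ↔ y ∈ hull T') := by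
    filter_upwards [hS.eventually_mem_hull_iff ha fun v hv =>
        𝒯.bary_pos_of_notMem_codimTwoSkeleton hT ha hz hzs hv,
      hS'.eventually_mem_hull_iff ha' fun v hv =>
        𝒯.bary_pos_of_notMem_codimTwoSkeleton hT' ha' (h ▸ hz) hzs hv] with y hy hy'
    rw [hy, hy', bary_eq y, mul_nonneg_iff_of_pos_right hpos]
  obtain ⟨U, hU, hUo, hzU⟩ := eventually_nhds_iff.1 same_side
  exact hne (𝒯.eq_of_isOpen_subset hT hT' (hUo.inter isOpen_interior)
    (hS.inter_interior_nonempty hUo ⟨z, hzU, hull_mono (Finset.erase_subset _ _) hz⟩)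
    (Set.inter_subset_right.trans interior_subset)
    fun y hy => (hU y hy.1).1 (interior_subset hy.2))

theorem union_hull_mem_nhds {T T' F : Finset (Pt d)} (hT : T ∈ 𝒯.cells) (hT' : T' ∈ 𝒯.cells)
    (hne : T ≠ T') (hF : F ∈ facets T) (hF' : F ∈ facets T') {z : Pt d} (hz : z ∈ hull F)
    (hzs : z ∉ 𝒯.codimTwoSkeleton) : hull T ∪ hull T' ∈ 𝓝 z := by
  have hS := 𝒯.isSimplex hT
  have hS' := 𝒯.isSimplex hT'
  obtain ⟨a, ha, rfl⟩ := (mem_facets_iff hS).1 hF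
  obtain ⟨a', ha', h⟩ := (mem_facets_iff hS').1 hF'
  have opposite := 𝒯.bary_neg_of_erase_eq hT hT' hne ha ha' h hz hzs
  filter_upwards [hS.eventually_mem_hull_iff ha fun v hv =>
      𝒯.bary_pos_of_notMem_codimTwoSkeleton hT ha hz hzs hv,
    hS'.eventually_mem_hull_iff ha' fun v hv =>
      𝒯.bary_pos_of_notMem_codimTwoSkeleton hT' ha' (h ▸ hz) hzs hv] with y hy hy'
  rcases le_total 0 (bary T a y) with hpos | hneg
  · exact Or.inl (hy.2 hpos)
  · refine Or.inr (hy'.2 ?_)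
    rw [hS.bary_eq_mul_of_erase_eq hS' ha ha' h]
    exact mul_nonneg_of_nonpos_of_nonpos hneg opposite.le

theorem mem_of_notMem_boundary_face (hΩ : IsLipschitzDomain Ω) {z : Pt d} (hz : z ∈ closure Ω)
    (hzs : z ∉ 𝒯.codimTwoSkeleton)
    (hface : ∀ T ∈ 𝒯.cells, ∀ F ∈ facets T, z ∈ hull F → ¬ hull F ⊆ frontier Ω) : z ∈ Ω := by
  obtain ⟨T, hT, hzT⟩ := 𝒯.exists_cell hz
  by_cases hz_int : z ∈ interior (hull T)
  · exact 𝒯.interior_hull_subset hΩ hT hz_int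
  obtain ⟨F, hF, hzF⟩ := (𝒯.isSimplex hT).exists_facet_of_notMem_interior hzT hz_int
  obtain ⟨T', hT', hne, hF'⟩ := (𝒯.facet T hT F hF).resolve_right (hface T hT F hF hzF)
  rw [← hΩ.interior_closure, mem_interior_iff_mem_nhds]
  exact Filter.mem_of_superset (𝒯.union_hull_mem_nhds hT hT' hne.symm hF hF' hzF hzs)
    (Set.union_subset (𝒯.hull_subset_closure hT) (𝒯.hull_subset_closure hT'))

theorem exists_boundary_face (hΩ : IsLipschitzDomain Ω) {x : Pt d} (hx : x ∈ frontier Ω) :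
    ∃ T ∈ 𝒯.cells, ∃ F ∈ facets T, x ∈ hull F ∧ hull F ⊆ frontier Ω := by
  classical
  by_contra! hno
  obtain ⟨ε, hε, havoid⟩ := exists_ball_avoiding (𝒯.cells.biUnion facets) x
  have mem_of_mem_closure : ∀ z ∈ Metric.ball x ε, z ∉ 𝒯.codimTwoSkeleton → z ∈ closure Ω →
      z ∈ Ω := fun z hz hzs hzc =>
    𝒯.mem_of_notMem_boundary_face hΩ hzc hzs fun T hT F hF hzF =>
      hno T hT F hF (havoid F (Finset.mem_biUnion.2 ⟨T, hT, hF⟩) ⟨z, hz, hzF⟩)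
  obtain ⟨y, ⟨hyb, hyc⟩, hys⟩ := 𝒯.exists_notMem_codimTwoSkeleton
    (Metric.isOpen_ball.inter isClosed_closure.isOpen_compl) (hΩ.exists_notMem_closure hx hε)
  obtain ⟨a, ⟨hab, haΩ⟩, hseg⟩ := 𝒯.exists_segment_avoiding_codimTwoSkeleton hys
    (Metric.isOpen_ball.inter hΩ.isOpen)
    (mem_closure_iff.1 (frontier_subset_closure hx) _ Metric.isOpen_ball (Metric.mem_ball_self hε))
  -- A generic segment from `Ω` to the exterior of `Ω` would have to stay in one of the two.
  obtain ⟨z, -, hzΩ, hzc⟩ := (convex_segment a y).isPreconnected Ω (closure Ω)ᶜ hΩ.isOpen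
    isClosed_closure.isOpen_compl
    (fun z hz => (em (z ∈ closure Ω)).imp_left
      (mem_of_mem_closure z ((convex_ball x ε).segment_subset hab hyb hz) (hseg z hz)))
    ⟨a, left_mem_segment ℝ _ _, haΩ⟩ ⟨y, right_mem_segment ℝ _ _, hyc⟩
  exact hzc (subset_closure hzΩ)

end SimplicialMesh

/-! ### Charts of faces and the surface measure -/

theorem facet_subset {T F : Finset (Pt d)} (hF : F ∈ facets T) : F ⊆ T :=
  (Finset.mem_powersetCard.1 hF).1

theorem facet_nonempty [NeZero d] {T F : Finset (Pt d)} (hF : F ∈ facets T) : F.Nonempty := by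
  rw [← Finset.card_pos, (Finset.mem_powersetCard.1 hF).2]
  exact NeZero.pos d

/-- An isometric parametrization `y ↦ p + A y` of the hyperplane through a face, by which surface
integrals become Lebesgue integrals in dimension `d - 1`. -/
structure FaceChart (F : Finset (Pt d)) where
  p : Pt d
  A : EuclideanSpace ℝ (Fin (d - 1)) →ₗᵢ[ℝ] Pt d
  mem_span : ∀ y, p + A y ∈ affineSpan ℝ (F : Set (Pt d))
  surj : ∀ x ∈ hull F, ∃ y, p + A y = x

namespace FaceChart

variable {F : Finset (Pt d)} (χ : FaceChart F)

/-- The parametrization `y ↦ p + A y`. -/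
def map (y : EuclideanSpace ℝ (Fin (d - 1))) : Pt d := χ.p + χ.A y

theorem isometry : Isometry χ.map := by
  intro y z
  simp [map, edist_add_left]

theorem hull_subset_range : hull F ⊆ Set.range χ.map := χ.surj

theorem continuous : Continuous χ.map := χ.isometry.continuous

/-- The parameter domain of the face. -/
def dom : Set (EuclideanSpace ℝ (Fin (d - 1))) := χ.map ⁻¹' hull F

theorem isClosed_dom : IsClosed χ.dom := (isClosed_hull F).preimage χ.continuous

theorem convex_dom : Convex ℝ χ.dom := by
  intro y hy z hz a b ha hb hab
  have map_combination : χ.map (a • y + b • z) = a • χ.map y + b • χ.map z := by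
    simp only [map, map_add, map_smul, smul_add]
    nth_rewrite 1 [← one_smul ℝ χ.p]
    rw [← hab, add_smul]
    abel
  change χ.map (a • y + b • z) ∈ hull F
  exact map_combination ▸ convex_convexHull ℝ (F : Set (Pt d)) hy hz ha hb hab

theorem surf_hull : surf d (hull F) = volume χ.dom := by
  rw [dom, ← EuclideanSpace.euclideanHausdorffMeasure_eq_volume,
    χ.isometry.euclideanHausdorffMeasure_preimage, Set.inter_eq_left.2 χ.hull_subset_range]

theorem setIntegral_hull (f : Pt d → ℝ) :
    ∫ x in hull F, f x ∂(surf d) = ∫ y in χ.dom, f (χ.map y) := by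
  have restrict_surf :
      (surf d).restrict (hull F) = (Measure.map χ.map volume).restrict (hull F) := by
    rw [← EuclideanSpace.euclideanHausdorffMeasure_eq_volume,
      χ.isometry.map_euclideanHausdorffMeasure,
      Measure.restrict_restrict_of_subset χ.hull_subset_range]
  rw [restrict_surf, χ.isometry.isClosedEmbedding.measurableEmbedding.setIntegral_map]
  rfl

theorem exists_dom_subset_closedBall {D : ℝ} (hD : Metric.diam (hull F) ≤ D)
    (hne : (hull F).Nonempty) : ∃ y, χ.dom ⊆ Metric.closedBall y D := by
  obtain ⟨x, hx⟩ := hne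
  obtain ⟨y, rfl⟩ := χ.hull_subset_range hx
  refine ⟨y, fun z hz => ?_⟩
  rw [Metric.mem_closedBall, ← χ.isometry.dist_eq]
  exact (Metric.dist_le_diam_of_mem (isCompact_hull F).isBounded hz hx).trans hD

theorem isCompact_dom : IsCompact χ.dom :=
  χ.isometry.isClosedEmbedding.isCompact_preimage (isCompact_hull F)

end FaceChart

namespace IsSimplex

variable {T : Finset (Pt d)} (hT : IsSimplex T)
include hT

theorem finrank_vectorSpan_facet [NeZero d] {F : Finset (Pt d)} (hF : F ∈ facets T) :
    Module.finrank ℝ (vectorSpan ℝ (F : Set (Pt d))) = d - 1 := by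
  have hcard : Fintype.card F = (d - 1) + 1 := by
    rw [Fintype.card_coe, (Finset.mem_powersetCard.1 hF).2, Nat.sub_add_cancel (NeZero.one_le)]
  have hfinrank := (hT.indep.mono (facet_subset hF)).finrank_vectorSpan hcard
  rwa [Subtype.range_coe] at hfinrank

theorem exists_chart [NeZero d] {F : Finset (Pt d)} (hF : F ∈ facets T) :
    Nonempty (FaceChart F) := by
  obtain ⟨p, hp⟩ := facet_nonempty hF
  have hp_span : p ∈ affineSpan ℝ (F : Set (Pt d)) := subset_affineSpan ℝ _ hp
  let e := ((stdOrthonormalBasis ℝ (vectorSpan ℝ (F : Set (Pt d)))).reindex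
    (finCongr (hT.finrank_vectorSpan_facet hF))).repr
  refine ⟨⟨p, (vectorSpan ℝ (F : Set (Pt d))).subtypeₗᵢ.comp e.symm.toLinearIsometry,
    fun y => ?_, fun x hx => ?_⟩⟩
  · rw [add_comm, ← vadd_eq_add]
    refine AffineSubspace.vadd_mem_of_mem_direction ?_ hp_span
    rw [direction_affineSpan]
    exact (e.symm y).2
  · have hv : x - p ∈ vectorSpan ℝ (F : Set (Pt d)) := by
      rw [← direction_affineSpan]
      exact AffineSubspace.vsub_mem_direction (convexHull_subset_affineSpan _ hx) hp_span
    exact ⟨e ⟨x - p, hv⟩, by simp⟩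

theorem bary_eq_zero_of_mem_span {a : Pt d} (ha : a ∈ T) {x : Pt d}
    (hx : x ∈ affineSpan ℝ ((T.erase a : Finset (Pt d)) : Set (Pt d))) : bary T a x = 0 := by
  refine affineSpan_induction (p := fun x => bary T a x = 0) hx ?_ ?_
  · intro w hw
    rw [Finset.mem_coe, Finset.mem_erase] at hw
    exact hT.bary_ne ha hw.2 hw.1.symm
  · intro c u v w hu hv hw
    rw [AffineMap.map_vadd, map_smul, AffineMap.linearMap_vsub, hu, hv, hw]
    simp

theorem bary_linear_chart_eq_zero {a : Pt d} (ha : a ∈ T) (χ : FaceChart (T.erase a))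
    (y : EuclideanSpace ℝ (Fin (d - 1))) : (bary T a).linear (χ.A y) = 0 := by
  rw [show χ.A y = (χ.p + χ.A y) -ᵥ (χ.p + χ.A 0) by simp, AffineMap.linearMap_vsub,
    hT.bary_eq_zero_of_mem_span ha (χ.mem_span y), hT.bary_eq_zero_of_mem_span ha (χ.mem_span 0),
    vsub_self]

theorem bary_lt_one_of_mem_interior [NeZero d] {a c : Pt d} (ha : a ∈ T)
    (hc : c ∈ interior (hull T)) : bary T a c < 1 := by
  have hpos := hT.mem_interior_iff.1 hc
  obtain ⟨v, hv, hva⟩ : ∃ v ∈ T, v ≠ a := by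
    refine Finset.exists_mem_ne ?_ a
    rw [hT.card_eq]
    exact Nat.lt_add_of_pos_left (NeZero.pos d)
  rw [← hT.sum_bary c, ← Finset.sum_erase_add _ _ ha, lt_add_iff_pos_left]
  exact Finset.sum_pos (fun w hw => hpos w (Finset.mem_of_mem_erase hw))
    ⟨v, Finset.mem_erase.2 ⟨hva, hv⟩⟩

theorem lineMap_mem_hull_erase {a x : Pt d} (ha : a ∈ T) (hx : x ∈ hull T)
    (hx_lt : bary T a x < 1) :
    AffineMap.lineMap a x (1 - bary T a x)⁻¹ ∈ hull (T.erase a) := by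
  have hpos : 0 < 1 - bary T a x := sub_pos.2 hx_lt
  have bary_lineMap (v : Pt d) : bary T v (AffineMap.lineMap a x (1 - bary T a x)⁻¹) =
      (1 - bary T a x)⁻¹ * (bary T v x - bary T v a) + bary T v a := by
    rw [AffineMap.apply_lineMap, AffineMap.lineMap_apply]
    simp
  have bary_apex : bary T a (AffineMap.lineMap a x (1 - bary T a x)⁻¹) = 0 := by
    rw [bary_lineMap, hT.bary_self ha]
    field_simp
    ring
  refine hT.mem_hull_of_bary_eq_zero (hT.mem_hull_iff.2 fun v hv => ?_) (Finset.erase_subset _ _)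
    fun v hv hv_erase => ?_
  · rcases eq_or_ne v a with rfl | hva
    · exact bary_apex.ge
    · rw [bary_lineMap, hT.bary_ne hv ha hva, sub_zero, add_zero]
      exact mul_nonneg (inv_nonneg.2 hpos.le) (hT.mem_hull_iff.1 hx v hv)
  · obtain rfl : v = a := by
      by_contra hva
      exact hv_erase (Finset.mem_erase.2 ⟨hva, hv⟩)
    exact bary_apex

/- The section of the ball parallel to the face has radius at least `(1 - s) r`, where `s` is the
barycentric coordinate of the centre at the vertex `a` opposite to the face; the homothety with
centre `a` and ratio `(1 - s)⁻¹` carries it into the face. -/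
theorem exists_closedBall_subset_dom [NeZero d] {F : Finset (Pt d)} (hF : F ∈ facets T)
    (χ : FaceChart F) {c : Pt d} {r : ℝ} (hr : 0 < r) (hball : Metric.closedBall c r ⊆ hull T) :
    ∃ y, Metric.closedBall y r ⊆ χ.dom := by
  obtain ⟨a, ha, rfl⟩ := (mem_facets_iff hT).1 hF
  have hc : c ∈ interior (hull T) :=
    mem_interior_iff_mem_nhds.2 (Filter.mem_of_superset (Metric.closedBall_mem_nhds c hr) hball)
  set s := bary T a c
  have hs_pos : 0 < s := hT.mem_interior_iff.1 hc a ha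
  have hs_lt : s < 1 := hT.bary_lt_one_of_mem_interior ha hc
  have bary_section (u : EuclideanSpace ℝ (Fin (d - 1))) :
      bary T a (c + (1 - s) • χ.A u) = s := by
    rw [add_comm c, ← vadd_eq_add, AffineMap.map_vadd, map_smul,
      hT.bary_linear_chart_eq_zero ha, smul_zero, zero_vadd]
  have homothety_mem {u : EuclideanSpace ℝ (Fin (d - 1))} (hu : ‖u‖ ≤ r) :
      AffineMap.lineMap a (c + (1 - s) • χ.A u) (1 - s)⁻¹ ∈ hull (T.erase a) := by
    have hmem : c + (1 - s) • χ.A u ∈ hull T := by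
      apply hball
      rw [Metric.mem_closedBall, dist_eq_norm, add_sub_cancel_left, norm_smul,
        Real.norm_of_nonneg (sub_nonneg.2 hs_lt.le), LinearIsometry.norm_map]
      nlinarith [norm_nonneg u]
    simpa only [bary_section] using
      hT.lineMap_mem_hull_erase ha hmem ((bary_section u).trans_lt hs_lt)
  obtain ⟨y, hy⟩ := χ.surj _ (homothety_mem (u := 0) (by simpa using hr.le))
  refine ⟨y, fun z hz => ?_⟩
  have map_eq : χ.map z = AffineMap.lineMap a (c + (1 - s) • χ.A (z - y)) (1 - s)⁻¹ := by
    rw [show χ.map z = (χ.p + χ.A y) + χ.A (z - y) by rw [FaceChart.map, map_sub]; abel, hy]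
    simp only [AffineMap.lineMap_apply, vsub_eq_sub, vadd_eq_add, map_zero, add_zero,
      smul_sub, smul_add, smul_smul, inv_mul_cancel₀ (sub_pos.2 hs_lt).ne', one_smul, smul_zero]
    abel
  change χ.map z ∈ hull (T.erase a)
  exact map_eq ▸ homothety_mem (by rwa [← dist_eq_norm])

theorem hull_nonempty : (hull T).Nonempty := hT.interior_nonempty.mono interior_subset

theorem exists_closedBall_subset_hull :
    ∃ (c : Pt d) (r : ℝ), 0 < r ∧ Metric.closedBall c r ⊆ hull T := by
  obtain ⟨c, hc⟩ := hT.interior_nonempty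
  obtain ⟨r, hr, hball⟩ :=
    Metric.nhds_basis_closedBall.mem_iff.1 (mem_interior_iff_mem_nhds.1 hc)
  exact ⟨c, r, hr, hball⟩

theorem card_facets : (facets T).card = d + 1 := by
  rw [facets, Finset.card_powersetCard, hT.card_eq]; simp

theorem facets_nonempty : (facets T).Nonempty := by
  rw [← Finset.card_pos, hT.card_facets]; omega

end IsSimplex

/-- The volume of the unit ball of `ℝⁿ`. -/
def ballVol (n : ℕ) : ℝ := volume.real (Metric.ball (0 : EuclideanSpace ℝ (Fin n)) 1)

theorem ballVol_pos (n : ℕ) : 0 < ballVol n :=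
  ENNReal.toReal_pos (Metric.measure_ball_pos volume _ one_pos).ne' measure_ball_lt_top.ne

theorem volume_real_closedBall {n : ℕ} (x : EuclideanSpace ℝ (Fin n)) {r : ℝ} (hr : 0 ≤ r) :
    volume.real (Metric.closedBall x r) = r ^ n * ballVol n := by
  rw [Measure.real, Measure.addHaar_closedBall _ _ hr, ENNReal.toReal_mul,
    ENNReal.toReal_ofReal (by positivity), finrank_euclideanSpace_fin]
  rfl

theorem surf_hull_lt_top {T : Finset (Pt d)} (hT : IsSimplex T) [NeZero d] {F : Finset (Pt d)}
    (hF : F ∈ facets T) : surf d (hull F) < ⊤ := by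
  obtain ⟨χ⟩ := hT.exists_chart hF
  rw [χ.surf_hull]
  exact χ.isCompact_dom.measure_lt_top

theorem surf_real_le {T : Finset (Pt d)} (hT : IsSimplex T) [NeZero d] {F : Finset (Pt d)}
    (hF : F ∈ facets T) :
    (surf d).real (hull F) ≤ Metric.diam (hull T) ^ (d - 1) * ballVol (d - 1) := by
  obtain ⟨χ⟩ := hT.exists_chart hF
  obtain ⟨y, hy⟩ := χ.exists_dom_subset_closedBall
    (Metric.diam_mono (hull_mono (facet_subset hF)) (isCompact_hull T).isBounded)
    (convexHull_nonempty_iff.2 (by exact_mod_cast facet_nonempty hF))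
  rw [← volume_real_closedBall y Metric.diam_nonneg, Measure.real, Measure.real, χ.surf_hull]
  exact ENNReal.toReal_mono measure_closedBall_lt_top.ne (measure_mono hy)

theorem le_surf_real {T : Finset (Pt d)} (hT : IsSimplex T) [NeZero d] {F : Finset (Pt d)}
    (hF : F ∈ facets T) {c : Pt d} {r : ℝ} (hr : 0 < r) (hball : Metric.closedBall c r ⊆ hull T) :
    r ^ (d - 1) * ballVol (d - 1) ≤ (surf d).real (hull F) := by
  obtain ⟨χ⟩ := hT.exists_chart hF
  obtain ⟨y, hy⟩ := hT.exists_closedBall_subset_dom hF χ hr hball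
  rw [← volume_real_closedBall y hr.le, Measure.real, Measure.real, χ.surf_hull]
  exact ENNReal.toReal_mono χ.isCompact_dom.measure_lt_top.ne (measure_mono hy)

theorem IsSimplex.volume_real_hull_le {T : Finset (Pt d)} (hT : IsSimplex T) :
    volume.real (hull T) ≤ Metric.diam (hull T) ^ d * ballVol d := by
  obtain ⟨x, hx⟩ := hT.hull_nonempty
  rw [← volume_real_closedBall x Metric.diam_nonneg]
  exact ENNReal.toReal_mono measure_closedBall_lt_top.ne (measure_mono fun z hz =>
    Metric.dist_le_diam_of_mem (isCompact_hull T).isBounded hz hx)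

theorem le_volume_real_hull {T : Finset (Pt d)} {c : Pt d} {r : ℝ} (hr : 0 < r)
    (hball : Metric.closedBall c r ⊆ hull T) : r ^ d * ballVol d ≤ volume.real (hull T) := by
  rw [← volume_real_closedBall c hr.le]
  exact ENNReal.toReal_mono (isCompact_hull T).measure_lt_top.ne (measure_mono hball)

theorem IsSimplex.volume_pos {T : Finset (Pt d)} (hT : IsSimplex T) : 0 < volume.real (hull T) := by
  obtain ⟨c, r, hr, hball⟩ := hT.exists_closedBall_subset_hull
  exact lt_of_lt_of_le (mul_pos (pow_pos hr _) (ballVol_pos d)) (le_volume_real_hull hr hball)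

theorem IsSimplex.surf_pos {T : Finset (Pt d)} (hT : IsSimplex T) [NeZero d] {F : Finset (Pt d)}
    (hF : F ∈ facets T) : 0 < (surf d).real (hull F) := by
  obtain ⟨c, r, hr, hball⟩ := hT.exists_closedBall_subset_hull
  exact lt_of_lt_of_le (mul_pos (pow_pos hr _) (ballVol_pos (d - 1))) (le_surf_real hT hF hr hball)

theorem IsSimplex.sum_surf_pos {T : Finset (Pt d)} (hT : IsSimplex T) [NeZero d] :
    0 < ∑ F ∈ facets T, (surf d).real (hull F) :=
  Finset.sum_pos (fun _ hF => hT.surf_pos hF) hT.facets_nonempty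

theorem IsSimplex.volRatio_pos {T : Finset (Pt d)} (hT : IsSimplex T) [NeZero d] :
    0 < volRatio T := div_pos hT.volume_pos (hT.sum_surf_pos)

theorem integrableOn_face {T : Finset (Pt d)} (hT : IsSimplex T) [NeZero d] {F : Finset (Pt d)}
    (hF : F ∈ facets T) {f : Pt d → ℝ} (hf : ContinuousOn f (hull F)) :
    IntegrableOn f (hull F) (surf d) := by
  obtain ⟨C, hC⟩ := (isCompact_hull F).exists_bound_of_continuousOn hf
  exact IntegrableOn.of_bound (surf_hull_lt_top hT hF)
    (hf.aestronglyMeasurable (isClosed_hull F).measurableSet) C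
    ((ae_restrict_iff' (isClosed_hull F).measurableSet).2 (Eventually.of_forall hC))

theorem eq_zero_of_face_integral_eq_zero {T : Finset (Pt d)} (hT : IsSimplex T) [NeZero d]
    {F : Finset (Pt d)} (hF : F ∈ facets T) {f : Pt d → ℝ} (hf : ContinuousOn f (hull F))
    (hf_nonneg : ∀ x ∈ hull F, 0 ≤ f x) (hf_integral : ∫ x in hull F, f x ∂(surf d) = 0)
    {x : Pt d} (hx : x ∈ hull F) : f x = 0 := by
  obtain ⟨χ⟩ := hT.exists_chart hF
  obtain ⟨c, r, hr, hball⟩ := hT.exists_closedBall_subset_hull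
  obtain ⟨y, hy⟩ := hT.exists_closedBall_subset_dom hF χ hr hball
  have hcont : ContinuousOn (f ∘ χ.map) χ.dom :=
    hf.comp χ.continuous.continuousOn fun _ h => h
  rw [χ.setIntegral_hull, setIntegral_eq_zero_iff_of_nonneg_ae
    ((ae_restrict_iff' χ.isClosed_dom.measurableSet).2
      (Eventually.of_forall fun y hy => hf_nonneg _ hy))
    (hcont.integrableOn_compact χ.isCompact_dom)] at hf_integral
  have eqOn_interior : Set.EqOn (f ∘ χ.map) 0 (interior χ.dom) :=
    Measure.eqOn_open_of_ae_eq (μ := volume)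
      (ae_restrict_of_ae_restrict_of_subset interior_subset hf_integral)
      isOpen_interior (hcont.mono interior_subset) continuousOn_const
  have interior_nonempty : (interior χ.dom).Nonempty :=
    ⟨y, mem_interior_iff_mem_nhds.2 (Filter.mem_of_superset (Metric.closedBall_mem_nhds y hr) hy)⟩
  have dom_subset : χ.dom ⊆ closure (interior χ.dom) := by
    rw [χ.convex_dom.closure_interior_eq_closure_of_nonempty_interior interior_nonempty]
    exact subset_closure
  obtain ⟨z, rfl⟩ := χ.hull_subset_range hx
  exact eqOn_interior.of_subset_closure hcont continuousOn_const interior_subset dom_subset hx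

/-! ### Polynomials as functions -/

theorem val_add (u v : Poly d) (x : Pt d) : val (u + v) x = val u x + val v x := by simp [val]

theorem val_smul (c : ℝ) (u : Poly d) (x : Pt d) : val (c • u) x = c * val u x := by
  simp [val]

theorem continuous_val (u : Poly d) : Continuous (val u) :=
  (MvPolynomial.continuous_eval u).comp (PiLp.continuous_ofLp 2 _)

theorem continuous_vecVal (q : Fin d → Poly d) : Continuous (vecVal q) :=
  (PiLp.continuous_toLp 2 _).comp (continuous_pi fun i => continuous_val (q i))

theorem vecVal_add (q r : Fin d → Poly d) (x : Pt d) :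
    vecVal (q + r) x = vecVal q x + vecVal r x := by
  ext i; simp [vecVal, val_add]

theorem vecVal_smul (c : ℝ) (q : Fin d → Poly d) (x : Pt d) :
    vecVal (c • q) x = c • vecVal q x := by
  ext i; simp [vecVal, val_smul]

theorem polyGrad_add (u v : Poly d) : polyGrad (u + v) = polyGrad u + polyGrad v := by
  funext i; simp [polyGrad]

theorem vecVal_polyGrad_mul_X (u : Poly d) (i : Fin d) (x : Pt d) :
    vecVal (polyGrad (u * MvPolynomial.X i)) x =
      val u x • EuclideanSpace.single i 1 + x i • vecVal (polyGrad u) x := by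
  ext j
  rcases eq_or_ne j i with rfl | hji
  · simp [vecVal, polyGrad, val, mul_comm]
  · simp [vecVal, polyGrad, val, hji, mul_comm]

theorem hasGradientAt_val (u : Poly d) (x : Pt d) :
    HasGradientAt (val u) (vecVal (polyGrad u) x) x := by
  rw [hasGradientAt_iff_hasFDerivAt]
  induction u using MvPolynomial.induction_on with
  | C a =>
    have val_C : val (MvPolynomial.C a : Poly d) = fun _ => a := by funext y; simp [val]
    have grad_C : vecVal (polyGrad (MvPolynomial.C a : Poly d)) x = 0 := by
      ext i; simp [vecVal, polyGrad, val]
    rw [val_C, grad_C, map_zero]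
    exact hasFDerivAt_const a x
  | add u v hu hv =>
    rw [show val (u + v) = val u + val v from funext (val_add u v), polyGrad_add, vecVal_add,
      map_add]
    exact hu.add hv
  | mul_X u i hu =>
    have val_mul_X : val (u * MvPolynomial.X i) = fun y => val u y * y i := by
      funext y; simp [val]
    have hasFDerivAt_coord :
        HasFDerivAt (fun y : Pt d => y i) (EuclideanSpace.proj (𝕜 := ℝ) i) x :=
      PiLp.hasFDerivAt_apply 2 x i
    rw [val_mul_X]
    refine (hu.mul hasFDerivAt_coord).congr_fderiv ?_
    ext w
    rw [vecVal_polyGrad_mul_X]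
    simp [EuclideanSpace.inner_single_left]

theorem polyDeg_induction {k : ℕ} {P : Poly d → Prop} (hadd : ∀ u v, P u → P v → P (u + v))
    (hmon : ∀ (s : Fin d →₀ ℕ) (c : ℝ), (s.sum fun _ e => e) ≤ k → P (MvPolynomial.monomial s c))
    {u : Poly d} (hu : u ∈ PolyDeg d k) : P u := by
  rw [MvPolynomial.mem_restrictTotalDegree] at hu
  rw [u.as_sum]
  refine Finset.sum_induction _ P hadd ?_ fun s hs =>
    hmon s _ ((MvPolynomial.le_totalDegree hs).trans hu)
  simpa using hmon 0 0 (by simp)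

theorem pderiv_mem_polyDeg {k : ℕ} {u : Poly d} (hu : u ∈ PolyDeg d k) (i : Fin d) :
    MvPolynomial.pderiv i u ∈ PolyDeg d k := by
  refine polyDeg_induction (P := fun u => MvPolynomial.pderiv i u ∈ PolyDeg d k) ?_ ?_ hu
  · intro u v hu hv
    rw [map_add]
    exact add_mem hu hv
  · intro s c hs
    rw [MvPolynomial.pderiv_monomial, MvPolynomial.mem_restrictTotalDegree]
    refine (MvPolynomial.totalDegree_monomial_le _ _).trans (le_trans ?_ hs)
    change ((s - Finsupp.single i 1).degree) ≤ s.degree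
    exact Finsupp.degree_mono tsub_le_self

theorem exists_comp_affine {k : ℕ} {u : Poly d} (hu : u ∈ PolyDeg d k) (c : Pt d) (r : ℝ) :
    ∃ v ∈ PolyDeg d k, ∀ x, val v x = val u (c + r • x) := by
  refine polyDeg_induction (P := fun u => ∃ v ∈ PolyDeg d k, ∀ x, val v x = val u (c + r • x))
    ?_ ?_ hu
  · rintro u v ⟨u', hu', val_u'⟩ ⟨v', hv', val_v'⟩
    exact ⟨u' + v', add_mem hu' hv', fun x => by rw [val_add, val_add, val_u', val_v']⟩
  · intro s a hs
    refine ⟨MvPolynomial.C a * ∏ i ∈ s.support,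
      (MvPolynomial.C (c i) + MvPolynomial.C r * MvPolynomial.X i) ^ s i, ?_, fun x => ?_⟩
    · rw [MvPolynomial.mem_restrictTotalDegree]
      refine (MvPolynomial.totalDegree_mul _ _).trans ?_
      rw [MvPolynomial.totalDegree_C, zero_add]
      refine (MvPolynomial.totalDegree_finsetProd _ _).trans (le_trans ?_ hs)
      refine Finset.sum_le_sum fun i _ => (MvPolynomial.totalDegree_pow _ _).trans ?_
      refine mul_le_of_le_one_right (Nat.zero_le _) ?_
      refine (MvPolynomial.totalDegree_add _ _).trans (max_le (by simp) ?_)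
      exact (MvPolynomial.totalDegree_mul _ _).trans (by simp)
    · simp [val, MvPolynomial.eval_monomial, Finsupp.prod]

theorem exists_affineMap_of_mem_polyDeg_one {u : Poly d} (hu : u ∈ PolyDeg d 1) :
    ∃ f : Pt d →ᵃ[ℝ] ℝ, ∀ x, val u x = f x := by
  refine polyDeg_induction (P := fun u => ∃ f : Pt d →ᵃ[ℝ] ℝ, ∀ x, val u x = f x) ?_ ?_ hu
  · rintro u v ⟨f, hf⟩ ⟨g, hg⟩
    exact ⟨f + g, fun x => by rw [val_add, hf, hg]; rfl⟩
  · intro s c hs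
    rcases Nat.le_one_iff_eq_zero_or_eq_one.1 hs with hs_zero | hs_one
    · obtain rfl := (Finsupp.degree_eq_zero_iff s).1 hs_zero
      exact ⟨AffineMap.const ℝ _ c, fun x => by simp [val]⟩
    · obtain ⟨i, rfl⟩ := (Finsupp.sum_eq_one_iff s).1 hs_one
      exact ⟨(c • (EuclideanSpace.proj (𝕜 := ℝ) i : Pt d →L[ℝ] ℝ).toLinearMap).toAffineMap,
        fun x => by simp [val, MvPolynomial.eval_monomial]⟩

theorem exists_poly_of_affineMap (f : Pt d →ᵃ[ℝ] ℝ) : ∃ u ∈ PolyDeg d 1, ∀ x, val u x = f x := by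
  refine ⟨MvPolynomial.C (f 0) + ∑ i, MvPolynomial.C (f.linear (EuclideanSpace.single i 1)) *
    MvPolynomial.X i, ?_, fun x => ?_⟩
  · rw [MvPolynomial.mem_restrictTotalDegree]
    refine (MvPolynomial.totalDegree_add _ _).trans (max_le (by simp) ?_)
    refine MvPolynomial.totalDegree_finsetSum_le fun i _ => ?_
    exact (MvPolynomial.totalDegree_mul _ _).trans (by simp)
  · have sum_coord : x = ∑ i, x i • EuclideanSpace.single i (1 : ℝ) := by
      ext j; simp [Finset.sum_apply, Pi.single_apply]
    have map_eq : f x = f.linear x + f 0 := by simpa using f.map_vadd 0 x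
    rw [map_eq]
    conv_rhs => rw [sum_coord, map_sum]
    simp [val, add_comm, mul_comm]

theorem exists_norm_le_mul_norm_of_injective {V X Y : Type*} [AddCommGroup V] [Module ℝ V]
    [FiniteDimensional ℝ V] [NormedAddCommGroup X] [NormedSpace ℝ X] [NormedAddCommGroup Y]
    [NormedSpace ℝ Y] (A : V →ₗ[ℝ] X) (B : V →ₗ[ℝ] Y) (hA : Function.Injective A) :
    ∃ C > 0, ∀ v, ‖B v‖ ≤ C * ‖A v‖ := by
  let e := LinearEquiv.ofInjective A hA
  let g : LinearMap.range A →L[ℝ] Y := (B ∘ₗ e.symm.toLinearMap).toContinuousLinearMap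
  refine ⟨‖g‖ + 1, by positivity, fun v => ?_⟩
  calc ‖B v‖ = ‖g (e v)‖ := by simp [g]
    _ ≤ ‖g‖ * ‖e v‖ := g.le_opNorm _
    _ ≤ (‖g‖ + 1) * ‖A v‖ :=
      mul_le_mul_of_nonneg_right (le_add_of_nonneg_right zero_le_one) (norm_nonneg _)

theorem memLp_restrict_of_continuousOn {K : Set (Pt d)} (hK : IsCompact K) {F : Type*}
    [NormedAddCommGroup F] [SecondCountableTopology F] {f : Pt d → F} (hf : ContinuousOn f K)
    (q : ℝ≥0∞) : MemLp f q (volume.restrict K) := by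
  obtain ⟨C, hC⟩ := hK.exists_bound_of_continuousOn hf
  have : IsFiniteMeasure (volume.restrict K) := ⟨by simpa using hK.measure_lt_top⟩
  exact MemLp.of_bound (hf.aestronglyMeasurable hK.measurableSet) C
    ((ae_restrict_iff' hK.measurableSet).2 (Eventually.of_forall hC))

/-- A polynomial as an element of `L²` of the unit ball. Together with `polyC` it turns the inverse
estimate into the equivalence of norms on a finite dimensional space. -/
def polyL2 (d k : ℕ) :
    PolyDeg d k →ₗ[ℝ] Lp ℝ 2 (volume.restrict (Metric.closedBall (0 : Pt d) 1)) where
  toFun u := (memLp_restrict_of_continuousOn (isCompact_closedBall (0 : Pt d) 1)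
    (continuous_val (u : Poly d)).continuousOn 2).toLp _
  map_add' u v := by
    rw [← MemLp.toLp_add]
    exact MemLp.toLp_congr _ _ (Eventually.of_forall fun x => val_add _ _ x)
  map_smul' a u := by
    rw [RingHom.id_apply, ← MemLp.toLp_const_smul]
    exact MemLp.toLp_congr _ _ (Eventually.of_forall fun x => val_smul _ _ x)

theorem coeFn_polyL2 {k : ℕ} (u : PolyDeg d k) :
    polyL2 d k u =ᵐ[volume.restrict (Metric.closedBall (0 : Pt d) 1)] val (u : Poly d) :=
  MemLp.coeFn_toLp (memLp_restrict_of_continuousOn (isCompact_closedBall (0 : Pt d) 1)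
    (continuous_val (u : Poly d)).continuousOn 2)

theorem norm_polyL2_sq {k : ℕ} (u : PolyDeg d k) :
    ‖polyL2 d k u‖ ^ 2 = ∫ x in Metric.closedBall (0 : Pt d) 1, val (u : Poly d) x ^ 2 := by
  rw [← real_inner_self_eq_norm_sq, L2.inner_def]
  refine integral_congr_ae ?_
  filter_upwards [coeFn_polyL2 u] with x hx
  rw [hx]
  simp [sq]

theorem eq_zero_of_val_eq_zero_on_ball {u : Poly d} {r : ℝ} (hr : 0 < r)
    (h : ∀ x ∈ Metric.ball (0 : Pt d) r, val u x = 0) : u = 0 := by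
  have hpre : (fun x : Fin d → ℝ => (WithLp.toLp 2 x : Pt d)) ⁻¹' Metric.ball 0 r ∈ 𝓝 0 :=
    (PiLp.continuous_toLp 2 (fun _ : Fin d => ℝ)).continuousAt (Metric.ball_mem_nhds _ hr)
  obtain ⟨ε, hε, hball⟩ := Metric.mem_nhds_iff.1 hpre
  refine MvPolynomial.funext_set (fun _ => Metric.ball (0 : ℝ) ε)
    (fun _ => infinite_of_mem_nhds 0 (Metric.ball_mem_nhds _ hε)) fun x hx => ?_
  have hx' : x ∈ Metric.ball (0 : Fin d → ℝ) ε := by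
    rw [ball_pi _ hε]; exact hx
  rw [map_zero]
  exact h _ (hball hx')

theorem polyL2_injective (d k : ℕ) : Function.Injective (polyL2 d k) := by
  rw [injective_iff_map_eq_zero]
  intro u hu
  have ae_eq_zero := coeFn_polyL2 u
  rw [hu] at ae_eq_zero
  have eqOn_ball : Set.EqOn (val (u : Poly d)) 0 (Metric.ball 0 1) :=
    Measure.eqOn_open_of_ae_eq (μ := volume)
      (ae_restrict_of_ae_restrict_of_subset Metric.ball_subset_closedBall
        (ae_eq_zero.symm.trans (Lp.coeFn_zero _ _ _)))
      Metric.isOpen_ball (continuous_val _).continuousOn continuousOn_const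
  ext1
  exact eq_zero_of_val_eq_zero_on_ball one_pos eqOn_ball

/-- A polynomial as a continuous function on the ball of radius `s`, with the supremum norm. -/
def polyC (d k : ℕ) (s : ℝ) : PolyDeg d k →ₗ[ℝ] C(Metric.closedBall (0 : Pt d) s, ℝ) where
  toFun u := ⟨fun x => val (u : Poly d) x, (continuous_val _).comp continuous_subtype_val⟩
  map_add' u v := by ext x; simp [val_add]
  map_smul' a u := by ext x; simp [val_smul]

theorem exists_inverse_estimate_unitBall (d k : ℕ) (s : ℝ) :
    ∃ C > 0, ∀ u ∈ PolyDeg d k, ∀ x ∈ Metric.closedBall (0 : Pt d) s,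
      val u x ^ 2 ≤ C * ∫ y in Metric.closedBall (0 : Pt d) 1, val u y ^ 2 := by
  obtain ⟨C, hC, hbound⟩ := exists_norm_le_mul_norm_of_injective (polyL2 d k) (polyC d k s)
    (polyL2_injective d k)
  refine ⟨C ^ 2, by positivity, fun u hu x hx => ?_⟩
  have abs_le : |val u x| ≤ C * ‖polyL2 d k ⟨u, hu⟩‖ :=
    ((polyC d k s ⟨u, hu⟩).norm_coe_le_norm ⟨x, hx⟩).trans (hbound _)
  rw [← norm_polyL2_sq ⟨u, hu⟩, ← mul_pow, ← sq_abs]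
  exact pow_le_pow_left₀ (abs_nonneg _) abs_le 2

open scoped Pointwise in
theorem setIntegral_unitBall_comp_affine (f : Pt d → ℝ) (c : Pt d) {r : ℝ} (hr : 0 < r) :
    (∫ y in Metric.closedBall (0 : Pt d) 1, f (c + r • y)) * r ^ d =
      ∫ y in Metric.closedBall c r, f y := by
  have smul_ball : r • Metric.closedBall (0 : Pt d) 1 =
      (fun z => c + z) ⁻¹' Metric.closedBall c r := by
    rw [smul_unitClosedBall, Real.norm_of_nonneg hr.le]
    ext z
    simp
  rw [Measure.setIntegral_comp_smul_of_pos volume (fun z => f (c + z)) _ hr,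
    finrank_euclideanSpace_fin, smul_ball,
    (measurePreserving_add_left volume c).setIntegral_preimage_emb
      (MeasurableEquiv.addLeft c).measurableEmbedding f, smul_eq_mul]
  field_simp

theorem exists_inverse_estimate (d k : ℕ) (s : ℝ) :
    ∃ C > 0, ∀ u ∈ PolyDeg d k, ∀ (c : Pt d) (r : ℝ), 0 < r → ∀ x ∈ Metric.closedBall c (s * r),
      val u x ^ 2 * r ^ d ≤ C * ∫ y in Metric.closedBall c r, val u y ^ 2 := by
  obtain ⟨C, hC, hbound⟩ := exists_inverse_estimate_unitBall d k s
  refine ⟨C, hC, fun u hu c r hr x hx => ?_⟩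
  obtain ⟨v, hv, val_v⟩ := exists_comp_affine hu c r
  have hx_scaled : r⁻¹ • (x - c) ∈ Metric.closedBall (0 : Pt d) s := by
    rw [mem_closedBall_zero_iff, norm_smul, Real.norm_of_nonneg (inv_nonneg.2 hr.le),
      inv_mul_le_iff₀ hr, mul_comm r, ← dist_eq_norm]
    exact hx
  have val_scaled : val v (r⁻¹ • (x - c)) = val u x := by
    rw [val_v, smul_smul, mul_inv_cancel₀ hr.ne', one_smul, add_sub_cancel]
  rw [← setIntegral_unitBall_comp_affine (fun y => val u y ^ 2) c hr, ← mul_assoc]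
  simp_rw [← val_v]
  exact mul_le_mul_of_nonneg_right (val_scaled ▸ hbound v hv _ hx_scaled) (pow_pos hr d).le

theorem norm_vecVal_sq (q : Fin d → Poly d) (x : Pt d) :
    ‖vecVal q x‖ ^ 2 = ∑ i, val (q i) x ^ 2 := by
  rw [EuclideanSpace.norm_sq_eq]
  simp [vecVal]

theorem exists_inverse_estimate_vecVal (d k : ℕ) (s : ℝ) :
    ∃ C > 0, ∀ q : Fin d → Poly d, (∀ i, q i ∈ PolyDeg d k) → ∀ (c : Pt d) (r : ℝ), 0 < r →
      ∀ x ∈ Metric.closedBall c (s * r),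
        ‖vecVal q x‖ ^ 2 * r ^ d ≤ C * ∫ y in Metric.closedBall c r, ‖vecVal q y‖ ^ 2 := by
  obtain ⟨C, hC, hbound⟩ := exists_inverse_estimate d k s
  refine ⟨C, hC, fun q hq c r hr x hx => ?_⟩
  have integrable (i : Fin d) :
      IntegrableOn (fun y => val (q i) y ^ 2) (Metric.closedBall c r) :=
    ((continuous_val _).pow 2).continuousOn.integrableOn_compact (isCompact_closedBall _ _)
  simp_rw [norm_vecVal_sq]
  rw [integral_finsetSum _ fun i _ => integrable i, Finset.sum_mul, Finset.mul_sum]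
  exact Finset.sum_le_sum fun i _ => hbound _ (hq i) c r hr x hx

theorem exists_oscillation_estimate (d k : ℕ) (s : ℝ) :
    ∃ C > 0, ∀ u ∈ PolyDeg d k, ∀ (K : Set (Pt d)), IsCompact K → Convex ℝ K →
      ∀ (c : Pt d) (r : ℝ), 0 < r → Metric.closedBall c r ⊆ K → Metric.diam K ≤ s * r →
      ∀ x ∈ K, ∀ y ∈ K, (val u x - val u y) ^ 2 * r ^ d ≤
        C * Metric.diam K ^ 2 * ∫ z in K, ‖vecVal (polyGrad u) z‖ ^ 2 := by
  obtain ⟨C, hC, hbound⟩ := exists_inverse_estimate_vecVal d k s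
  refine ⟨C, hC, fun u hu K hK hK_convex c r hr hball hdiam x hx y hy => ?_⟩
  set J := ∫ z in K, ‖vecVal (polyGrad u) z‖ ^ 2
  have hJ_nonneg : 0 ≤ J := integral_nonneg fun _ => by positivity
  have hr_pow : 0 < r ^ d := pow_pos hr d
  have grad_sq_le (z : Pt d) (hz : z ∈ K) : ‖vecVal (polyGrad u) z‖ ^ 2 * r ^ d ≤ C * J := by
    have hz_ball : z ∈ Metric.closedBall c (s * r) :=
      (Metric.dist_le_diam_of_mem hK.isBounded hz
        (hball (Metric.mem_closedBall_self hr.le))).trans hdiam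
    refine (hbound _ (pderiv_mem_polyDeg hu) c r hr z hz_ball).trans
      (mul_le_mul_of_nonneg_left (setIntegral_mono_set ?_ ?_ hball.eventuallyLE) hC.le)
    · exact ((continuous_vecVal _).norm.pow 2).continuousOn.integrableOn_compact hK
    · exact Eventually.of_forall fun _ => by positivity
  have grad_le (z : Pt d) (hz : z ∈ K) : ‖vecVal (polyGrad u) z‖ ≤ √(C * J / r ^ d) :=
    Real.le_sqrt_of_sq_le ((le_div_iff₀ hr_pow).2 (grad_sq_le z hz))
  have abs_sub_le : |val u x - val u y| ≤ √(C * J / r ^ d) * Metric.diam K := by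
    have mean_value := hK_convex.norm_image_sub_le_of_norm_hasFDerivWithin_le (f := val u)
      (fun z _ => (hasGradientAt_val u z).hasFDerivAt.hasFDerivWithinAt)
      (fun z hz => by simpa using grad_le z hz) hy hx
    refine mean_value.trans (mul_le_mul_of_nonneg_left ?_ (Real.sqrt_nonneg _))
    rw [← dist_eq_norm]
    exact Metric.dist_le_diam_of_mem hK.isBounded hx hy
  calc (val u x - val u y) ^ 2 * r ^ d
      ≤ (√(C * J / r ^ d) * Metric.diam K) ^ 2 * r ^ d := by
        rw [← sq_abs]
        exact mul_le_mul_of_nonneg_right (pow_le_pow_left₀ (abs_nonneg _) abs_sub_le 2) hr_pow.le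
    _ = C * Metric.diam K ^ 2 * J := by
        rw [mul_pow, Real.sq_sqrt (div_nonneg (mul_nonneg hC.le hJ_nonneg) hr_pow.le)]
        field_simp

/-! ### Integrals over the cells and their boundaries -/

theorem integrableOn_hull {T : Finset (Pt d)} {f : Pt d → ℝ} (hf : ContinuousOn f (hull T)) :
    IntegrableOn f (hull T) := hf.integrableOn_compact (isCompact_hull T)

theorem setIntegral_hull_eq_linear_comb {T : Finset (Pt d)} {f g h : Pt d → ℝ} (hf : Continuous f)
    (hg : Continuous g) {a b : ℝ} (hh : ∀ x, h x = a * f x + b * g x) :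
    ∫ x in hull T, h x = a * (∫ x in hull T, f x) + b * ∫ x in hull T, g x := by
  simp_rw [hh]
  rw [integral_add ((integrableOn_hull hf.continuousOn).const_mul a)
    ((integrableOn_hull hg.continuousOn).const_mul b), integral_const_mul, integral_const_mul]

/-- Facewise continuity of boundary data of a cell; the values on different faces need not match. -/
def BdryCont (T : Finset (Pt d)) (f : Finset (Pt d) → Pt d → ℝ) : Prop :=
  ∀ F ∈ facets T, ContinuousOn (f F) (hull F)

theorem bdryIntegral_congr {T : Finset (Pt d)} {f g : Finset (Pt d) → Pt d → ℝ}
    (h : ∀ F ∈ facets T, ∀ x ∈ hull F, f F x = g F x) : bdryIntegral T f = bdryIntegral T g :=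
  Finset.sum_congr rfl fun F hF => setIntegral_congr_fun (isClosed_hull F).measurableSet (h F hF)

theorem bdryIntegral_eq_linear_comb {T : Finset (Pt d)} (hT : IsSimplex T) [NeZero d]
    {f g h : Finset (Pt d) → Pt d → ℝ} (hf : BdryCont T f) (hg : BdryCont T g) {a b : ℝ}
    (hh : ∀ F ∈ facets T, ∀ x ∈ hull F, h F x = a * f F x + b * g F x) :
    bdryIntegral T h = a * bdryIntegral T f + b * bdryIntegral T g := by
  rw [bdryIntegral_congr hh]
  simp only [bdryIntegral, Finset.mul_sum, ← Finset.sum_add_distrib]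
  refine Finset.sum_congr rfl fun F hF => ?_
  rw [integral_add ((integrableOn_face hT hF (hf F hF)).const_mul a)
    ((integrableOn_face hT hF (hg F hF)).const_mul b), integral_const_mul, integral_const_mul]

theorem bdryIntegral_const_mul (T : Finset (Pt d)) (f : Finset (Pt d) → Pt d → ℝ) (a : ℝ) :
    bdryIntegral T (fun F x => a * f F x) = a * bdryIntegral T f := by
  simp only [bdryIntegral, Finset.mul_sum]
  exact Finset.sum_congr rfl fun F _ => integral_const_mul _ _

theorem bdryIntegral_nonneg {T : Finset (Pt d)} {f : Finset (Pt d) → Pt d → ℝ}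
    (h : ∀ F ∈ facets T, ∀ x ∈ hull F, 0 ≤ f F x) : 0 ≤ bdryIntegral T f :=
  Finset.sum_nonneg fun F hF => setIntegral_nonneg (isClosed_hull F).measurableSet (h F hF)

theorem bdryIntegral_mono {T : Finset (Pt d)} (hT : IsSimplex T) [NeZero d]
    {f g : Finset (Pt d) → Pt d → ℝ} (hf : BdryCont T f) (hg : BdryCont T g)
    (h : ∀ F ∈ facets T, ∀ x ∈ hull F, f F x ≤ g F x) : bdryIntegral T f ≤ bdryIntegral T g :=
  Finset.sum_le_sum fun F hF => setIntegral_mono_on (integrableOn_face hT hF (hf F hF))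
    (integrableOn_face hT hF (hg F hF)) (isClosed_hull F).measurableSet (h F hF)

/-! ### `L²` norms -/

theorem l2norm_nonneg {F : Type*} [NormedAddCommGroup F] (Ω : Set (Pt d)) (f : Pt d → F) :
    0 ≤ l2norm Ω f := Real.sqrt_nonneg _

theorem l2norm_eq_toReal {F : Type*} [NormedAddCommGroup F] {Ω : Set (Pt d)} {f : Pt d → F}
    (hf : MemLp f 2 (volume.restrict Ω)) :
    l2norm Ω f = (eLpNorm f 2 (volume.restrict Ω)).toReal := by
  rw [hf.eLpNorm_eq_integral_rpow_norm (by norm_num) (by norm_num),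
    ENNReal.toReal_ofReal (by positivity), l2norm, Real.sqrt_eq_rpow]
  norm_num

theorem l2norm_congr {F : Type*} [NormedAddCommGroup F] {Ω : Set (Pt d)} {f g : Pt d → F}
    (h : f =ᵐ[volume.restrict Ω] g) : l2norm Ω f = l2norm Ω g := by
  rw [l2norm, l2norm]
  congr 1
  exact integral_congr_ae (h.mono fun x hx => by simp only [hx])

theorem l2norm_neg {F : Type*} [NormedAddCommGroup F] (Ω : Set (Pt d)) (f : Pt d → F) :
    l2norm Ω (-f) = l2norm Ω f := by simp [l2norm]

theorem l2norm_add_le {F : Type*} [NormedAddCommGroup F] {Ω : Set (Pt d)} {f g : Pt d → F}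
    (hf : MemLp f 2 (volume.restrict Ω)) (hg : MemLp g 2 (volume.restrict Ω)) :
    l2norm Ω (f + g) ≤ l2norm Ω f + l2norm Ω g := by
  rw [l2norm_eq_toReal hf, l2norm_eq_toReal hg, l2norm_eq_toReal (hf.add hg),
    ← ENNReal.toReal_add hf.2.ne hg.2.ne]
  exact ENNReal.toReal_mono (ENNReal.add_ne_top.2 ⟨hf.2.ne, hg.2.ne⟩)
    (eLpNorm_add_le hf.1 hg.1 (by norm_num))

theorem l2norm_sub_le {F : Type*} [NormedAddCommGroup F] {Ω : Set (Pt d)} {f g : Pt d → F}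
    (hf : MemLp f 2 (volume.restrict Ω)) (hg : MemLp g 2 (volume.restrict Ω)) :
    l2norm Ω (f - g) ≤ l2norm Ω f + l2norm Ω g := by
  rw [sub_eq_add_neg, ← l2norm_neg Ω g]
  exact l2norm_add_le hf hg.neg

namespace SimplicialMesh

variable {Ω : Set (Pt d)} (𝒯 : SimplicialMesh d Ω)

theorem ae_mem_interior : ∀ᵐ x ∂(volume.restrict Ω), ∃ T ∈ 𝒯.cells, x ∈ interior (hull T) := by
  have notMem_frontier : ∀ᵐ x ∂(volume : Measure (Pt d)), ∀ T ∈ 𝒯.cells, x ∉ frontier (hull T) :=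
    (ae_ball_iff 𝒯.cells.countable_toSet).2 fun T _ =>
      measure_eq_zero_iff_ae_notMem.1 (volume_frontier_hull T)
  have mem_closure : ∀ᵐ x ∂(volume.restrict Ω), x ∈ closure Ω :=
    ae_mono (Measure.restrict_mono subset_closure le_rfl)
      (ae_restrict_mem isClosed_closure.measurableSet)
  filter_upwards [ae_restrict_of_ae notMem_frontier, mem_closure] with x hx hxΩ
  obtain ⟨T, hT, hxT⟩ := 𝒯.exists_cell hxΩ
  refine ⟨T, hT, ?_⟩
  by_contra hx_interior
  exact hx T hT ((isClosed_hull T).frontier_eq ▸ ⟨hxT, hx_interior⟩)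

theorem eq_of_mem_interior {T T' : Finset (Pt d)} (hT : T ∈ 𝒯.cells) (hT' : T' ∈ 𝒯.cells)
    {x : Pt d} (hx : x ∈ interior (hull T)) (hx' : x ∈ hull T') : T = T' :=
  𝒯.eq_of_interior_inter_nonempty hT hT' ⟨x, hx, hx'⟩

theorem fn_eq (u : Finset (Pt d) → Poly d) {T : Finset (Pt d)} (hT : T ∈ 𝒯.cells) {x : Pt d}
    (hx : x ∈ interior (hull T)) : 𝒯.fn u x = val (u T) x := by
  rw [fn, Finset.sum_eq_single_of_mem T hT, Set.indicator_of_mem hx]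
  intro T' hT' hne
  refine Set.indicator_of_notMem (fun h => hne ?_) _
  exact 𝒯.eq_of_mem_interior hT' hT h (interior_subset hx)

theorem vecFn_eq (q : Finset (Pt d) → Fin d → Poly d) {T : Finset (Pt d)} (hT : T ∈ 𝒯.cells)
    {x : Pt d} (hx : x ∈ interior (hull T)) : 𝒯.vecFn q x = vecVal (q T) x := by
  rw [vecFn, Finset.sum_eq_single_of_mem T hT, Set.indicator_of_mem hx]
  intro T' hT' hne
  refine Set.indicator_of_notMem (fun h => hne ?_) _
  exact 𝒯.eq_of_mem_interior hT' hT h (interior_subset hx)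

theorem memLp_fn (u : Finset (Pt d) → Poly d) : MemLp (𝒯.fn u) 2 (volume.restrict Ω) := by
  have fn_eq_sum : 𝒯.fn u = ∑ T ∈ 𝒯.cells, (interior (hull T)).indicator (val (u T)) := by
    funext x
    simp [fn]
  rw [fn_eq_sum]
  refine memLp_finsetSum' _ fun T _ => MemLp.restrict _ ?_
  rw [memLp_indicator_iff_restrict isOpen_interior.measurableSet]
  exact (memLp_restrict_of_continuousOn (isCompact_hull T)
    (continuous_val (u T)).continuousOn 2).mono_measure
    (Measure.restrict_mono interior_subset le_rfl)

theorem memLp_vecFn (q : Finset (Pt d) → Fin d → Poly d) :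
    MemLp (𝒯.vecFn q) 2 (volume.restrict Ω) := by
  have vecFn_eq_sum : 𝒯.vecFn q = ∑ T ∈ 𝒯.cells, (interior (hull T)).indicator (vecVal (q T)) := by
    funext x
    simp [vecFn]
  rw [vecFn_eq_sum]
  refine memLp_finsetSum' _ fun T _ => MemLp.restrict _ ?_
  rw [memLp_indicator_iff_restrict isOpen_interior.measurableSet]
  exact (memLp_restrict_of_continuousOn (isCompact_hull T)
    (continuous_vecVal (q T)).continuousOn 2).mono_measure
    (Measure.restrict_mono interior_subset le_rfl)

theorem integral_eq_sum (hΩ : IsLipschitzDomain Ω) {f : Pt d → ℝ} {g : Finset (Pt d) → Pt d → ℝ}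
    (hg : ∀ T ∈ 𝒯.cells, Continuous (g T))
    (h : ∀ T ∈ 𝒯.cells, ∀ x ∈ interior (hull T), f x = g T x) :
    ∫ x in Ω, f x = ∑ T ∈ 𝒯.cells, ∫ x in hull T, g T x := by
  have ae_eq_union : Ω =ᵐ[volume] ⋃ T ∈ 𝒯.cells, interior (hull T) := by
    have union_subset : (⋃ T ∈ 𝒯.cells, interior (hull T)) ⊆ Ω :=
      Set.iUnion₂_subset fun T hT => 𝒯.interior_hull_subset hΩ hT
    refine Filter.EventuallyLE.antisymm ?_ union_subset.eventuallyLE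
    filter_upwards [(ae_restrict_iff' hΩ.isOpen.measurableSet).1 𝒯.ae_mem_interior] with x hx hxΩ
    obtain ⟨T, hT, hxT⟩ := hx hxΩ
    exact Set.mem_biUnion hT hxT
  rw [setIntegral_congr_set ae_eq_union, integral_biUnion_finset 𝒯.cells
    (fun T _ => isOpen_interior.measurableSet)]
  · refine Finset.sum_congr rfl fun T hT => ?_
    rw [setIntegral_congr_fun isOpen_interior.measurableSet (h T hT)]
    exact setIntegral_congr_set (interior_ae_eq_of_null_frontier (volume_frontier_hull T))
  · intro T hT T' hT' hne
    refine Set.disjoint_left.2 fun x hx hx' => hne ?_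
    exact 𝒯.eq_of_mem_interior hT hT' hx (interior_subset hx')
  · intro T hT
    refine IntegrableOn.congr_fun ?_ (fun x hx => (h T hT x hx).symm) isOpen_interior.measurableSet
    exact (integrableOn_hull (hg T hT).continuousOn).mono_set interior_subset

theorem l2norm_vecFn_sq (hΩ : IsLipschitzDomain Ω) (q : Finset (Pt d) → Fin d → Poly d) :
    l2norm Ω (𝒯.vecFn q) ^ 2 = ∑ T ∈ 𝒯.cells, ∫ x in hull T, ‖vecVal (q T) x‖ ^ 2 := by
  rw [l2norm, Real.sq_sqrt (integral_nonneg fun _ => by positivity)]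
  refine 𝒯.integral_eq_sum hΩ (fun T _ => (continuous_vecVal _).norm.pow 2) fun T hT x hx => ?_
  rw [𝒯.vecFn_eq q hT hx]

theorem skelNorm_nonneg (f : Finset (Pt d) → Finset (Pt d) → Pt d → ℝ) : 0 ≤ 𝒯.skelNorm f :=
  Real.sqrt_nonneg _

theorem volRatio_mul_bdryIntegral_sq_nonneg [NeZero d] {T : Finset (Pt d)} (hT : T ∈ 𝒯.cells)
    (f : Finset (Pt d) → Pt d → ℝ) : 0 ≤ volRatio T * bdryIntegral T (fun F x => f F x ^ 2) :=
  mul_nonneg (𝒯.isSimplex hT).volRatio_pos.le (bdryIntegral_nonneg fun _ _ _ _ => sq_nonneg _)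

theorem skelNorm_sq [NeZero d] (f : Finset (Pt d) → Finset (Pt d) → Pt d → ℝ) :
    𝒯.skelNorm f ^ 2 = ∑ T ∈ 𝒯.cells, volRatio T * bdryIntegral T (fun F x => f T F x ^ 2) :=
  Real.sq_sqrt (Finset.sum_nonneg fun _ hT => 𝒯.volRatio_mul_bdryIntegral_sq_nonneg hT _)

theorem isFace {T F : Finset (Pt d)} (hT : T ∈ 𝒯.cells) (hF : F ∈ facets T) : 𝒯.IsFace F :=
  ⟨T, hT, hF⟩

theorem M_continuousOn {p : ℕ} (lam : 𝒯.M p) {T F : Finset (Pt d)} (hT : T ∈ 𝒯.cells)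
    (hF : F ∈ facets T) : ContinuousOn ((lam : Finset (Pt d) → Pt d → ℝ) F) (hull F) := by
  obtain ⟨P, -, hP⟩ := lam.2.1 F (𝒯.isFace hT hF)
  rw [hP]
  exact (continuous_val P).continuousOn.congr fun x hx => Set.indicator_of_mem hx _

theorem M_eq_zero_of_frontier {p : ℕ} (lam : 𝒯.M p) {F : Finset (Pt d)} (hF : 𝒯.IsFace F)
    (h : hull F ⊆ frontier Ω) : (lam : Finset (Pt d) → Pt d → ℝ) F = 0 := lam.2.2.1 F hF h

end SimplicialMesh

/-! ### Linearity of the local solvers -/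

section LinearComb

variable {V : Submodule ℝ (Poly d)} {W : Submodule ℝ (Fin d → Poly d)} {τ : ℝ} {T : Finset (Pt d)}
  {l₁ l₂ : Finset (Pt d) → Pt d → ℝ} {u₁ u₂ : Poly d} {q₁ q₂ : Fin d → Poly d}

theorem continuousOn_inner_vecVal (q : Fin d → Poly d) (n : Pt d) (s : Set (Pt d)) :
    ContinuousOn (fun x => inner ℝ (vecVal q x) n) s :=
  ((continuous_vecVal q).inner continuous_const).continuousOn

theorem setIntegral_inner_vecVal_linear_comb (q₁ q₂ r : Fin d → Poly d) (a b : ℝ) :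
    ∫ x in hull T, inner ℝ (vecVal (a • q₁ + b • q₂) x) (vecVal r x) =
      a * (∫ x in hull T, inner ℝ (vecVal q₁ x) (vecVal r x)) +
        b * ∫ x in hull T, inner ℝ (vecVal q₂ x) (vecVal r x) :=
  setIntegral_hull_eq_linear_comb ((continuous_vecVal _).inner (continuous_vecVal _))
    ((continuous_vecVal _).inner (continuous_vecVal _)) fun x => by
      simp only [vecVal_add, vecVal_smul, inner_add_left, real_inner_smul_left]

theorem IsLocalSolution.primary_linear_comb (hT : IsSimplex T) [NeZero d]
    (hl₁ : BdryCont T l₁) (hl₂ : BdryCont T l₂) (h₁ : IsLocalSolution V W τ T l₁ u₁ q₁)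
    (h₂ : IsLocalSolution V W τ T l₂ u₂ q₂) (a b : ℝ) {r : Fin d → Poly d} (hr : r ∈ W) :
    (∫ x in hull T, inner ℝ (vecVal (a • q₁ + b • q₂) x) (vecVal r x)) -
        ∫ x in hull T, val (a • u₁ + b • u₂) x * val (polyDiv r) x =
      -bdryIntegral T fun F x =>
        (a • l₁ + b • l₂) F x * inner ℝ (vecVal r x) (outerNormal T F) := by
  have div_term : ∫ x in hull T, val (a • u₁ + b • u₂) x * val (polyDiv r) x =
      a * (∫ x in hull T, val u₁ x * val (polyDiv r) x) +
        b * ∫ x in hull T, val u₂ x * val (polyDiv r) x :=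
    setIntegral_hull_eq_linear_comb ((continuous_val _).mul (continuous_val _))
      ((continuous_val _).mul (continuous_val _)) fun x => by
        simp only [val_add, val_smul, add_mul, mul_assoc, Pi.mul_apply]
  have data_term : bdryIntegral T (fun F x =>
        (a • l₁ + b • l₂) F x * inner ℝ (vecVal r x) (outerNormal T F)) =
      a * bdryIntegral T (fun F x => l₁ F x * inner ℝ (vecVal r x) (outerNormal T F)) +
        b * bdryIntegral T (fun F x => l₂ F x * inner ℝ (vecVal r x) (outerNormal T F)) := by
    refine bdryIntegral_eq_linear_comb hT
      (fun F hF => (hl₁ F hF).mul (continuousOn_inner_vecVal r _ _))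
      (fun F hF => (hl₂ F hF).mul (continuousOn_inner_vecVal r _ _)) fun F _ x _ => ?_
    simp only [Pi.add_apply, Pi.smul_apply, smul_eq_mul, Pi.mul_apply]
    ring
  rw [setIntegral_inner_vecVal_linear_comb, div_term, data_term]
  linear_combination a * h₁.primary r hr + b * h₂.primary r hr

theorem IsLocalSolution.flux_linear_comb (hT : IsSimplex T) [NeZero d]
    (hl₁ : BdryCont T l₁) (hl₂ : BdryCont T l₂) (h₁ : IsLocalSolution V W τ T l₁ u₁ q₁)
    (h₂ : IsLocalSolution V W τ T l₂ u₂ q₂) (a b : ℝ) {v : Poly d} (hv : v ∈ V) :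
    bdryIntegral T (fun F x => (inner ℝ (vecVal (a • q₁ + b • q₂) x) (outerNormal T F) +
          τ * val (a • u₁ + b • u₂) x) * val v x) -
        ∫ x in hull T, inner ℝ (vecVal (a • q₁ + b • q₂) x) (vecVal (polyGrad v) x) =
      τ * bdryIntegral T (fun F x => (a • l₁ + b • l₂) F x * val v x) := by
  have continuousOn_val (u : Poly d) (s : Set (Pt d)) : ContinuousOn (val u) s :=
    (continuous_val u).continuousOn
  have numerical_flux_continuousOn (u : Poly d) (q : Fin d → Poly d) :
      BdryCont T fun F x => (inner ℝ (vecVal q x) (outerNormal T F) + τ * val u x) * val v x :=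
    fun F _ => ((continuousOn_inner_vecVal q _ _).add
      (continuousOn_const.mul (continuousOn_val u _))).mul (continuousOn_val v _)
  have flux_term : bdryIntegral T (fun F x =>
        (inner ℝ (vecVal (a • q₁ + b • q₂) x) (outerNormal T F) +
          τ * val (a • u₁ + b • u₂) x) * val v x) =
      a * bdryIntegral T (fun F x =>
        (inner ℝ (vecVal q₁ x) (outerNormal T F) + τ * val u₁ x) * val v x) +
      b * bdryIntegral T (fun F x =>
        (inner ℝ (vecVal q₂ x) (outerNormal T F) + τ * val u₂ x) * val v x) := by
    refine bdryIntegral_eq_linear_comb hT (numerical_flux_continuousOn u₁ q₁)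
      (numerical_flux_continuousOn u₂ q₂) fun F _ x _ => ?_
    simp only [vecVal_add, vecVal_smul, inner_add_left, real_inner_smul_left, val_add, val_smul]
    ring
  have data_term : bdryIntegral T (fun F x => (a • l₁ + b • l₂) F x * val v x) =
      a * bdryIntegral T (fun F x => l₁ F x * val v x) +
        b * bdryIntegral T (fun F x => l₂ F x * val v x) := by
    refine bdryIntegral_eq_linear_comb hT (fun F hF => (hl₁ F hF).mul (continuousOn_val v _))
      (fun F hF => (hl₂ F hF).mul (continuousOn_val v _)) fun F _ x _ => ?_
    simp only [Pi.add_apply, Pi.smul_apply, smul_eq_mul, Pi.mul_apply]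
    ring
  rw [setIntegral_inner_vecVal_linear_comb, flux_term, data_term]
  linear_combination a * h₁.flux v hv + b * h₂.flux v hv

theorem IsLocalSolution.linear_comb (hT : IsSimplex T) [NeZero d]
    (hl₁ : BdryCont T l₁) (hl₂ : BdryCont T l₂) (h₁ : IsLocalSolution V W τ T l₁ u₁ q₁)
    (h₂ : IsLocalSolution V W τ T l₂ u₂ q₂) (a b : ℝ) :
    IsLocalSolution V W τ T (a • l₁ + b • l₂) (a • u₁ + b • u₂) (a • q₁ + b • q₂) where
  mem_V := add_mem (V.smul_mem a h₁.mem_V) (V.smul_mem b h₂.mem_V)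
  mem_W := add_mem (W.smul_mem a h₁.mem_W) (W.smul_mem b h₂.mem_W)
  primary _ hr := h₁.primary_linear_comb hT hl₁ hl₂ h₂ a b hr
  flux _ hv := h₁.flux_linear_comb hT hl₁ hl₂ h₂ a b hv

end LinearComb

namespace Method

variable {Ω : Set (Pt d)} {𝒯 : SimplicialMesh d Ω} {p k : ℕ} (S : Method 𝒯 p k)

theorem isLocalSolution {T : Finset (Pt d)} (hT : T ∈ 𝒯.cells) (lam : 𝒯.M p) :
    IsLocalSolution (S.V T) (S.W T) S.τ T lam (S.U lam T) (S.Q lam T) := by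
  simpa [U, Q, sol, hT] using (S.solvable T hT lam lam.2).choose_spec.1

theorem eq_of_isLocalSolution {T : Finset (Pt d)} (hT : T ∈ 𝒯.cells) (lam : 𝒯.M p)
    {u : Poly d} {q : Fin d → Poly d} (h : IsLocalSolution (S.V T) (S.W T) S.τ T lam u q) :
    u = S.U lam T ∧ q = S.Q lam T :=
  Prod.mk.inj <| (S.solvable T hT lam lam.2).unique (y₁ := (u, q)) (y₂ := (S.U lam T, S.Q lam T)) h
    (S.isLocalSolution hT lam)

theorem U_Q_linear_comb [NeZero d] {T : Finset (Pt d)} (hT : T ∈ 𝒯.cells) (lam mu : 𝒯.M p)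
    (a b : ℝ) :
    a • S.U lam T + b • S.U mu T = S.U (a • lam + b • mu) T ∧
      a • S.Q lam T + b • S.Q mu T = S.Q (a • lam + b • mu) T :=
  S.eq_of_isLocalSolution hT _ <| by
    simpa using (S.isLocalSolution hT lam).linear_comb (𝒯.isSimplex hT)
      (fun F hF => 𝒯.M_continuousOn lam hT hF) (fun F hF => 𝒯.M_continuousOn mu hT hF)
      (S.isLocalSolution hT mu) a b

theorem val_U_linear_comb [NeZero d] {T : Finset (Pt d)} (hT : T ∈ 𝒯.cells) (lam mu : 𝒯.M p)
    (a b : ℝ) (x : Pt d) :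
    val (S.U (a • lam + b • mu) T) x = a * val (S.U lam T) x + b * val (S.U mu T) x := by
  rw [← (S.U_Q_linear_comb hT lam mu a b).1, val_add, val_smul, val_smul]

theorem vecVal_Q_linear_comb [NeZero d] {T : Finset (Pt d)} (hT : T ∈ 𝒯.cells) (lam mu : 𝒯.M p)
    (a b : ℝ) (x : Pt d) :
    vecVal (S.Q (a • lam + b • mu) T) x = a • vecVal (S.Q lam T) x + b • vecVal (S.Q mu T) x := by
  rw [← (S.U_Q_linear_comb hT lam mu a b).2, vecVal_add, vecVal_smul, vecVal_smul]

theorem jump_linear_comb [NeZero d] {T : Finset (Pt d)} (hT : T ∈ 𝒯.cells) (lam mu : 𝒯.M p)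
    (a b : ℝ) (F : Finset (Pt d)) (x : Pt d) :
    S.jump (a • lam + b • mu) T F x = a * S.jump lam T F x + b * S.jump mu T F x := by
  simp only [jump, S.val_U_linear_comb hT, Submodule.coe_add, Submodule.coe_smul, Pi.add_apply,
    Pi.smul_apply, smul_eq_mul]
  ring

theorem jump_continuousOn (lam : 𝒯.M p) {T F : Finset (Pt d)} (hT : T ∈ 𝒯.cells)
    (hF : F ∈ facets T) : ContinuousOn (S.jump lam T F) (hull F) :=
  (continuous_val _).continuousOn.sub (𝒯.M_continuousOn lam hT hF)

theorem normQ_nonneg (lam : 𝒯.M p) : 0 ≤ S.normQ lam := l2norm_nonneg _ _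

theorem normQ_sq (hΩ : IsLipschitzDomain Ω) (lam : 𝒯.M p) :
    S.normQ lam ^ 2 = ∑ T ∈ 𝒯.cells, ∫ x in hull T, ‖vecVal (S.Q lam T) x‖ ^ 2 :=
  𝒯.l2norm_vecFn_sq hΩ _

theorem a_eq (hΩ : IsLipschitzDomain Ω) (lam mu : 𝒯.M p) :
    S.a lam mu = ∑ T ∈ 𝒯.cells,
      ((∫ x in hull T, inner ℝ (vecVal (S.Q lam T) x) (vecVal (S.Q mu T) x)) +
        bdryIntegral T (fun F x => S.τ * S.jump lam T F x * S.jump mu T F x)) := by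
  rw [a, Finset.sum_add_distrib]
  congr 1
  refine 𝒯.integral_eq_sum hΩ (fun T _ => (continuous_vecVal _).inner (continuous_vecVal _))
    fun T hT x hx => ?_
  rw [𝒯.vecFn_eq _ hT hx, 𝒯.vecFn_eq _ hT hx]

theorem a_symm (lam mu : 𝒯.M p) : S.a lam mu = S.a mu lam := by
  rw [a, a]
  congr 1
  · simp_rw [real_inner_comm]
  · refine Finset.sum_congr rfl fun T _ => bdryIntegral_congr fun F _ x _ => by ring

theorem a_linear_comb [NeZero d] (hΩ : IsLipschitzDomain Ω) (lam₁ lam₂ mu : 𝒯.M p) (s t : ℝ) :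
    S.a (s • lam₁ + t • lam₂) mu = s * S.a lam₁ mu + t * S.a lam₂ mu := by
  simp only [S.a_eq hΩ, Finset.mul_sum]
  rw [← Finset.sum_add_distrib]
  refine Finset.sum_congr rfl fun T hT => ?_
  have penalty_continuousOn (lam : 𝒯.M p) :
      BdryCont T fun F x => S.τ * S.jump lam T F x * S.jump mu T F x := fun F hF =>
    (continuousOn_const.mul (S.jump_continuousOn lam hT hF)).mul (S.jump_continuousOn mu hT hF)
  have penalty_term : bdryIntegral T (fun F x =>
        S.τ * S.jump (s • lam₁ + t • lam₂) T F x * S.jump mu T F x) =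
      s * bdryIntegral T (fun F x => S.τ * S.jump lam₁ T F x * S.jump mu T F x) +
        t * bdryIntegral T (fun F x => S.τ * S.jump lam₂ T F x * S.jump mu T F x) := by
    refine bdryIntegral_eq_linear_comb (𝒯.isSimplex hT) (penalty_continuousOn lam₁)
      (penalty_continuousOn lam₂) fun F _ x _ => ?_
    simp only [S.jump_linear_comb hT]
    ring
  rw [← (S.U_Q_linear_comb hT lam₁ lam₂ s t).2, setIntegral_inner_vecVal_linear_comb, penalty_term]
  ring

/-- The condensed form `a` bundled as a bilinear form on the skeletal space. -/
def aForm [NeZero d] (hΩ : IsLipschitzDomain Ω) : LinearMap.BilinForm ℝ (𝒯.M p) :=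
  LinearMap.mk₂ ℝ S.a
    (fun l₁ l₂ m => by simpa using S.a_linear_comb hΩ l₁ l₂ m 1 1)
    (fun c l m => by simpa using S.a_linear_comb hΩ l l m c 0)
    (fun m l₁ l₂ => by
      rw [S.a_symm m, S.a_symm m, S.a_symm m]
      simpa using S.a_linear_comb hΩ l₁ l₂ m 1 1)
    (fun c m l => by
      rw [S.a_symm m, S.a_symm m]
      simpa using S.a_linear_comb hΩ l l m c 0)

theorem a_self (hΩ : IsLipschitzDomain Ω) (lam : 𝒯.M p) :
    S.a lam lam = S.normQ lam ^ 2 +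
      S.τ * ∑ T ∈ 𝒯.cells, bdryIntegral T (fun F x => S.jump lam T F x ^ 2) := by
  rw [S.normQ_sq hΩ, S.a_eq hΩ, Finset.sum_add_distrib, Finset.mul_sum]
  congr 1
  · simp_rw [real_inner_self_eq_norm_sq]
  · refine Finset.sum_congr rfl fun T _ => ?_
    rw [← bdryIntegral_const_mul]
    exact bdryIntegral_congr fun F _ x _ => by ring

theorem normQ_sq_le_a (hΩ : IsLipschitzDomain Ω) (lam : 𝒯.M p) :
    S.normQ lam ^ 2 ≤ S.a lam lam := by
  rw [S.a_self hΩ]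
  exact le_add_of_nonneg_right <| mul_nonneg S.τ_nonneg <|
    Finset.sum_nonneg fun T _ => bdryIntegral_nonneg fun _ _ _ _ => sq_nonneg _

theorem a_sq_le_a_mul_a [NeZero d] (hΩ : IsLipschitzDomain Ω) (lam mu : 𝒯.M p) :
    S.a lam mu ^ 2 ≤ S.a lam lam * S.a mu mu :=
  LinearMap.BilinForm.apply_sq_le_of_symm (S.aForm hΩ)
    (fun l => (sq_nonneg _).trans (S.normQ_sq_le_a hΩ l)) ⟨fun l m => S.a_symm l m⟩ lam mu

theorem vecFn_Q_add [NeZero d] (lam mu : 𝒯.M p) :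
    𝒯.vecFn (S.Q (lam + mu)) =ᵐ[volume.restrict Ω] 𝒯.vecFn (S.Q lam) + 𝒯.vecFn (S.Q mu) := by
  filter_upwards [𝒯.ae_mem_interior] with x ⟨T, hT, hx⟩
  have add := S.vecVal_Q_linear_comb hT lam mu 1 1 x
  simp only [one_smul] at add
  rw [Pi.add_apply, 𝒯.vecFn_eq _ hT hx, 𝒯.vecFn_eq _ hT hx, 𝒯.vecFn_eq _ hT hx, add]

theorem fn_U_add [NeZero d] (lam mu : 𝒯.M p) :
    𝒯.fn (S.U (lam + mu)) =ᵐ[volume.restrict Ω] 𝒯.fn (S.U lam) + 𝒯.fn (S.U mu) := by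
  filter_upwards [𝒯.ae_mem_interior] with x ⟨T, hT, hx⟩
  have add := S.val_U_linear_comb hT lam mu 1 1 x
  simp only [one_smul, one_mul] at add
  rw [Pi.add_apply, 𝒯.fn_eq _ hT hx, 𝒯.fn_eq _ hT hx, 𝒯.fn_eq _ hT hx, add]

theorem normQ_add_le [NeZero d] (lam mu : 𝒯.M p) :
    S.normQ (lam + mu) ≤ S.normQ lam + S.normQ mu := by
  rw [normQ, l2norm_congr (S.vecFn_Q_add lam mu)]
  exact l2norm_add_le (𝒯.memLp_vecFn _) (𝒯.memLp_vecFn _)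

theorem vecFn_Q_neg [NeZero d] (lam : 𝒯.M p) :
    𝒯.vecFn (S.Q (-lam)) =ᵐ[volume.restrict Ω] -𝒯.vecFn (S.Q lam) := by
  filter_upwards [𝒯.ae_mem_interior] with x ⟨T, hT, hx⟩
  have neg_eq : -lam = (-1 : ℝ) • lam + (0 : ℝ) • lam := by module
  rw [Pi.neg_apply, 𝒯.vecFn_eq _ hT hx, 𝒯.vecFn_eq _ hT hx, neg_eq, S.vecVal_Q_linear_comb hT]
  module

theorem normQ_neg [NeZero d] (lam : 𝒯.M p) : S.normQ (-lam) = S.normQ lam := by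
  rw [normQ, l2norm_congr (S.vecFn_Q_neg lam), l2norm_neg, normQ]

end Method

theorem normM_nonneg {Ω : Set (Pt d)} {𝒯 : SimplicialMesh d Ω} {p : ℕ} (lam : 𝒯.M p) :
    0 ≤ normM lam := Real.sqrt_nonneg _

/-! ### A criterion for membership in `H¹₀` -/

theorem tendsto_eLpNorm_of_forall_norm_le {α F : Type*} [MeasurableSpace α] {μ : Measure α}
    [IsFiniteMeasure μ] [NormedAddCommGroup F] {f : ℕ → α → F} {C : ℝ} {p : ℝ≥0∞} (hp : 1 ≤ p)
    (hp_top : p ≠ ⊤) (hf : ∀ n, AEStronglyMeasurable (f n) μ) (hC : ∀ n x, ‖f n x‖ ≤ C)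
    (hlim : ∀ᵐ x ∂μ, Tendsto (fun n => f n x) atTop (𝓝 0)) :
    Tendsto (fun n => eLpNorm (f n) p μ) atTop (𝓝 0) := by
  have unifIntegrable : UnifIntegrable f p μ := by
    refine unifIntegrable_of hp hp_top hf fun ε _ => ⟨Real.toNNReal C + 1, fun n => ?_⟩
    have large_values_empty : {x | Real.toNNReal C + 1 ≤ ‖f n x‖₊} = ∅ :=
      Set.eq_empty_of_forall_notMem fun x hx => by
        have norm_le : ‖f n x‖₊ ≤ Real.toNNReal C := NNReal.le_toNNReal_of_coe_le (hC n x)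
        exact (lt_add_one _).not_ge (hx.trans norm_le)
    rw [large_values_empty, Set.indicator_empty, eLpNorm_zero']
    exact zero_le
  simpa only [sub_zero] using
    tendsto_Lp_finite_of_tendsto_ae hp hp_top hf (MemLp.zero (p := p)) unifIntegrable hlim

/-- Soft thresholding at level `ε`: it moves `s` towards `0` by at most `ε`, annihilating
`[-ε, ε]`. -/
def softThreshold (ε s : ℝ) : ℝ := s - max (-ε) (min ε s)

theorem lipschitzWith_softThreshold (ε : ℝ) : LipschitzWith 2 (softThreshold ε) := by
  have lipschitz_clamp : LipschitzWith 1 (fun s : ℝ => max (-ε) (min ε s)) := by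
    simpa using (LipschitzWith.id.const_min ε).const_max (-ε)
  have lipschitz_sub := (LipschitzWith.id (α := ℝ)).sub lipschitz_clamp
  rwa [one_add_one_eq_two] at lipschitz_sub

theorem softThreshold_of_abs_le {ε s : ℝ} (h : |s| ≤ ε) : softThreshold ε s = 0 := by
  rw [abs_le] at h
  rw [softThreshold, min_eq_right h.2, max_eq_right h.1, sub_self]

theorem softThreshold_of_le {ε s : ℝ} (hε : 0 ≤ ε) (h : ε ≤ s) : softThreshold ε s = s - ε := by
  rw [softThreshold, min_eq_left h, max_eq_right (by linarith)]

theorem softThreshold_of_le_neg {ε s : ℝ} (hε : 0 ≤ ε) (h : s ≤ -ε) :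
    softThreshold ε s = s + ε := by
  rw [softThreshold, min_eq_right (by linarith), max_eq_left h, sub_neg_eq_add]

theorem abs_softThreshold_sub_le {ε : ℝ} (hε : 0 ≤ ε) (s : ℝ) : |softThreshold ε s - s| ≤ ε := by
  rw [softThreshold, sub_sub_cancel_left, abs_neg, abs_le]
  exact ⟨le_max_left _ _, max_le (by linarith) (min_le_left _ _)⟩

theorem exists_softThreshold_eq_add_const {w : Pt d → ℝ} (hw : Continuous w) {x : Pt d}
    (hx : w x ≠ 0 ∨ ∀ᶠ y in 𝓝 x, w y = 0) :
    ∃ U ∈ 𝓝 x, ∃ ε₀ > 0, ∀ ε, 0 ≤ ε → ε ≤ ε₀ →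
      ∃ c : ℝ, ∀ y ∈ U, softThreshold ε (w y) = w y + c := by
  rcases hx with hx | locally_zero
  · rcases lt_or_gt_of_ne hx with hneg | hpos
    · refine ⟨{y | w y < w x / 2}, hw.continuousAt.eventually_lt_const (by linarith), -(w x / 2),
        by linarith, fun ε hε hε_le => ⟨ε, fun y (hy : w y < w x / 2) => ?_⟩⟩
      exact softThreshold_of_le_neg hε (by linarith)
    · refine ⟨{y | w x / 2 < w y}, hw.continuousAt.eventually_const_lt (by linarith), w x / 2,
        by linarith, fun ε hε hε_le => ⟨-ε, fun y (hy : w x / 2 < w y) => ?_⟩⟩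
      exact softThreshold_of_le hε (by linarith)
  · refine ⟨{y | w y = 0}, locally_zero, 1, one_pos,
      fun ε hε _ => ⟨0, fun y (hy : w y = 0) => ?_⟩⟩
    rw [hy, softThreshold_of_abs_le (by simpa using hε), add_zero]

section Mollification

variable (φ : ContDiffBump (0 : Pt d)) {g : Pt d → ℝ}

/-- Mollification: convolution with a bump function of total mass one. -/
def mollify (g : Pt d → ℝ) : Pt d → ℝ :=
  convolution (φ.normed volume) g (ContinuousLinearMap.lsmul ℝ ℝ) volume

theorem contDiff_mollify (hg : Continuous g) : ContDiff ℝ ∞ (mollify φ g) :=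
  φ.hasCompactSupport_normed.contDiff_convolution_left _ φ.contDiff_normed hg.locallyIntegrable

theorem abs_mollify_sub_le (hg : Continuous g) {x : Pt d} {ε : ℝ}
    (h : ∀ y ∈ Metric.ball x φ.rOut, |g y - g x| ≤ ε) : |mollify φ g x - g x| ≤ ε :=
  φ.dist_normed_convolution_le (μ := volume) hg.aestronglyMeasurable h

theorem mollify_eq_zero {x : Pt d} (h : ∀ y ∈ Metric.ball x φ.rOut, g y = 0) :
    mollify φ g x = 0 := by
  have hx : g x = 0 := h x (Metric.mem_ball_self φ.rOut_pos)
  have mollify_eq := φ.normed_convolution_eq_right (μ := volume) (g := g) (x₀ := x)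
    fun y hy => by rw [h y hy, hx]
  rwa [hx] at mollify_eq

theorem mollify_sub (hg : Continuous g) (x y : Pt d) :
    mollify φ g x - mollify φ g y = ∫ t, φ.normed volume t * (g (x - t) - g (y - t)) := by
  have integrable (z : Pt d) : Integrable fun t => φ.normed volume t * g (z - t) :=
    Continuous.integrable_of_hasCompactSupport
      (φ.continuous_normed.mul (hg.comp (continuous_const.sub continuous_id)))
      φ.hasCompactSupport_normed.mul_right
  simp only [mollify, convolution_def, ContinuousLinearMap.lsmul_apply, smul_eq_mul]
  rw [← integral_sub (integrable x) (integrable y)]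
  simp_rw [mul_sub]

theorem lipschitzWith_mollify {K : ℝ≥0} (hg : LipschitzWith K g) :
    LipschitzWith K (mollify φ g) := by
  refine LipschitzWith.of_dist_le_mul fun x y => ?_
  rw [dist_eq_norm, mollify_sub φ hg.continuous]
  calc ‖∫ t, φ.normed volume t * (g (x - t) - g (y - t))‖
      ≤ ∫ t, φ.normed volume t * (K * dist x y) := by
        refine norm_integral_le_of_norm_le (φ.integrable_normed.mul_const _)
          (Eventually.of_forall fun t => ?_)
        rw [norm_mul, Real.norm_of_nonneg (φ.nonneg_normed t), ← dist_eq_norm,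
          ← dist_sub_right x y t]
        exact mul_le_mul_of_nonneg_left (hg.dist_le_mul _ _) (φ.nonneg_normed t)
    _ = K * dist x y := by rw [integral_mul_const, φ.integral_normed, one_mul]

theorem mollify_sub_eq_of_affine (hg : Continuous g) (f : Pt d →ᵃ[ℝ] ℝ) {x z : Pt d}
    (hx : ∀ y ∈ Metric.ball x φ.rOut, g y = f y) (hz : ∀ y ∈ Metric.ball z φ.rOut, g y = f y) :
    mollify φ g z - mollify φ g x = f z - f x := by
  have increment (a b : Pt d) : f a - f b = f.linear (a - b) := (f.linearMap_vsub a b).symm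
  have integrand_eq (t : Pt d) : φ.normed volume t * (g (z - t) - g (x - t)) =
      φ.normed volume t * (f z - f x) := by
    by_cases ht : t ∈ Metric.ball (0 : Pt d) φ.rOut
    · rw [hx (x - t) (by simpa [dist_eq_norm] using ht),
        hz (z - t) (by simpa [dist_eq_norm] using ht), increment, increment,
        sub_sub_sub_cancel_right]
    · rw [← φ.support_normed_eq (μ := volume)] at ht
      rw [Function.notMem_support.1 ht, zero_mul, zero_mul]
  simp_rw [mollify_sub φ hg, integrand_eq]
  rw [integral_mul_const, φ.integral_normed, one_mul]

end Mollification

section SmoothCutoff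

variable {w : Pt d → ℝ} {K : ℝ≥0} {ε : ℝ}

/-- Soft thresholding followed by mollification. For a Lipschitz function vanishing outside `Ω`
and suitable parameters this is a test function on `Ω`. -/
def smoothCutoff (φ : ContDiffBump (0 : Pt d)) (ε : ℝ) (w : Pt d → ℝ) : Pt d → ℝ :=
  mollify φ (softThreshold ε ∘ w)

theorem lipschitzWith_smoothCutoff (φ : ContDiffBump (0 : Pt d)) (ε : ℝ)
    (hw : LipschitzWith K w) : LipschitzWith (2 * K) (smoothCutoff φ ε w) :=
  lipschitzWith_mollify φ ((lipschitzWith_softThreshold ε).comp hw)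

theorem abs_smoothCutoff_sub_le {φ : ContDiffBump (0 : Pt d)} (hw : LipschitzWith K w) (hε : 0 ≤ ε)
    (hφ : K * φ.rOut ≤ ε / 2) (x : Pt d) : |smoothCutoff φ ε w x - w x| ≤ 2 * ε := by
  have lipschitz := (lipschitzWith_softThreshold ε).comp hw
  have mollify_error : |smoothCutoff φ ε w x - softThreshold ε (w x)| ≤ ε := by
    refine abs_mollify_sub_le φ lipschitz.continuous fun y hy => ?_
    calc |softThreshold ε (w y) - softThreshold ε (w x)|
        ≤ 2 * K * dist y x := lipschitz.dist_le_mul y x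
      _ ≤ 2 * K * φ.rOut := mul_le_mul_of_nonneg_left (Metric.mem_ball.1 hy).le (by positivity)
      _ ≤ ε := by linarith
  calc |smoothCutoff φ ε w x - w x|
      ≤ |smoothCutoff φ ε w x - softThreshold ε (w x)| + |softThreshold ε (w x) - w x| :=
        abs_sub_le _ _ _
    _ ≤ 2 * ε := by linarith [abs_softThreshold_sub_le hε (w x)]

theorem tsupport_smoothCutoff_subset {φ : ContDiffBump (0 : Pt d)} (hw : LipschitzWith K w)
    (hφ : K * φ.rOut ≤ ε / 2) : tsupport (smoothCutoff φ ε w) ⊆ {x | ε / 2 ≤ |w x|} := by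
  refine closure_minimal (fun x hx => ?_) (isClosed_le continuous_const hw.continuous.abs)
  contrapose! hx
  have abs_lt : |w x| < ε / 2 := not_le.1 hx
  rw [Function.notMem_support]
  refine mollify_eq_zero φ fun y hy => softThreshold_of_abs_le ?_
  have variation_le : |w y - w x| ≤ ε / 2 :=
    calc |w y - w x| ≤ K * dist y x := hw.dist_le_mul y x
      _ ≤ K * φ.rOut := mul_le_mul_of_nonneg_left (Metric.mem_ball.1 hy).le K.2
      _ ≤ ε / 2 := hφ
  linarith [abs_sub_abs_le_abs_sub (w y) (w x)]

theorem exists_forall_gradient_smoothCutoff_eq (hw : Continuous w) {x : Pt d} {f : Pt d →ᵃ[ℝ] ℝ}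
    (hf : ∀ᶠ y in 𝓝 x, w y = f y) (hx : w x ≠ 0 ∨ ∀ᶠ y in 𝓝 x, w y = 0) :
    ∃ δ > 0, ∀ ε, 0 ≤ ε → ε ≤ δ → ∀ φ : ContDiffBump (0 : Pt d), φ.rOut ≤ δ →
      ∇ (smoothCutoff φ ε w) x = ∇ w x := by
  obtain ⟨U, hU, ε₀, hε₀, threshold_eq⟩ := exists_softThreshold_eq_add_const hw hx
  obtain ⟨δ, hδ, hball⟩ := Metric.mem_nhds_iff.1 (Filter.inter_mem hU hf)
  refine ⟨min ε₀ (δ / 2), lt_min hε₀ (half_pos hδ), fun ε hε hε_le φ hφ => ?_⟩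
  obtain ⟨c, hc⟩ := threshold_eq ε hε (hε_le.trans (min_le_left _ _))
  have hφ_le : φ.rOut ≤ δ / 2 := hφ.trans (min_le_right _ _)
  have w_eq {y : Pt d} (hy : y ∈ Metric.ball x δ) : w y = f y := (hball hy).2
  have cutoff_eq (y : Pt d) (hy : y ∈ Metric.ball x δ) :
      (softThreshold ε ∘ w) y = (f + AffineMap.const ℝ (Pt d) c) y := by
    rw [Function.comp_apply, hc y (hball hy).1, w_eq hy]
    rfl
  have eventually_eq : smoothCutoff φ ε w =ᶠ[𝓝 x] fun z => w z + (smoothCutoff φ ε w x - w x) := by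
    filter_upwards [Metric.ball_mem_nhds x (half_pos hδ)] with z hz
    have ball_z_subset : Metric.ball z φ.rOut ⊆ Metric.ball x δ :=
      Metric.ball_subset_ball' (by linarith [Metric.mem_ball.1 hz])
    have increment_eq := mollify_sub_eq_of_affine φ
      ((lipschitzWith_softThreshold ε).continuous.comp hw) (f + AffineMap.const ℝ (Pt d) c)
      (fun y hy => cutoff_eq y (Metric.ball_subset_ball (by linarith) hy))
      (fun y hy => cutoff_eq y (ball_z_subset hy))
    rw [w_eq (Metric.ball_subset_ball (by linarith) hz), w_eq (Metric.mem_ball_self hδ)]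
    simp only [AffineMap.coe_add, AffineMap.coe_const, Pi.add_apply, Function.const_apply,
      add_sub_add_right_eq_sub] at increment_eq
    simp only [smoothCutoff]
    linarith
  rw [gradient, gradient, eventually_eq.fderiv_eq, fderiv_add_const]

end SmoothCutoff

theorem norm_gradient_le {f : Pt d → ℝ} {K : ℝ≥0} (hf : LipschitzWith K f) (x : Pt d) :
    ‖∇ f x‖ ≤ K := by
  rw [gradient, LinearIsometryEquiv.norm_map]
  exact norm_fderiv_le_of_lipschitz ℝ hf

theorem measurable_gradient (f : Pt d → ℝ) : Measurable (∇ f) :=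
  (InnerProductSpace.toDual ℝ (Pt d)).symm.continuous.measurable.comp (measurable_fderiv ℝ f)

theorem exists_forall_norm_le_of_eq_zero_off {Ω : Set (Pt d)} (hΩ : Bornology.IsBounded Ω)
    {w : Pt d → ℝ} (hw : Continuous w) (hw_zero : ∀ x ∉ Ω, w x = 0) : ∃ B, ∀ x, ‖w x‖ ≤ B := by
  refine hw.bounded_above_of_compact_support (HasCompactSupport.of_support_subset_isCompact
    hΩ.isCompact_closure fun x hx => subset_closure ?_)
  by_contra hxΩ
  exact hx (hw_zero x hxΩ)

theorem tendsto_eLpNorm_smoothCutoff_sub {Ω : Set (Pt d)} [IsFiniteMeasure (volume.restrict Ω)]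
    {w : Pt d → ℝ} {K : ℝ≥0} (hw : LipschitzWith K w) {ε : ℕ → ℝ} (hε : ∀ n, 0 ≤ ε n)
    (hε_le : ∀ n, ε n ≤ 1) (hε_lim : Tendsto ε atTop (𝓝 0)) {φ : ℕ → ContDiffBump (0 : Pt d)}
    (hφ : ∀ n, K * (φ n).rOut ≤ ε n / 2) :
    Tendsto (fun n => eLpNorm (fun x => smoothCutoff (φ n) (ε n) w x - w x) 2
      (volume.restrict Ω)) atTop (𝓝 0) := by
  have sub_le (n : ℕ) (x : Pt d) : ‖smoothCutoff (φ n) (ε n) w x - w x‖ ≤ 2 * ε n :=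
    abs_smoothCutoff_sub_le hw (hε n) (hφ n) x
  refine tendsto_eLpNorm_of_forall_norm_le (C := 2) (by norm_num) (by norm_num)
    (fun n => ((lipschitzWith_smoothCutoff (φ n) (ε n) hw).continuous.sub
      hw.continuous).aestronglyMeasurable)
    (fun n x => (sub_le n x).trans (by linarith [hε_le n])) (Eventually.of_forall fun x => ?_)
  exact squeeze_zero_norm (fun n => sub_le n x) (by simpa using hε_lim.const_mul 2)

theorem tendsto_eLpNorm_gradient_smoothCutoff_sub {Ω : Set (Pt d)}
    [IsFiniteMeasure (volume.restrict Ω)] {w : Pt d → ℝ} {K : ℝ≥0} (hw : LipschitzWith K w)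
    (hw_affine : ∀ᵐ x ∂(volume.restrict Ω), (∃ f : Pt d →ᵃ[ℝ] ℝ, ∀ᶠ y in 𝓝 x, w y = f y) ∧
      (w x ≠ 0 ∨ ∀ᶠ y in 𝓝 x, w y = 0))
    {ε : ℕ → ℝ} (hε : ∀ n, 0 ≤ ε n) (hε_lim : Tendsto ε atTop (𝓝 0))
    {φ : ℕ → ContDiffBump (0 : Pt d)} (hφ : ∀ n, (φ n).rOut ≤ ε n) :
    Tendsto (fun n => eLpNorm (fun x => ∇ (smoothCutoff (φ n) (ε n) w) x - ∇ w x) 2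
      (volume.restrict Ω)) atTop (𝓝 0) := by
  refine tendsto_eLpNorm_of_forall_norm_le (C := 3 * K) (by norm_num) (by norm_num)
    (fun n => ((measurable_gradient _).sub (measurable_gradient w)).aestronglyMeasurable)
    (fun n x => ?_) ?_
  · have norm_cutoff_le := norm_gradient_le (lipschitzWith_smoothCutoff (φ n) (ε n) hw) x
    push_cast at norm_cutoff_le
    linarith [norm_sub_le (∇ (smoothCutoff (φ n) (ε n) w) x) (∇ w x), norm_gradient_le hw x]
  · filter_upwards [hw_affine] with x ⟨⟨f, hf⟩, hx⟩
    obtain ⟨δ, hδ, gradient_eq⟩ := exists_forall_gradient_smoothCutoff_eq hw.continuous hf hx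
    refine tendsto_const_nhds.congr' ?_
    filter_upwards [hε_lim.eventually_le_const hδ] with n hn
    rw [gradient_eq (ε n) (hε n) hn (φ n) ((hφ n).trans hn), sub_self]

theorem memH10_of_lipschitz {Ω : Set (Pt d)} (hΩ : Bornology.IsBounded Ω)
    {w : Pt d → ℝ} {K : ℝ≥0} (hw : LipschitzWith K w) (hw_zero : ∀ x ∉ Ω, w x = 0)
    (hw_affine : ∀ᵐ x ∂(volume.restrict Ω), (∃ f : Pt d →ᵃ[ℝ] ℝ, ∀ᶠ y in 𝓝 x, w y = f y) ∧
      (w x ≠ 0 ∨ ∀ᶠ y in 𝓝 x, w y = 0)) : MemH10 Ω w := by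
  have : IsFiniteMeasure (volume.restrict Ω) := ⟨by simpa using hΩ.measure_lt_top⟩
  obtain ⟨B, hB⟩ := exists_forall_norm_le_of_eq_zero_off hΩ hw.continuous hw_zero
  let ε (n : ℕ) : ℝ := 1 / (n + 1)
  have hε (n : ℕ) : 0 < ε n := Nat.one_div_pos_of_nat
  have hε_le (n : ℕ) : ε n ≤ 1 := (div_le_one (by positivity)).2 (by simp)
  have hε_lim : Tendsto ε atTop (𝓝 0) := tendsto_one_div_add_atTop_nhds_zero_nat
  let φ (n : ℕ) : ContDiffBump (0 : Pt d) :=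
    ⟨ε n / (4 * (K + 1)), ε n / (2 * (K + 1)), div_pos (hε n) (by positivity),
      div_lt_div_of_pos_left (hε n) (by positivity) (by linarith [K.coe_nonneg])⟩
  have rOut_mul (n : ℕ) : (φ n).rOut * (2 * (K + 1)) = ε n := div_mul_cancel₀ _ (by positivity)
  have hφ (n : ℕ) : K * (φ n).rOut ≤ ε n / 2 := by linarith [rOut_mul n, (φ n).rOut_pos]
  have hφ_le (n : ℕ) : (φ n).rOut ≤ ε n := by
    nlinarith [rOut_mul n, (φ n).rOut_pos, K.coe_nonneg]
  have tsupport_subset (n : ℕ) : tsupport (smoothCutoff (φ n) (ε n) w) ⊆ Ω := by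
    intro x hx
    have abs_ge : ε n / 2 ≤ |w x| := tsupport_smoothCutoff_subset hw (hφ n) hx
    by_contra hxΩ
    rw [hw_zero x hxΩ, abs_zero] at abs_ge
    linarith [hε n]
  refine ⟨MemLp.of_bound hw.continuous.aestronglyMeasurable B (Eventually.of_forall hB), ∇ w,
    MemLp.of_bound (measurable_gradient w).aestronglyMeasurable K
      (Eventually.of_forall (norm_gradient_le hw)), fun n => smoothCutoff (φ n) (ε n) w,
    fun n => ⟨contDiff_mollify _ ((lipschitzWith_softThreshold _).continuous.comp hw.continuous),
      Metric.isCompact_of_isClosed_isBounded (isClosed_tsupport _) (hΩ.subset (tsupport_subset n)),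
      tsupport_subset n⟩,
    tendsto_eLpNorm_smoothCutoff_sub hw (fun n => (hε n).le) hε_le hε_lim hφ,
    tendsto_eLpNorm_gradient_smoothCutoff_sub hw hw_affine (fun n => (hε n).le) hε_lim hφ_le⟩

/-! ### Piecewise linear interpolation -/

/-- The affine function on the simplex `T` with the vertex values `g`. -/
def linInterp (T : Finset (Pt d)) (g : Pt d → ℝ) : Pt d →ᵃ[ℝ] ℝ := ∑ v ∈ T, g v • bary T v

theorem linInterp_apply (T : Finset (Pt d)) (g : Pt d → ℝ) (x : Pt d) :
    linInterp T g x = ∑ v ∈ T, bary T v x * g v := by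
  let evalAt : (Pt d →ᵃ[ℝ] ℝ) →+ ℝ := ⟨⟨fun f => f x, rfl⟩, fun _ _ => rfl⟩
  exact (map_sum evalAt _ T).trans (Finset.sum_congr rfl fun v _ => mul_comm _ _)

theorem IsSimplex.linInterp_vertex {T : Finset (Pt d)} (hT : IsSimplex T) (g : Pt d → ℝ) {v : Pt d}
    (hv : v ∈ T) : linInterp T g v = g v := by
  rw [linInterp_apply, Finset.sum_eq_single_of_mem v hv fun w hw hwv => by
    rw [hT.bary_ne hw hv hwv, zero_mul], hT.bary_self hv, one_mul]

theorem eqOn_hull_of_forall_eq {S : Finset (Pt d)} {f g : Pt d →ᵃ[ℝ] ℝ}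
    (h : ∀ v ∈ S, f v = g v) : Set.EqOn f g (hull S) :=
  (AffineMap.eqOn_affineSpan h).mono (convexHull_subset_affineSpan _)

theorem exists_lipschitzWith_affineMap (f : Pt d →ᵃ[ℝ] ℝ) : ∃ K : ℝ≥0, LipschitzWith K f :=
  ⟨‖LinearMap.toContinuousLinearMap f.linear‖₊, LipschitzWith.of_dist_le_mul fun x y => by
    rw [dist_eq_norm, dist_eq_norm, ← vsub_eq_sub, ← f.linearMap_vsub]
    exact (LinearMap.toContinuousLinearMap f.linear).le_opNorm (x - y)⟩

theorem volume_zeros_affineMap {f : Pt d →ᵃ[ℝ] ℝ} (hf : ∃ x, f x ≠ 0) :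
    volume {x | f x = 0} = 0 := by
  have zeros_eq_comap : {x | f x = 0} = ((AffineSubspace.mk' (0 : ℝ) ⊥).comap f : Set (Pt d)) := by
    ext x
    simp [AffineSubspace.mem_mk']
  rw [zeros_eq_comap]
  refine Measure.addHaar_affineSubspace volume _ fun comap_eq_top => ?_
  obtain ⟨x, hx⟩ := hf
  rw [comap_eq_top, AffineSubspace.top_coe] at zeros_eq_comap
  exact hx (zeros_eq_comap.symm.subset (Set.mem_univ x))

section LocallyLipschitz

variable {E X : Type*} [PseudoMetricSpace X]

theorem continuous_of_eventually_dist_le [PseudoMetricSpace E] {w : E → X} {K : ℝ≥0}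
    (h : ∀ x, ∀ᶠ y in 𝓝 x, dist (w y) (w x) ≤ K * dist y x) : Continuous w := by
  refine continuous_iff_continuousAt.2 fun x => tendsto_iff_dist_tendsto_zero.2 ?_
  refine squeeze_zero' (Eventually.of_forall fun _ => dist_nonneg) (h x) ?_
  have continuous_bound : Continuous fun y => (K : ℝ) * dist y x := by fun_prop
  simpa using continuous_bound.tendsto x

theorem lipschitzWith_of_eventually_dist_le [NormedAddCommGroup E] [NormedSpace ℝ E] {w : E → X}
    {K : ℝ≥0} (h : ∀ x, ∀ᶠ y in 𝓝 x, dist (w y) (w x) ≤ K * dist y x) : LipschitzWith K w := by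
  refine LipschitzWith.of_dist_le_mul fun y x => ?_
  let γ : ℝ → E := AffineMap.lineMap x y
  have continuous_γ : Continuous γ := AffineMap.lineMap_continuous
  have slope_lt (t : ℝ) {ρ : ℝ} (hρ : K * dist y x < ρ) :
      ∃ᶠ s in 𝓝[>] t, slope (fun s => dist (w (γ s)) (w x)) t s < ρ := by
    refine Filter.Eventually.frequently ?_
    filter_upwards [(continuous_γ.continuousAt.eventually (h (γ t))).filter_mono nhdsWithin_le_nhds,
      self_mem_nhdsWithin] with s dist_le (hts : t < s)
    refine lt_of_le_of_lt ?_ hρ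
    rw [dist_lineMap_lineMap, Real.dist_eq, abs_of_pos (sub_pos.2 hts), dist_comm x y] at dist_le
    rw [slope_def_field, div_le_iff₀ (sub_pos.2 hts)]
    linarith [dist_triangle (w (γ s)) (w (γ t)) (w x)]
  have dist_le_along_segment := image_le_of_liminf_slope_right_le_deriv_boundary
    (f := fun t => dist (w (γ t)) (w x)) (a := 0) (b := 1) (B := fun t => K * dist y x * t)
    (B' := fun _ => K * dist y x)
    (((continuous_of_eventually_dist_le h).comp continuous_γ).dist continuous_const).continuousOn
    (by simp [γ]) (by fun_prop)
    (fun t _ => by simpa using ((hasDerivAt_id t).const_mul ((K : ℝ) * dist y x)).hasDerivWithinAt)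
    (fun t _ ρ hρ => slope_lt t hρ) (Set.right_mem_Icc.2 zero_le_one)
  simpa [γ] using dist_le_along_segment

end LocallyLipschitz

namespace SimplicialMesh

variable {Ω : Set (Pt d)} (𝒯 : SimplicialMesh d Ω)

open Classical in
/-- The continuous piecewise linear interpolant of the vertex values `g`, extended by zero outside
the cells. On a face shared by several cells any of them may be chosen, see `interpolate_eq`. -/
def interpolate (g : Pt d → ℝ) (x : Pt d) : ℝ :=
  if h : ∃ T ∈ 𝒯.cells, x ∈ hull T then linInterp h.choose g x else 0

theorem interpolate_eq (g : Pt d → ℝ) {T : Finset (Pt d)} (hT : T ∈ 𝒯.cells) {x : Pt d}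
    (hx : x ∈ hull T) : 𝒯.interpolate g x = linInterp T g x := by
  classical
  have exists_cell : ∃ T ∈ 𝒯.cells, x ∈ hull T := ⟨T, hT, hx⟩
  obtain ⟨chosen_mem, hx_chosen⟩ := exists_cell.choose_spec
  rw [interpolate, dif_pos exists_cell]
  have eq_on_common_vertices : ∀ v ∈ exists_cell.choose ∩ T,
      linInterp exists_cell.choose g v = linInterp T g v := fun v hv => by
    rw [Finset.mem_inter] at hv
    rw [(𝒯.isSimplex chosen_mem).linInterp_vertex g hv.1, (𝒯.isSimplex hT).linInterp_vertex g hv.2]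
  exact eqOn_hull_of_forall_eq eq_on_common_vertices
    (𝒯.hull_inter_hull chosen_mem hT ▸ ⟨hx_chosen, hx⟩)

variable {g : Pt d → ℝ}

theorem interpolate_eq_zero (hΩ : IsLipschitzDomain Ω) (hg : ∀ v ∈ frontier Ω, g v = 0) {x : Pt d}
    (hx : x ∉ Ω) : 𝒯.interpolate g x = 0 := by
  by_cases hx_closure : x ∈ closure Ω
  · have hx_frontier : x ∈ frontier Ω := hΩ.isOpen.frontier_eq ▸ ⟨hx_closure, hx⟩
    obtain ⟨T, hT, F, hF, hxF, hF_frontier⟩ := 𝒯.exists_boundary_face hΩ hx_frontier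
    rw [𝒯.interpolate_eq g hT (hull_mono (facet_subset hF) hxF)]
    refine eqOn_hull_of_forall_eq (g := AffineMap.const ℝ (Pt d) (0 : ℝ)) (fun v hv => ?_) hxF
    exact ((𝒯.isSimplex hT).linInterp_vertex g (facet_subset hF hv)).trans
      (hg v (hF_frontier (mem_hull_of_mem hv)))
  · refine dif_neg ?_
    rintro ⟨T, hT, hxT⟩
    exact hx_closure (𝒯.hull_subset_closure hT hxT)

theorem exists_lipschitzWith_interpolate (hΩ : IsLipschitzDomain Ω)
    (hg : ∀ v ∈ frontier Ω, g v = 0) : ∃ K : ℝ≥0, LipschitzWith K (𝒯.interpolate g) := by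
  choose K hK using fun T : Finset (Pt d) => exists_lipschitzWith_affineMap (linInterp T g)
  have K_le {T : Finset (Pt d)} (hT : T ∈ 𝒯.cells) : K T ≤ ∑ T ∈ 𝒯.cells, K T :=
    Finset.single_le_sum (fun _ _ => zero_le) hT
  refine ⟨∑ T ∈ 𝒯.cells, K T, lipschitzWith_of_eventually_dist_le fun x => ?_⟩
  obtain ⟨ε, hε, hx_of_meets⟩ := exists_ball_avoiding 𝒯.cells x
  have eventually_mem : ∀ᶠ y in 𝓝 x, x ∈ Ω → y ∈ Ω := by
    by_cases hx : x ∈ Ω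
    · filter_upwards [hΩ.isOpen.mem_nhds hx] with y hy _ using hy
    · exact Eventually.of_forall fun y h => absurd h hx
  filter_upwards [Metric.ball_mem_nhds x hε, eventually_mem] with y hy mem_of_mem
  by_cases hy_closure : y ∈ closure Ω
  · obtain ⟨T, hT, hyT⟩ := 𝒯.exists_cell hy_closure
    rw [𝒯.interpolate_eq g hT hyT, 𝒯.interpolate_eq g hT (hx_of_meets T hT ⟨y, hy, hyT⟩)]
    exact ((hK T).weaken (K_le hT)).dist_le_mul y x
  · have hy_notMem : y ∉ Ω := fun h => hy_closure (subset_closure h)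
    rw [𝒯.interpolate_eq_zero hΩ hg hy_notMem,
      𝒯.interpolate_eq_zero hΩ hg fun h => hy_notMem (mem_of_mem h), dist_self]
    positivity

theorem ae_linInterp_ne_zero (g : Pt d → ℝ) : ∀ᵐ x ∂(volume : Measure (Pt d)), ∀ T ∈ 𝒯.cells,
    (∃ y, linInterp T g y ≠ 0) → linInterp T g x ≠ 0 := by
  refine (ae_ball_iff 𝒯.cells.countable_toSet).2 fun T _ => ?_
  by_cases not_zero : ∃ y, linInterp T g y ≠ 0
  · filter_upwards [measure_eq_zero_iff_ae_notMem.1 (volume_zeros_affineMap not_zero)] with x hx _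
      using hx
  · exact Eventually.of_forall fun x h => absurd h not_zero

theorem conformingP1_interpolate (hΩ : IsLipschitzDomain Ω) (hg : ∀ v ∈ frontier Ω, g v = 0) :
    𝒯.ConformingP1 (𝒯.interpolate g) := by
  obtain ⟨K, hK⟩ := 𝒯.exists_lipschitzWith_interpolate hΩ hg
  refine ⟨memH10_of_lipschitz hΩ.isBounded hK (fun x hx => 𝒯.interpolate_eq_zero hΩ hg hx) ?_,
    fun T hT => ?_⟩
  · filter_upwards [𝒯.ae_mem_interior, ae_restrict_of_ae (𝒯.ae_linInterp_ne_zero g)]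
      with x ⟨T, hT, hxT⟩ ne_zero
    have eventually_eq : ∀ᶠ y in 𝓝 x, 𝒯.interpolate g y = linInterp T g y := by
      filter_upwards [isOpen_interior.mem_nhds hxT] with y hy
      exact 𝒯.interpolate_eq g hT (interior_subset hy)
    refine ⟨⟨_, eventually_eq⟩, ?_⟩
    by_cases not_zero : ∃ y, linInterp T g y ≠ 0
    · exact Or.inl (by rw [eventually_eq.self_of_nhds]; exact ne_zero T hT not_zero)
    · push Not at not_zero
      exact Or.inr (eventually_eq.mono fun y hy => hy.trans (not_zero y))
  · obtain ⟨P, hP, hP_eq⟩ := exists_poly_of_affineMap (linInterp T g)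
    exact ⟨P, hP, fun x hx => by rw [𝒯.interpolate_eq g hT hx, hP_eq]⟩

theorem trace_apply (w : Pt d → ℝ) {T F : Finset (Pt d)} (hT : T ∈ 𝒯.cells) (hF : F ∈ facets T)
    {x : Pt d} (hx : x ∈ hull F) : 𝒯.trace w F x = w x := by
  rw [trace, if_pos (𝒯.isFace hT hF), Set.indicator_of_mem hx]

theorem trace_mem_M {p : ℕ} (hp : 1 ≤ p) {w : Pt d → ℝ} (hw : 𝒯.ConformingP1 w)
    (hw_zero : ∀ x ∈ frontier Ω, w x = 0) : 𝒯.trace w ∈ 𝒯.M p := by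
  refine ⟨fun F hF => ?_, fun F hF hF_frontier => ?_, fun F hF => if_neg hF⟩
  · obtain ⟨T, hT, hFT⟩ := hF
    obtain ⟨P, hP, hP_eq⟩ := hw.2 T hT
    refine ⟨P, ?_, ?_⟩
    · rw [MvPolynomial.mem_restrictTotalDegree] at hP ⊢
      exact hP.trans hp
    · rw [trace, if_pos (𝒯.isFace hT hFT)]
      exact Set.indicator_congr fun x hx => hP_eq x (hull_mono (facet_subset hFT) hx)
  · rw [trace, if_pos hF]
    exact (Set.indicator_congr fun x hx => hw_zero x (hF_frontier hx))
      |>.trans (Set.indicator_zero ℝ (hull F))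

theorem exists_cell_hull_subset_of_isRefinedBy {𝒯' : SimplicialMesh d Ω} (h : 𝒯.IsRefinedBy 𝒯')
    {T' : Finset (Pt d)} (hT' : T' ∈ 𝒯'.cells) : ∃ T ∈ 𝒯.cells, hull T' ⊆ hull T := by
  obtain ⟨x, hx⟩ := (𝒯'.isSimplex hT').interior_nonempty
  obtain ⟨T, hT, hxT⟩ := 𝒯.exists_cell (𝒯'.hull_subset_closure hT' (interior_subset hx))
  obtain ⟨C, hC, hull_eq⟩ := h T hT
  refine ⟨T, hT, ?_⟩
  rw [hull_eq] at hxT ⊢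
  obtain ⟨T₁, hT₁, hxT₁⟩ := Set.mem_iUnion₂.1 hxT
  rw [𝒯'.eq_of_mem_interior hT' (hC hT₁) hx hxT₁]
  exact Set.subset_biUnion_of_mem (u := fun T => hull T) hT₁

variable {𝒯} in
theorem ConformingP1.of_isRefinedBy {𝒯' : SimplicialMesh d Ω} (h : 𝒯.IsRefinedBy 𝒯')
    {w : Pt d → ℝ} (hw : 𝒯.ConformingP1 w) : 𝒯'.ConformingP1 w := by
  refine ⟨hw.1, fun T' hT' => ?_⟩
  obtain ⟨T, hT, hull_subset⟩ := 𝒯.exists_cell_hull_subset_of_isRefinedBy h hT'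
  obtain ⟨P, hP, hP_eq⟩ := hw.2 T hT
  exact ⟨P, hP, fun y hy => hP_eq y (hull_subset hy)⟩

end SimplicialMesh

/-! ### Uniform meshes -/

theorem IsSimplex.diam_pos {T : Finset (Pt d)} (hT : IsSimplex T) [NeZero d] :
    0 < Metric.diam (hull T) := by
  have one_lt_card : 1 < T.card := by
    rw [hT.card_eq]
    exact Nat.lt_add_of_pos_left (NeZero.pos d)
  obtain ⟨a, ha, b, hb, hab⟩ := Finset.one_lt_card.1 one_lt_card
  exact (dist_pos.2 hab).trans_le (Metric.dist_le_diam_of_mem (isCompact_hull T).isBounded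
    (mem_hull_of_mem ha) (mem_hull_of_mem hb))

namespace SimplicialMesh

variable {Ω : Set (Pt d)} (𝒯 : SimplicialMesh d Ω)

theorem cells_nonempty (hΩ : IsLipschitzDomain Ω) : 𝒯.cells.Nonempty := by
  obtain ⟨x, hx⟩ := hΩ.isConnected.nonempty
  obtain ⟨T, hT, -⟩ := 𝒯.exists_cell (subset_closure hx)
  exact ⟨T, hT⟩

theorem diam_le_h {T : Finset (Pt d)} (hT : T ∈ 𝒯.cells) : Metric.diam (hull T) ≤ 𝒯.h :=
  le_csSup (𝒯.cells.finite_toSet.image _).bddAbove (Set.mem_image_of_mem _ hT)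

theorem h_pos [NeZero d] (hΩ : IsLipschitzDomain Ω) : 0 < 𝒯.h := by
  obtain ⟨T, hT⟩ := 𝒯.cells_nonempty hΩ
  exact (𝒯.isSimplex hT).diam_pos.trans_le (𝒯.diam_le_h hT)

theorem volume_real_hull_le {T : Finset (Pt d)} (hT : T ∈ 𝒯.cells) :
    volume.real (hull T) ≤ 𝒯.h ^ d * ballVol d :=
  (𝒯.isSimplex hT).volume_real_hull_le.trans (mul_le_mul_of_nonneg_right
    (pow_le_pow_left₀ Metric.diam_nonneg (𝒯.diam_le_h hT) d) (ballVol_pos d).le)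

theorem sum_surf_le [NeZero d] {T : Finset (Pt d)} (hT : T ∈ 𝒯.cells) :
    ∑ F ∈ facets T, (surf d).real (hull F) ≤ (d + 1) * (𝒯.h ^ (d - 1) * ballVol (d - 1)) := by
  have surf_le : ∀ F ∈ facets T, (surf d).real (hull F) ≤ 𝒯.h ^ (d - 1) * ballVol (d - 1) :=
    fun F hF => (surf_real_le (𝒯.isSimplex hT) hF).trans (mul_le_mul_of_nonneg_right
      (pow_le_pow_left₀ Metric.diam_nonneg (𝒯.diam_le_h hT) _) (ballVol_pos _).le)
  refine (Finset.sum_le_card_nsmul _ _ _ surf_le).trans_eq ?_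
  rw [(𝒯.isSimplex hT).card_facets, nsmul_eq_mul, Nat.cast_succ]

/-- Shape regularity and quasi-uniformity in one condition: all cells contain a ball of the same
radius `h / κ`, while their diameters are at most `h`. -/
structure IsUniform (κ : ℝ) : Prop where
  κ_pos : 0 < κ
  h_pos : 0 < 𝒯.h
  exists_closedBall_subset : ∀ T ∈ 𝒯.cells, ∃ c, Metric.closedBall c (𝒯.h / κ) ⊆ hull T

theorem isUniform_of_shapeRegular_of_quasiUniform [NeZero d] (hΩ : IsLipschitzDomain Ω) {s σ : ℝ}
    (hs : 𝒯.ShapeRegular s) (hσ : 𝒯.QuasiUniform σ) : 𝒯.IsUniform (max 1 (σ * s)) := by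
  have κ_pos : 0 < max 1 (σ * s) := lt_max_of_lt_left one_pos
  refine ⟨κ_pos, 𝒯.h_pos hΩ, fun T hT => ?_⟩
  obtain ⟨c, r, hr, hball, hdiam⟩ := hs T hT
  refine ⟨c, (Metric.closedBall_subset_closedBall ?_).trans hball⟩
  have σ_pos : 0 < σ :=
    pos_of_mul_pos_left ((𝒯.h_pos hΩ).trans_le (hσ T hT)) (𝒯.isSimplex hT).diam_pos.le
  rw [div_le_iff₀ κ_pos]
  calc 𝒯.h ≤ σ * (s * r) := (hσ T hT).trans (mul_le_mul_of_nonneg_left hdiam σ_pos.le)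
    _ = r * (σ * s) := by ring
    _ ≤ r * max 1 (σ * s) := mul_le_mul_of_nonneg_left (le_max_right _ _) hr.le

end SimplicialMesh

/-- The constant in the lower bound of `|T| / |∂T|` by the mesh size on uniform meshes. -/
def volRatioConst (d : ℕ) (κ : ℝ) : ℝ := ballVol d / ((d + 1) * κ ^ d * ballVol (d - 1))

theorem volRatioConst_pos (d : ℕ) {κ : ℝ} (hκ : 0 < κ) : 0 < volRatioConst d κ := by
  have := ballVol_pos d
  have := ballVol_pos (d - 1)
  unfold volRatioConst
  positivity

namespace SimplicialMesh.IsUniform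

variable {Ω : Set (Pt d)} {𝒯 : SimplicialMesh d Ω} {κ : ℝ} (hu : 𝒯.IsUniform κ)
include hu

theorem radius_pos : 0 < 𝒯.h / κ := div_pos hu.h_pos hu.κ_pos

theorem le_volume_real_hull {T : Finset (Pt d)} (hT : T ∈ 𝒯.cells) :
    (𝒯.h / κ) ^ d * ballVol d ≤ volume.real (hull T) := by
  obtain ⟨c, hc⟩ := hu.exists_closedBall_subset T hT
  exact HDG.le_volume_real_hull hu.radius_pos hc

theorem le_surf_real [NeZero d] {T F : Finset (Pt d)} (hT : T ∈ 𝒯.cells) (hF : F ∈ facets T) :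
    (𝒯.h / κ) ^ (d - 1) * ballVol (d - 1) ≤ (surf d).real (hull F) := by
  obtain ⟨c, hc⟩ := hu.exists_closedBall_subset T hT
  exact HDG.le_surf_real (𝒯.isSimplex hT) hF hu.radius_pos hc

theorem mul_volRatioConst_le_volRatio [NeZero d] {T : Finset (Pt d)} (hT : T ∈ 𝒯.cells) :
    𝒯.h * volRatioConst d κ ≤ volRatio T := by
  have κ_pos := hu.κ_pos
  have h_pos := hu.h_pos
  have := ballVol_pos (d - 1)
  rw [volRatio, le_div_iff₀ (𝒯.isSimplex hT).sum_surf_pos]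
  calc 𝒯.h * volRatioConst d κ * ∑ F ∈ facets T, (surf d).real (hull F)
      ≤ 𝒯.h * volRatioConst d κ * ((d + 1) * (𝒯.h ^ (d - 1) * ballVol (d - 1))) :=
        mul_le_mul_of_nonneg_left (𝒯.sum_surf_le hT)
          (mul_pos h_pos (volRatioConst_pos d κ_pos)).le
    _ = (𝒯.h / κ) ^ d * ballVol d := by
        rw [volRatioConst, div_pow, ← pow_sub_one_mul (NeZero.ne d) 𝒯.h]
        field_simp
    _ ≤ volume.real (hull T) := hu.le_volume_real_hull hT

end SimplicialMesh.IsUniform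

/-! ### Cells around a point -/

namespace SimplicialMesh

variable {Ω : Set (Pt d)} (𝒯 : SimplicialMesh d Ω)

theorem sum_star_volume_real_hull_le (v : Pt d) :
    ∑ T ∈ 𝒯.star v, volume.real (hull T) ≤ volume.real (Metric.closedBall v 𝒯.h) := by
  have volume_eq : ∀ T ∈ 𝒯.star v, volume.real (hull T) = volume.real (interior (hull T)) :=
    fun T _ => (measureReal_congr
      (interior_ae_eq_of_null_frontier (volume_frontier_hull T))).symm
  rw [Finset.sum_congr rfl volume_eq, ← measureReal_biUnion_finset (h := fun T _ =>
    ((measure_mono interior_subset).trans_lt (isCompact_hull T).measure_lt_top).ne)]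
  · refine measureReal_mono (Set.iUnion₂_subset fun T hT x hx => ?_) measure_closedBall_lt_top.ne
    obtain ⟨hT, hv⟩ := 𝒯.mem_star.1 hT
    exact (Metric.dist_le_diam_of_mem (isCompact_hull T).isBounded (interior_subset hx) hv).trans
      (𝒯.diam_le_h hT)
  · exact fun T hT T' hT' hne => Set.disjoint_left.2 fun x hx hx' => hne
      (𝒯.eq_of_mem_interior (𝒯.mem_star.1 hT).1 (𝒯.mem_star.1 hT').1 hx (interior_subset hx'))
  · exact fun T _ => isOpen_interior.measurableSet

variable {𝒯} {κ : ℝ}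

theorem IsUniform.card_star_le (hu : 𝒯.IsUniform κ) (v : Pt d) :
    ((𝒯.star v).card : ℝ) ≤ κ ^ d := by
  have κ_pos := hu.κ_pos
  have h_pos := hu.h_pos
  have ball_pos : 0 < 𝒯.h ^ d * ballVol d := mul_pos (pow_pos h_pos d) (ballVol_pos d)
  have card_le : (𝒯.star v).card • ((𝒯.h / κ) ^ d * ballVol d) ≤
      ∑ T ∈ 𝒯.star v, volume.real (hull T) :=
    Finset.card_nsmul_le_sum _ _ _ fun T hT => hu.le_volume_real_hull (𝒯.mem_star.1 hT).1
  have volume_le := card_le.trans (𝒯.sum_star_volume_real_hull_le v)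
  rw [volume_real_closedBall v h_pos.le, nsmul_eq_mul] at volume_le
  refine le_of_mul_le_mul_right ?_ ball_pos
  calc ((𝒯.star v).card : ℝ) * (𝒯.h ^ d * ballVol d)
      = κ ^ d * ((𝒯.star v).card * ((𝒯.h / κ) ^ d * ballVol d)) := by
        rw [div_pow]
        field_simp
    _ ≤ κ ^ d * (𝒯.h ^ d * ballVol d) :=
        mul_le_mul_of_nonneg_left volume_le (pow_pos κ_pos d).le

end SimplicialMesh

theorem abs_sub_le_walk_length_mul {V : Type*} {G : SimpleGraph V} {f : V → ℝ} {δ : ℝ}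
    (hf : ∀ a b, G.Adj a b → |f a - f b| ≤ δ) {a b : V} (p : G.Walk a b) :
    |f a - f b| ≤ p.length * δ := by
  induction p with
  | nil => simp
  | @cons a b c hab p ih =>
    rw [SimpleGraph.Walk.length_cons, Nat.cast_succ]
    linarith [hf a b hab, abs_sub_le (f a) (f b) (f c)]

theorem abs_sub_le_card_mul_of_preconnected {V : Type*} [Fintype V] {G : SimpleGraph V}
    (hG : G.Preconnected) {f : V → ℝ} {δ : ℝ} (hδ : 0 ≤ δ)
    (hf : ∀ a b, G.Adj a b → |f a - f b| ≤ δ) (a b : V) : |f a - f b| ≤ Fintype.card V * δ := by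
  obtain ⟨p, hp⟩ := (hG a b).exists_isPath
  have length_le : (p.length : ℝ) ≤ Fintype.card V := by exact_mod_cast hp.length_lt.le
  exact (abs_sub_le_walk_length_mul hf p).trans (mul_le_mul_of_nonneg_right length_le hδ)

theorem SimplicialMesh.IsUniform.abs_sub_le_of_mem_star {Ω : Set (Pt d)} {𝒯 : SimplicialMesh d Ω}
    {κ : ℝ} (hu : 𝒯.IsUniform κ) (hΩ : IsLipschitzDomain Ω) {v : Pt d} {f : Finset (Pt d) → ℝ}
    {δ : ℝ} (hδ : 0 ≤ δ)
    (hf : ∀ T ∈ 𝒯.star v, ∀ T' ∈ 𝒯.star v, ∀ F ∈ facets T, F ∈ facets T' → |f T - f T'| ≤ δ)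
    {T T' : Finset (Pt d)} (hT : T ∈ 𝒯.star v) (hT' : T' ∈ 𝒯.star v) :
    |f T - f T'| ≤ κ ^ d * δ := by
  have card_bound := abs_sub_le_card_mul_of_preconnected (𝒯.starGraph_preconnected hΩ v)
    (f := fun T => f T) hδ (fun A B ⟨_, F, hFA, hFB, _⟩ => hf A A.2 B B.2 F hFA hFB)
    ⟨T, hT⟩ ⟨T', hT'⟩
  rw [Fintype.card_coe] at card_bound
  exact card_bound.trans (mul_le_mul_of_nonneg_right (hu.card_star_le v) hδ)

theorem sq_sub_le_of_setIntegral_face_le {T F : Finset (Pt d)} (hT : IsSimplex T) [NeZero d]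
    (hF : F ∈ facets T) {l : Pt d → ℝ} (hl : ContinuousOn l (hull F)) {a b A B : ℝ}
    (ha : ∫ x in hull F, (a - l x) ^ 2 ∂(surf d) ≤ (surf d).real (hull F) * A)
    (hb : ∫ x in hull F, (b - l x) ^ 2 ∂(surf d) ≤ (surf d).real (hull F) * B) :
    (a - b) ^ 2 ≤ 2 * A + 2 * B := by
  have integrable_sq : ∀ c : ℝ, IntegrableOn (fun x => (c - l x) ^ 2) (hull F) (surf d) :=
    fun _ => integrableOn_face hT hF ((continuousOn_const.sub hl).pow 2)
  have integral_le : ∫ _ in hull F, (a - b) ^ 2 ∂(surf d) ≤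
      ∫ x in hull F, (2 * (a - l x) ^ 2 + 2 * (b - l x) ^ 2) ∂(surf d) := by
    refine setIntegral_mono_on (integrableOn_face hT hF continuousOn_const)
      (((integrable_sq a).const_mul 2).add ((integrable_sq b).const_mul 2))
      (isClosed_hull F).measurableSet fun x _ => ?_
    nlinarith [sq_nonneg ((a - l x) + (b - l x))]
  rw [setIntegral_const, smul_eq_mul,
    integral_add ((integrable_sq a).const_mul 2) ((integrable_sq b).const_mul 2),
    integral_const_mul, integral_const_mul] at integral_le
  refine le_of_mul_le_mul_left ?_ (hT.surf_pos hF)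
  linarith

/-! ### The local error indicators -/

namespace Method

variable {Ω : Set (Pt d)} {𝒯 : SimplicialMesh d Ω} {p k : ℕ} (S : Method 𝒯 p k)

/-- The error indicator of `λ` on the cell `T`: the gradient of `𝒰 λ` and the distance of `𝒰 λ`
to `λ` on `∂T`, scaled like `‖·‖_ℓ²`. -/
def errorIndicator (lam : 𝒯.M p) (T : Finset (Pt d)) : ℝ :=
  𝒯.h ^ 2 * (∫ x in hull T, ‖vecVal (polyGrad (S.U lam T)) x‖ ^ 2) +
    volRatio T * bdryIntegral T (fun F x => S.jump lam T F x ^ 2)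

theorem sq_mul_integral_grad_le_errorIndicator [NeZero d] (lam : 𝒯.M p) {T : Finset (Pt d)}
    (hT : T ∈ 𝒯.cells) :
    𝒯.h ^ 2 * (∫ x in hull T, ‖vecVal (polyGrad (S.U lam T)) x‖ ^ 2) ≤ S.errorIndicator lam T :=
  le_add_of_nonneg_right (𝒯.volRatio_mul_bdryIntegral_sq_nonneg hT _)

theorem volRatio_mul_bdryIntegral_jump_sq_le_errorIndicator (lam : 𝒯.M p) (T : Finset (Pt d)) :
    volRatio T * bdryIntegral T (fun F x => S.jump lam T F x ^ 2) ≤ S.errorIndicator lam T :=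
  le_add_of_nonneg_left (mul_nonneg (sq_nonneg _) (integral_nonneg fun _ => by positivity))

theorem errorIndicator_nonneg [NeZero d] (lam : 𝒯.M p) {T : Finset (Pt d)} (hT : T ∈ 𝒯.cells) :
    0 ≤ S.errorIndicator lam T :=
  (𝒯.volRatio_mul_bdryIntegral_sq_nonneg hT _).trans
    (S.volRatio_mul_bdryIntegral_jump_sq_le_errorIndicator lam T)

theorem sum_errorIndicator [NeZero d] (hΩ : IsLipschitzDomain Ω) (lam : 𝒯.M p) :
    ∑ T ∈ 𝒯.cells, S.errorIndicator lam T =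
      𝒯.h ^ 2 * l2norm Ω (𝒯.vecFn fun T => polyGrad (S.U lam T)) ^ 2 +
        𝒯.skelNorm (S.jump lam) ^ 2 := by
  rw [𝒯.l2norm_vecFn_sq hΩ, 𝒯.skelNorm_sq, Finset.mul_sum, ← Finset.sum_add_distrib]
  rfl

variable {S} {c1 c3 : ℝ}

theorem LS1.skelNorm_jump_le [NeZero d] (h1 : S.LS1 c1) (hΩ : IsLipschitzDomain Ω)
    (lam : 𝒯.M p) : 𝒯.skelNorm (S.jump lam) ≤ |c1| * (𝒯.h * S.normQ lam) := by
  rw [← mul_assoc]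
  have := 𝒯.h_pos hΩ
  have := S.normQ_nonneg lam
  exact (h1 lam).trans (by gcongr; exact le_abs_self c1)

theorem LS3.l2norm_grad_le [NeZero d] (h3 : S.LS3 c3) (h1 : S.LS1 c1) (hΩ : IsLipschitzDomain Ω)
    (lam : 𝒯.M p) :
    l2norm Ω (𝒯.vecFn fun T => polyGrad (S.U lam T)) ≤ (1 + |c1| * |c3|) * S.normQ lam := by
  have h_pos := 𝒯.h_pos hΩ
  have grad_eq : 𝒯.vecFn (fun T => polyGrad (S.U lam T)) =ᵐ[volume.restrict Ω]
      𝒯.vecFn (fun T => S.Q lam T + polyGrad (S.U lam T)) - 𝒯.vecFn (S.Q lam) := by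
    filter_upwards [𝒯.ae_mem_interior] with x ⟨T, hT, hx⟩
    simp only [Pi.sub_apply, 𝒯.vecFn_eq _ hT hx, vecVal_add, add_sub_cancel_left]
  have consistency : l2norm Ω (𝒯.vecFn fun T => S.Q lam T + polyGrad (S.U lam T)) ≤
      |c1| * |c3| * S.normQ lam :=
    calc l2norm Ω (𝒯.vecFn fun T => S.Q lam T + polyGrad (S.U lam T))
        ≤ c3 * 𝒯.h⁻¹ * 𝒯.skelNorm (S.jump lam) := h3 lam
      _ ≤ |c3| * 𝒯.h⁻¹ * (|c1| * (𝒯.h * S.normQ lam)) := by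
          gcongr
          · exact 𝒯.skelNorm_nonneg _
          · exact le_abs_self c3
          · exact h1.skelNorm_jump_le hΩ lam
      _ = |c1| * |c3| * S.normQ lam := by field_simp
  calc l2norm Ω (𝒯.vecFn fun T => polyGrad (S.U lam T))
      ≤ l2norm Ω (𝒯.vecFn fun T => S.Q lam T + polyGrad (S.U lam T)) + S.normQ lam :=
        (l2norm_congr grad_eq).trans_le (l2norm_sub_le (𝒯.memLp_vecFn _) (𝒯.memLp_vecFn _))
    _ ≤ (1 + |c1| * |c3|) * S.normQ lam := by linarith

theorem LS3.sum_errorIndicator_le [NeZero d] (h3 : S.LS3 c3) (h1 : S.LS1 c1)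
    (hΩ : IsLipschitzDomain Ω) (lam : 𝒯.M p) :
    ∑ T ∈ 𝒯.cells, S.errorIndicator lam T ≤
      ((1 + |c1| * |c3|) ^ 2 + c1 ^ 2) * (𝒯.h * S.normQ lam) ^ 2 :=
  calc ∑ T ∈ 𝒯.cells, S.errorIndicator lam T
      ≤ 𝒯.h ^ 2 * ((1 + |c1| * |c3|) * S.normQ lam) ^ 2 + (|c1| * (𝒯.h * S.normQ lam)) ^ 2 := by
        rw [S.sum_errorIndicator hΩ]
        gcongr
        · exact l2norm_nonneg _ _
        · exact h3.l2norm_grad_le h1 hΩ lam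
        · exact 𝒯.skelNorm_nonneg _
        · exact h1.skelNorm_jump_le hΩ lam
    _ = ((1 + |c1| * |c3|) ^ 2 + c1 ^ 2) * (𝒯.h * S.normQ lam) ^ 2 := by
        rw [mul_pow |c1|, sq_abs]
        ring

end Method

/-! ### Local estimates for the scalar local solver -/

/-- The constant in the bound of the oscillation of `𝒰 λ` on a cell by its error indicator. -/
def oscillationConst (d k : ℕ) (κ : ℝ) : ℝ := (exists_oscillation_estimate d k κ).choose * κ ^ d

theorem oscillationConst_pos (d k : ℕ) {κ : ℝ} (hκ : 0 < κ) : 0 < oscillationConst d k κ :=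
  mul_pos (exists_oscillation_estimate d k κ).choose_spec.1 (pow_pos hκ d)

/-- The constant in the bound of the `L²` norm of `𝒰 λ - λ` on a face by the error indicator. -/
def jumpConst (d : ℕ) (κ : ℝ) : ℝ := κ ^ (d - 1) / (ballVol (d - 1) * volRatioConst d κ)

theorem jumpConst_pos (d : ℕ) {κ : ℝ} (hκ : 0 < κ) : 0 < jumpConst d κ :=
  div_pos (pow_pos hκ _) (mul_pos (ballVol_pos _) (volRatioConst_pos d hκ))

/-- The constant in the bound of the `L²` distance on a face of `λ` to a value of `𝒰 λ` on an
adjacent cell by the error indicator. -/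
def faceConst (d k : ℕ) (κ : ℝ) : ℝ := 2 * oscillationConst d k κ + 2 * jumpConst d κ

theorem faceConst_pos (d k : ℕ) {κ : ℝ} (hκ : 0 < κ) : 0 < faceConst d k κ := by
  have := oscillationConst_pos d k hκ
  have := jumpConst_pos d hκ
  unfold faceConst
  positivity

namespace Method

variable {Ω : Set (Pt d)} {𝒯 : SimplicialMesh d Ω} {p k : ℕ} (S : Method 𝒯 p k) {κ : ℝ}
  (hu : 𝒯.IsUniform κ) (lam : 𝒯.M p) {T F : Finset (Pt d)}
include hu

theorem sq_sub_val_U_le [NeZero d] (hT : T ∈ 𝒯.cells) {x y : Pt d} (hx : x ∈ hull T)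
    (hy : y ∈ hull T) :
    (val (S.U lam T) x - val (S.U lam T) y) ^ 2 ≤
      oscillationConst d k κ * (S.errorIndicator lam T / 𝒯.h ^ d) := by
  have κ_pos := hu.κ_pos
  have h_pos := hu.h_pos
  obtain ⟨c, hc⟩ := hu.exists_closedBall_subset T hT
  obtain ⟨C_pos, hC⟩ := (exists_oscillation_estimate d k κ).choose_spec
  rw [oscillationConst]
  set C := (exists_oscillation_estimate d k κ).choose
  have U_mem : S.U lam T ∈ PolyDeg d k := S.V_le T hT (S.isLocalSolution hT lam).mem_V
  have diam_le : Metric.diam (hull T) ≤ κ * (𝒯.h / κ) := by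
    rw [mul_div_cancel₀ _ κ_pos.ne']
    exact 𝒯.diam_le_h hT
  have scaled_bound : (val (S.U lam T) x - val (S.U lam T) y) ^ 2 * (𝒯.h / κ) ^ d ≤
      C * S.errorIndicator lam T :=
    calc (val (S.U lam T) x - val (S.U lam T) y) ^ 2 * (𝒯.h / κ) ^ d
        ≤ C * Metric.diam (hull T) ^ 2 * ∫ z in hull T, ‖vecVal (polyGrad (S.U lam T)) z‖ ^ 2 :=
          hC _ U_mem _ (isCompact_hull T) (convex_convexHull ℝ _) c _ hu.radius_pos hc diam_le
            x hx y hy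
      _ ≤ C * (𝒯.h ^ 2 * ∫ z in hull T, ‖vecVal (polyGrad (S.U lam T)) z‖ ^ 2) := by
          rw [mul_assoc]
          gcongr
          exact 𝒯.diam_le_h hT
      _ ≤ C * S.errorIndicator lam T :=
          mul_le_mul_of_nonneg_left (S.sq_mul_integral_grad_le_errorIndicator lam hT) C_pos.le
  rw [← le_div_iff₀ (pow_pos hu.radius_pos d)] at scaled_bound
  refine scaled_bound.trans_eq ?_
  rw [div_pow]
  field_simp

theorem setIntegral_jump_sq_le [NeZero d] (hT : T ∈ 𝒯.cells) (hF : F ∈ facets T) :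
    ∫ x in hull F, S.jump lam T F x ^ 2 ∂(surf d) ≤
      (surf d).real (hull F) * (jumpConst d κ * (S.errorIndicator lam T / 𝒯.h ^ d)) := by
  have κ_pos := hu.κ_pos
  have h_pos := hu.h_pos
  have ballVol_pos := ballVol_pos (d - 1)
  have volRatioConst_pos := volRatioConst_pos d κ_pos
  have errorIndicator_nonneg := S.errorIndicator_nonneg lam hT
  set J := bdryIntegral T (fun F x => S.jump lam T F x ^ 2)
  have J_nonneg : 0 ≤ J := bdryIntegral_nonneg fun _ _ _ _ => sq_nonneg _
  calc ∫ x in hull F, S.jump lam T F x ^ 2 ∂(surf d)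
      ≤ J := Finset.single_le_sum (f := fun F => ∫ x in hull F, S.jump lam T F x ^ 2 ∂(surf d))
        (fun _ _ => integral_nonneg fun _ => sq_nonneg _) hF
    _ ≤ S.errorIndicator lam T / (𝒯.h * volRatioConst d κ) := by
        rw [le_div_iff₀' (mul_pos h_pos volRatioConst_pos)]
        exact (mul_le_mul_of_nonneg_right (hu.mul_volRatioConst_le_volRatio hT) J_nonneg).trans
          (S.volRatio_mul_bdryIntegral_jump_sq_le_errorIndicator lam T)
    _ = (𝒯.h / κ) ^ (d - 1) * ballVol (d - 1) *
          (jumpConst d κ * (S.errorIndicator lam T / 𝒯.h ^ d)) := by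
        rw [jumpConst, div_pow, ← pow_sub_one_mul (NeZero.ne d) 𝒯.h]
        field_simp
    _ ≤ (surf d).real (hull F) * (jumpConst d κ * (S.errorIndicator lam T / 𝒯.h ^ d)) :=
        mul_le_mul_of_nonneg_right (hu.le_surf_real hT hF) (mul_nonneg (jumpConst_pos d κ_pos).le
          (div_nonneg errorIndicator_nonneg (pow_pos h_pos d).le))

theorem setIntegral_face_sq_sub_le [NeZero d] (hT : T ∈ 𝒯.cells) (hF : F ∈ facets T) {v : Pt d}
    (hv : v ∈ hull T) :
    ∫ x in hull F, (val (S.U lam T) v - (lam : Finset (Pt d) → Pt d → ℝ) F x) ^ 2 ∂(surf d) ≤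
      (surf d).real (hull F) * (faceConst d k κ * (S.errorIndicator lam T / 𝒯.h ^ d)) := by
  set A := oscillationConst d k κ * (S.errorIndicator lam T / 𝒯.h ^ d) with hA
  have jump_continuousOn : ContinuousOn (fun x => S.jump lam T F x ^ 2) (hull F) :=
    (S.jump_continuousOn lam hT hF).pow 2
  calc ∫ x in hull F, (val (S.U lam T) v - (lam : Finset (Pt d) → Pt d → ℝ) F x) ^ 2 ∂(surf d)
      ≤ ∫ x in hull F, (2 * A + 2 * S.jump lam T F x ^ 2) ∂(surf d) := by
        refine setIntegral_mono_on (integrableOn_face (𝒯.isSimplex hT) hF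
            ((continuousOn_const.sub (𝒯.M_continuousOn lam hT hF)).pow 2))
          (integrableOn_face (𝒯.isSimplex hT) hF
            (continuousOn_const.add (continuousOn_const.mul jump_continuousOn)))
          (isClosed_hull F).measurableSet fun x hx => ?_
        have oscillation_le := S.sq_sub_val_U_le hu lam hT hv (hull_mono (facet_subset hF) hx)
        rw [← hA] at oscillation_le
        rw [← sub_add_sub_cancel _ (val (S.U lam T) x)]
        exact (add_sq_le (a := val (S.U lam T) v - val (S.U lam T) x)).trans
          (by rw [Method.jump]; linarith)
    _ = (surf d).real (hull F) * (2 * A) + 2 * ∫ x in hull F, S.jump lam T F x ^ 2 ∂(surf d) := by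
        rw [integral_add (integrableOn_face (𝒯.isSimplex hT) hF continuousOn_const)
          ((integrableOn_face (𝒯.isSimplex hT) hF jump_continuousOn).const_mul 2),
          setIntegral_const, integral_const_mul, smul_eq_mul]
    _ ≤ (surf d).real (hull F) * (faceConst d k κ * (S.errorIndicator lam T / 𝒯.h ^ d)) := by
        rw [faceConst]
        linarith [S.setIntegral_jump_sq_le hu lam hT hF]

end Method

/-! ### Nodal values -/

namespace Method

variable {Ω : Set (Pt d)} {𝒯 : SimplicialMesh d Ω} {p k : ℕ} (S : Method 𝒯 p k) (lam : 𝒯.M p)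
  {v : Pt d}

open Classical in
/-- Vertex values of a conforming approximation: zero on the boundary, and the value of `𝒰 λ` from
one of the adjacent cells elsewhere. -/
def nodal (v : Pt d) : ℝ :=
  if h : v ∉ frontier Ω ∧ (𝒯.star v).Nonempty then val (S.U lam h.2.choose) v else 0

theorem nodal_eq_zero_of_mem_frontier (hv : v ∈ frontier Ω) : S.nodal lam v = 0 :=
  dif_neg fun h => h.1 hv

theorem exists_nodal_eq (hv : v ∉ frontier Ω) (hv_star : (𝒯.star v).Nonempty) :
    ∃ T ∈ 𝒯.star v, S.nodal lam v = val (S.U lam T) v :=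
  ⟨_, hv_star.choose_spec, dif_pos ⟨hv, hv_star⟩⟩

/-- The error indicator of `λ` on the cells around `v`. -/
def starIndicator (v : Pt d) : ℝ := ∑ T ∈ 𝒯.star v, S.errorIndicator lam T

variable [NeZero d]

theorem errorIndicator_le_starIndicator {T : Finset (Pt d)} (hT : T ∈ 𝒯.star v) :
    S.errorIndicator lam T ≤ S.starIndicator lam v :=
  Finset.single_le_sum (f := S.errorIndicator lam)
    (fun _ hT => S.errorIndicator_nonneg lam (𝒯.mem_star.1 hT).1) hT

theorem starIndicator_nonneg (v : Pt d) : 0 ≤ S.starIndicator lam v :=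
  Finset.sum_nonneg fun _ hT => S.errorIndicator_nonneg lam (𝒯.mem_star.1 hT).1

variable {κ : ℝ} (hu : 𝒯.IsUniform κ)
include hu

theorem setIntegral_face_sq_sub_le_starIndicator {T F : Finset (Pt d)} (hT : T ∈ 𝒯.star v)
    (hF : F ∈ facets T) :
    ∫ x in hull F, (val (S.U lam T) v - (lam : Finset (Pt d) → Pt d → ℝ) F x) ^ 2 ∂(surf d) ≤
      (surf d).real (hull F) * (faceConst d k κ * (S.starIndicator lam v / 𝒯.h ^ d)) := by
  have h_pos := hu.h_pos
  have faceConst_pos := faceConst_pos d k hu.κ_pos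
  refine (S.setIntegral_face_sq_sub_le hu lam (𝒯.mem_star.1 hT).1 hF (𝒯.mem_star.1 hT).2).trans ?_
  gcongr
  exact S.errorIndicator_le_starIndicator lam hT

theorem abs_val_U_sub_val_U_le_of_common_facet {T T' F : Finset (Pt d)} (hT : T ∈ 𝒯.star v)
    (hT' : T' ∈ 𝒯.star v) (hF : F ∈ facets T) (hF' : F ∈ facets T') :
    |val (S.U lam T) v - val (S.U lam T') v| ≤
      √(4 * faceConst d k κ * (S.starIndicator lam v / 𝒯.h ^ d)) :=
  Real.abs_le_sqrt ((sq_sub_le_of_setIntegral_face_le (𝒯.isSimplex (𝒯.mem_star.1 hT).1) hF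
    (𝒯.M_continuousOn lam (𝒯.mem_star.1 hT).1 hF)
    (S.setIntegral_face_sq_sub_le_starIndicator lam hu hT hF)
    (S.setIntegral_face_sq_sub_le_starIndicator lam hu hT' hF')).trans_eq (by ring))

theorem abs_val_U_le_of_boundary_facet {T F : Finset (Pt d)} (hT : T ∈ 𝒯.star v)
    (hF : F ∈ facets T) (hF_frontier : hull F ⊆ frontier Ω) :
    |val (S.U lam T) v| ≤ √(4 * faceConst d k κ * (S.starIndicator lam v / 𝒯.h ^ d)) := by
  have hT_cell := (𝒯.mem_star.1 hT).1
  have face_integral := S.setIntegral_face_sq_sub_le_starIndicator lam hu hT hF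
  have bound_nonneg : 0 ≤ faceConst d k κ * (S.starIndicator lam v / 𝒯.h ^ d) :=
    mul_nonneg (faceConst_pos d k hu.κ_pos).le
      (div_nonneg (S.starIndicator_nonneg lam v) (pow_pos hu.h_pos d).le)
  have zero_integral : ∫ x in hull F, (0 - (lam : Finset (Pt d) → Pt d → ℝ) F x) ^ 2 ∂(surf d) ≤
      (surf d).real (hull F) * 0 := by
    simp [𝒯.M_eq_zero_of_frontier lam (𝒯.isFace hT_cell hF) hF_frontier]
  have sq_le := sq_sub_le_of_setIntegral_face_le (𝒯.isSimplex hT_cell) hF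
    (𝒯.M_continuousOn lam hT_cell hF) face_integral zero_integral
  rw [sub_zero] at sq_le
  exact Real.abs_le_sqrt (by linarith)

theorem abs_val_U_sub_val_U_le (hΩ : IsLipschitzDomain Ω) {T T' : Finset (Pt d)}
    (hT : T ∈ 𝒯.star v) (hT' : T' ∈ 𝒯.star v) :
    |val (S.U lam T) v - val (S.U lam T') v| ≤
      κ ^ d * √(4 * faceConst d k κ * (S.starIndicator lam v / 𝒯.h ^ d)) :=
  hu.abs_sub_le_of_mem_star hΩ (f := fun T => val (S.U lam T) v) (Real.sqrt_nonneg _)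
    (fun _ hA _ hB _ hFA hFB => S.abs_val_U_sub_val_U_le_of_common_facet lam hu hA hB hFA hFB)
    hT hT'

theorem abs_val_U_sub_nodal_le (hΩ : IsLipschitzDomain Ω) {T : Finset (Pt d)}
    (hT : T ∈ 𝒯.star v) :
    |val (S.U lam T) v - S.nodal lam v| ≤
      (κ ^ d + 1) * √(4 * faceConst d k κ * (S.starIndicator lam v / 𝒯.h ^ d)) := by
  by_cases hv : v ∈ frontier Ω
  · obtain ⟨T', hT', F, hF, hvF, hF_frontier⟩ := 𝒯.exists_boundary_face hΩ hv
    have hT'_star : T' ∈ 𝒯.star v := 𝒯.mem_star.2 ⟨hT', hull_mono (facet_subset hF) hvF⟩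
    rw [S.nodal_eq_zero_of_mem_frontier lam hv]
    refine (abs_sub_le _ (val (S.U lam T') v) 0).trans ?_
    rw [sub_zero, add_one_mul]
    exact add_le_add (S.abs_val_U_sub_val_U_le lam hu hΩ hT hT'_star)
      (S.abs_val_U_le_of_boundary_facet lam hu hT'_star hF hF_frontier)
  · obtain ⟨T', hT', nodal_eq⟩ := S.exists_nodal_eq lam hv ⟨T, hT⟩
    rw [nodal_eq]
    exact (S.abs_val_U_sub_val_U_le lam hu hΩ hT hT').trans
      (mul_le_mul_of_nonneg_right (lt_add_one _).le (Real.sqrt_nonneg _))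

theorem sq_val_U_sub_nodal_le (hΩ : IsLipschitzDomain Ω) {T : Finset (Pt d)} (hT : T ∈ 𝒯.star v) :
    (val (S.U lam T) v - S.nodal lam v) ^ 2 ≤
      4 * (κ ^ d + 1) ^ 2 * faceConst d k κ * (S.starIndicator lam v / 𝒯.h ^ d) := by
  have bound_nonneg : 0 ≤ 4 * faceConst d k κ * (S.starIndicator lam v / 𝒯.h ^ d) :=
    mul_nonneg (mul_pos four_pos (faceConst_pos d k hu.κ_pos)).le
      (div_nonneg (S.starIndicator_nonneg lam v) (pow_pos hu.h_pos d).le)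
  have sq_le := pow_le_pow_left₀ (abs_nonneg _) (S.abs_val_U_sub_nodal_le lam hu hΩ hT) 2
  rw [sq_abs, mul_pow, Real.sq_sqrt bound_nonneg] at sq_le
  linarith

end Method

/-! ### Approximation by conforming functions -/

theorem IsSimplex.sq_sub_linInterp_le {T : Finset (Pt d)} (hT : IsSimplex T) (a : ℝ)
    (g : Pt d → ℝ) {x : Pt d} (hx : x ∈ hull T) :
    (a - linInterp T g x) ^ 2 ≤ ∑ v ∈ T, (a - g v) ^ 2 := by
  have bary_nonneg := hT.mem_hull_iff.1 hx
  have sub_eq : a - linInterp T g x = ∑ v ∈ T, bary T v x • (a - g v) := by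
    simp only [smul_eq_mul, mul_sub, Finset.sum_sub_distrib, ← Finset.sum_mul, hT.sum_bary,
      one_mul, linInterp_apply]
  calc (a - linInterp T g x) ^ 2 ≤ ∑ v ∈ T, bary T v x • (a - g v) ^ 2 := by
        rw [sub_eq]
        exact even_two.convexOn_pow.map_sum_le bary_nonneg (hT.sum_bary x)
          fun _ _ => Set.mem_univ _
    _ ≤ ∑ v ∈ T, (a - g v) ^ 2 := Finset.sum_le_sum fun v hv =>
        mul_le_of_le_one_left (sq_nonneg _)
          (hT.sum_bary x ▸ Finset.single_le_sum (f := fun v => bary T v x) bary_nonneg hv)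

theorem IsSimplex.volRatio_mul_bdryIntegral_const {T : Finset (Pt d)} (hT : IsSimplex T)
    [NeZero d] (A : ℝ) :
    volRatio T * bdryIntegral T (fun _ _ => A) = volume.real (hull T) * A := by
  have := hT.sum_surf_pos.ne'
  simp only [bdryIntegral, setIntegral_const, smul_eq_mul, ← Finset.sum_mul, volRatio]
  field_simp

namespace SimplicialMesh

variable {Ω : Set (Pt d)} (𝒯 : SimplicialMesh d Ω)

theorem mem_of_mem_hull {T T' : Finset (Pt d)} (hT : T ∈ 𝒯.cells) (hT' : T' ∈ 𝒯.cells) {v : Pt d}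
    (hv : v ∈ T) (hv' : v ∈ hull T') : v ∈ T' := by
  classical
  exact Finset.mem_of_mem_inter_right ((𝒯.isSimplex hT).mem_of_mem_hull Finset.inter_subset_left hv
    (𝒯.hull_inter_hull hT hT' ▸ ⟨mem_hull_of_mem hv, hv'⟩))

open Classical in
theorem sum_vertices_sum_star (D : Finset (Pt d) → ℝ) :
    ∑ T ∈ 𝒯.cells, ∑ v ∈ T, ∑ T' ∈ 𝒯.star v, D T' =
      ∑ T' ∈ 𝒯.cells, ((∑ T ∈ 𝒯.cells, (T' ∩ T).card : ℕ) : ℝ) * D T' := by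
  simp only [Nat.cast_sum, Finset.sum_mul]
  rw [Finset.sum_comm]
  refine Finset.sum_congr rfl fun T hT => ?_
  rw [Finset.sum_comm' (t' := 𝒯.cells) (s' := fun T' => T' ∩ T)]
  · simp only [Finset.sum_const, nsmul_eq_mul]
  · intro v T'
    rw [𝒯.mem_star, Finset.mem_inter]
    exact ⟨fun ⟨hv, hT', hv'⟩ => ⟨⟨𝒯.mem_of_mem_hull hT hT' hv hv', hv⟩, hT'⟩,
      fun ⟨⟨hv', hv⟩, hT'⟩ => ⟨hv, hT', mem_hull_of_mem hv'⟩⟩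

variable {𝒯} {κ : ℝ}

theorem IsUniform.sum_vertices_sum_star_le (hu : 𝒯.IsUniform κ) {D : Finset (Pt d) → ℝ}
    (hD : ∀ T ∈ 𝒯.cells, 0 ≤ D T) :
    ∑ T ∈ 𝒯.cells, ∑ v ∈ T, ∑ T' ∈ 𝒯.star v, D T' ≤ (d + 1) * κ ^ d * ∑ T ∈ 𝒯.cells, D T := by
  classical
  have card_le : ∀ T' ∈ 𝒯.cells, ∀ v ∈ T', (𝒯.cells.filter (v ∈ ·)).card ≤ ⌊κ ^ d⌋₊ :=
    fun T' _ v _ => (Finset.card_le_card fun T hT => 𝒯.mem_star.2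
      ((Finset.mem_filter.1 hT).imp_right mem_hull_of_mem)).trans (Nat.le_floor (hu.card_star_le v))
  rw [𝒯.sum_vertices_sum_star, Finset.mul_sum]
  refine Finset.sum_le_sum fun T' hT' => mul_le_mul_of_nonneg_right ?_ (hD T' hT')
  calc ((∑ T ∈ 𝒯.cells, (T' ∩ T).card : ℕ) : ℝ) ≤ ((d + 1) * ⌊κ ^ d⌋₊ : ℕ) :=
        Nat.cast_le.2 (𝒯.card_eq T' hT' ▸ Finset.sum_card_inter_le (card_le T' hT'))
    _ ≤ (d + 1) * κ ^ d := by
        push_cast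
        exact mul_le_mul_of_nonneg_left (Nat.floor_le (pow_pos hu.κ_pos d).le) (by positivity)

end SimplicialMesh

/-- The constant in the bound of the distance between `𝒰 λ` and the conforming approximation of `λ`
by the error indicators. -/
def interpolationConst (d k : ℕ) (κ : ℝ) : ℝ :=
  2 * oscillationConst d k κ + 2 * (4 * (κ ^ d + 1) ^ 2 * faceConst d k κ)

theorem interpolationConst_pos (d k : ℕ) {κ : ℝ} (hκ : 0 < κ) : 0 < interpolationConst d k κ := by
  have := oscillationConst_pos d k hκ
  have := faceConst_pos d k hκ
  unfold interpolationConst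
  positivity

/-- The constant in the approximation of skeletal functions by traces of conforming functions. -/
def approxConst (d k : ℕ) (κ c1 c3 : ℝ) : ℝ :=
  √((2 * (ballVol d * interpolationConst d k κ * ((d + 1) * κ ^ d)) + 2) *
    ((1 + |c1| * |c3|) ^ 2 + c1 ^ 2))

theorem approxConst_pos (d k : ℕ) {κ : ℝ} (hκ : 0 < κ) (c1 c3 : ℝ) :
    0 < approxConst d k κ c1 c3 := by
  have := ballVol_pos d
  have := interpolationConst_pos d k hκ
  exact Real.sqrt_pos.2 (by positivity)

namespace Method

variable {Ω : Set (Pt d)} {𝒯 : SimplicialMesh d Ω} {p k : ℕ} (S : Method 𝒯 p k) (lam : 𝒯.M p)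

/-- The conforming approximation of `λ`: the piecewise linear function with vertex values
`S.nodal λ`. -/
def conformingApprox : Pt d → ℝ := 𝒯.interpolate (S.nodal lam)

variable (hΩ : IsLipschitzDomain Ω)
include hΩ

theorem conformingP1_conformingApprox : 𝒯.ConformingP1 (S.conformingApprox lam) :=
  𝒯.conformingP1_interpolate hΩ fun _ hv => S.nodal_eq_zero_of_mem_frontier lam hv

theorem conformingApprox_eq_zero {x : Pt d} (hx : x ∉ Ω) : S.conformingApprox lam x = 0 :=
  𝒯.interpolate_eq_zero hΩ (fun _ hv => S.nodal_eq_zero_of_mem_frontier lam hv) hx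

theorem continuous_conformingApprox : Continuous (S.conformingApprox lam) := by
  obtain ⟨K, hK⟩ := 𝒯.exists_lipschitzWith_interpolate hΩ
    fun _ hv => S.nodal_eq_zero_of_mem_frontier lam hv
  exact hK.continuous

theorem trace_conformingApprox_mem_M (hp : 1 ≤ p) : 𝒯.trace (S.conformingApprox lam) ∈ 𝒯.M p :=
  𝒯.trace_mem_M hp (S.conformingP1_conformingApprox lam hΩ) fun _ hx =>
    S.conformingApprox_eq_zero lam hΩ (hΩ.isOpen.frontier_eq ▸ hx).2

variable [NeZero d] {κ : ℝ} (hu : 𝒯.IsUniform κ) {T : Finset (Pt d)}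
include hu

theorem sq_val_U_sub_nodal_vertex_le (hT : T ∈ 𝒯.cells) {x v : Pt d} (hx : x ∈ hull T)
    (hv : v ∈ T) :
    (val (S.U lam T) x - S.nodal lam v) ^ 2 ≤
      interpolationConst d k κ * (S.starIndicator lam v / 𝒯.h ^ d) := by
  have h_pos := hu.h_pos
  have oscillationConst_pos := oscillationConst_pos d k hu.κ_pos
  have hT_star : T ∈ 𝒯.star v := 𝒯.mem_star.2 ⟨hT, mem_hull_of_mem hv⟩
  have oscillation_le : (val (S.U lam T) x - val (S.U lam T) v) ^ 2 ≤
      oscillationConst d k κ * (S.starIndicator lam v / 𝒯.h ^ d) := by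
    refine (S.sq_sub_val_U_le hu lam hT hx (mem_hull_of_mem hv)).trans ?_
    gcongr
    exact S.errorIndicator_le_starIndicator lam hT_star
  rw [← sub_add_sub_cancel _ (val (S.U lam T) v), interpolationConst]
  refine (add_sq_le (a := val (S.U lam T) x - val (S.U lam T) v)).trans ?_
  linarith [S.sq_val_U_sub_nodal_le lam hu hΩ hT_star]

theorem sq_val_U_sub_conformingApprox_le (hT : T ∈ 𝒯.cells) {x : Pt d} (hx : x ∈ hull T) :
    (val (S.U lam T) x - S.conformingApprox lam x) ^ 2 ≤
      interpolationConst d k κ * ((∑ v ∈ T, S.starIndicator lam v) / 𝒯.h ^ d) := by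
  rw [conformingApprox, 𝒯.interpolate_eq _ hT hx, Finset.sum_div, Finset.mul_sum]
  exact ((𝒯.isSimplex hT).sq_sub_linInterp_le _ _ hx).trans (Finset.sum_le_sum fun v hv =>
    S.sq_val_U_sub_nodal_vertex_le lam hΩ hu hT hx hv)

variable {mu : 𝒯.M p}
  (hmu : (mu : Finset (Pt d) → Pt d → ℝ) = 𝒯.trace (S.conformingApprox lam))
include hmu

theorem bdryIntegral_sub_sq_le (hT : T ∈ 𝒯.cells) :
    bdryIntegral T (fun F x => ((lam - mu : 𝒯.M p) : Finset (Pt d) → Pt d → ℝ) F x ^ 2) ≤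
      2 * bdryIntegral T (fun _ _ =>
          interpolationConst d k κ * ((∑ v ∈ T, S.starIndicator lam v) / 𝒯.h ^ d)) +
        2 * bdryIntegral T (fun F x => S.jump lam T F x ^ 2) := by
  have jump_continuousOn : BdryCont T fun F x => S.jump lam T F x ^ 2 :=
    fun F hF => (S.jump_continuousOn lam hT hF).pow 2
  have const_continuousOn (A : ℝ) : BdryCont T fun _ _ => A := fun _ _ => continuousOn_const
  rw [← bdryIntegral_eq_linear_comb (𝒯.isSimplex hT) (const_continuousOn _) jump_continuousOn
    fun _ _ _ _ => rfl]
  refine bdryIntegral_mono (𝒯.isSimplex hT) (fun F hF => (𝒯.M_continuousOn _ hT hF).pow 2)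
    (fun F hF => continuousOn_const.add (continuousOn_const.mul (jump_continuousOn F hF)))
    fun F hF x hx => ?_
  have sub_eq : ((lam - mu : 𝒯.M p) : Finset (Pt d) → Pt d → ℝ) F x =
      (val (S.U lam T) x - S.conformingApprox lam x) + -S.jump lam T F x := by
    rw [Method.jump, Submodule.coe_sub, Pi.sub_apply, Pi.sub_apply, hmu, 𝒯.trace_apply _ hT hF hx]
    ring
  have approx_le := S.sq_val_U_sub_conformingApprox_le lam hΩ hu hT (hull_mono (facet_subset hF) hx)
  rw [sub_eq, ← neg_sq (S.jump lam T F x)]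
  exact add_sq_le.trans (by linarith)

theorem volRatio_mul_bdryIntegral_sub_sq_le (hT : T ∈ 𝒯.cells) :
    volRatio T *
        bdryIntegral T (fun F x => ((lam - mu : 𝒯.M p) : Finset (Pt d) → Pt d → ℝ) F x ^ 2) ≤
      2 * (ballVol d * interpolationConst d k κ * ∑ v ∈ T, S.starIndicator lam v) +
        2 * S.errorIndicator lam T := by
  have h_pos := hu.h_pos
  have interpolationConst_pos := interpolationConst_pos d k hu.κ_pos
  set A := interpolationConst d k κ * ((∑ v ∈ T, S.starIndicator lam v) / 𝒯.h ^ d) with hA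
  have A_nonneg : 0 ≤ A := mul_nonneg interpolationConst_pos.le
    (div_nonneg (Finset.sum_nonneg fun v _ => S.starIndicator_nonneg lam v) (pow_pos h_pos d).le)
  have volume_mul_le : volume.real (hull T) * A ≤
      ballVol d * interpolationConst d k κ * ∑ v ∈ T, S.starIndicator lam v :=
    (mul_le_mul_of_nonneg_right (𝒯.volume_real_hull_le hT) A_nonneg).trans_eq
      (by rw [hA]; field_simp)
  calc volRatio T *
        bdryIntegral T (fun F x => ((lam - mu : 𝒯.M p) : Finset (Pt d) → Pt d → ℝ) F x ^ 2)
      ≤ volRatio T * (2 * bdryIntegral T (fun _ _ => A) +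
          2 * bdryIntegral T (fun F x => S.jump lam T F x ^ 2)) :=
        mul_le_mul_of_nonneg_left (S.bdryIntegral_sub_sq_le lam hΩ hu hmu hT)
          (𝒯.isSimplex hT).volRatio_pos.le
    _ = 2 * (volume.real (hull T) * A) +
          2 * (volRatio T * bdryIntegral T (fun F x => S.jump lam T F x ^ 2)) := by
        rw [← (𝒯.isSimplex hT).volRatio_mul_bdryIntegral_const]
        ring
    _ ≤ 2 * (ballVol d * interpolationConst d k κ * ∑ v ∈ T, S.starIndicator lam v) +
          2 * S.errorIndicator lam T := by
        linarith [S.volRatio_mul_bdryIntegral_jump_sq_le_errorIndicator lam T]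

theorem normM_sub_sq_le :
    normM (lam - mu) ^ 2 ≤ (2 * (ballVol d * interpolationConst d k κ * ((d + 1) * κ ^ d)) + 2) *
      ∑ T ∈ 𝒯.cells, S.errorIndicator lam T := by
  have const_pos : 0 < ballVol d * interpolationConst d k κ :=
    mul_pos (ballVol_pos d) (interpolationConst_pos d k hu.κ_pos)
  rw [normM, 𝒯.skelNorm_sq]
  refine (Finset.sum_le_sum fun T hT =>
    S.volRatio_mul_bdryIntegral_sub_sq_le lam hΩ hu hmu hT).trans ?_
  rw [Finset.sum_add_distrib, ← Finset.mul_sum, ← Finset.mul_sum, ← Finset.mul_sum]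
  have star_le : ∑ T ∈ 𝒯.cells, ∑ v ∈ T, S.starIndicator lam v ≤
      (d + 1) * κ ^ d * ∑ T ∈ 𝒯.cells, S.errorIndicator lam T :=
    hu.sum_vertices_sum_star_le fun _ hT => S.errorIndicator_nonneg lam hT
  linarith [mul_le_mul_of_nonneg_left star_le const_pos.le]

theorem normM_sub_le {c1 c3 : ℝ} (h1 : S.LS1 c1) (h3 : S.LS3 c3) :
    normM (lam - mu) ≤ approxConst d k κ c1 c3 * (𝒯.h * S.normQ lam) := by
  have κ_pos := hu.κ_pos
  have ballVol_pos := ballVol_pos d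
  have interpolationConst_pos := interpolationConst_pos d k κ_pos
  refine abs_le_of_sq_le_sq' ?_ (mul_nonneg (approxConst_pos d k κ_pos c1 c3).le
    (mul_nonneg hu.h_pos.le (S.normQ_nonneg lam))) |>.2
  rw [approxConst, mul_pow (√_), Real.sq_sqrt (by positivity), mul_assoc]
  exact (S.normM_sub_sq_le lam hΩ hu hmu).trans
    (mul_le_mul_of_nonneg_left (h3.sum_errorIndicator_le h1 hΩ lam) (by positivity))

end Method

/-! ### Definiteness and the energy norm -/

section Skeletal

variable {Ω : Set (Pt d)} {𝒯 : SimplicialMesh d Ω} {p k : ℕ}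

theorem eqOn_hull_zero_of_normM_eq_zero [NeZero d] {lam : 𝒯.M p} (h : normM lam = 0)
    {T F : Finset (Pt d)} (hT : T ∈ 𝒯.cells) (hF : F ∈ facets T) :
    Set.EqOn ((lam : Finset (Pt d) → Pt d → ℝ) F) 0 (hull F) := by
  have sum_eq_zero := 𝒯.skelNorm_sq fun _ F x => (lam : Finset (Pt d) → Pt d → ℝ) F x
  rw [← normM, h, zero_pow two_ne_zero, eq_comm, Finset.sum_eq_zero_iff_of_nonneg
    fun T hT => 𝒯.volRatio_mul_bdryIntegral_sq_nonneg hT _] at sum_eq_zero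
  have bdryIntegral_eq_zero := (mul_eq_zero.1 (sum_eq_zero T hT)).resolve_left
    (𝒯.isSimplex hT).volRatio_pos.ne'
  rw [bdryIntegral, Finset.sum_eq_zero_iff_of_nonneg
    fun F _ => integral_nonneg fun _ => sq_nonneg _] at bdryIntegral_eq_zero
  exact fun x hx => pow_eq_zero_iff two_ne_zero |>.1 <|
    eq_zero_of_face_integral_eq_zero (𝒯.isSimplex hT) hF ((𝒯.M_continuousOn lam hT hF).pow 2)
      (fun _ _ => sq_nonneg _) (bdryIntegral_eq_zero F hF) hx

theorem eq_zero_of_normM_eq_zero [NeZero d] {lam : 𝒯.M p} (h : normM lam = 0) : lam = 0 := by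
  refine Subtype.ext (funext fun F => ?_)
  by_cases hF : 𝒯.IsFace F
  · obtain ⟨P, -, indicator_eq⟩ := lam.2.1 F hF
    obtain ⟨T, hT, hFT⟩ := hF
    have eqOn_zero := eqOn_hull_zero_of_normM_eq_zero h hT hFT
    rw [indicator_eq] at eqOn_zero ⊢
    exact Set.indicator_eq_zero'.2 (Set.disjoint_left.2 fun x hx hxF =>
      hx (by simpa only [Set.indicator_of_mem hxF, Pi.zero_apply] using eqOn_zero hxF))
  · exact lam.2.2.2 F hF

/-- Restriction of polynomials to the face `F`, extended by zero off `F` as in the skeletal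
spaces. -/
def faceRestrict (F : Finset (Pt d)) : Poly d →ₗ[ℝ] Pt d → ℝ where
  toFun P := (hull F).indicator (val P)
  map_add' P R := by
    rw [← Set.indicator_add']
    exact congrArg _ (funext fun x => val_add P R x)
  map_smul' c P :=
    (congrArg _ (funext fun x => val_smul c P x)).trans (Set.indicator_const_smul (hull F) c _)

theorem finiteDimensional_M : FiniteDimensional ℝ (𝒯.M p) := by
  classical
  let N (F : 𝒯.cells.biUnion facets) : Submodule ℝ (Pt d → ℝ) :=
    (PolyDeg d p).map (faceRestrict (F : Finset (Pt d)))
  have isFace_iff (F : Finset (Pt d)) : 𝒯.IsFace F ↔ F ∈ 𝒯.cells.biUnion facets := by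
    rw [Finset.mem_biUnion]
    rfl
  let toFaces : 𝒯.M p →ₗ[ℝ] (∀ F, N F) := LinearMap.pi fun F =>
    ((LinearMap.proj (F : Finset (Pt d))).comp (𝒯.M p).subtype).codRestrict (N F) fun lam => by
      obtain ⟨P, hP, indicator_eq⟩ := lam.2.1 F ((isFace_iff F).2 F.2)
      exact ⟨P, hP, indicator_eq.symm⟩
  refine FiniteDimensional.of_injective toFaces fun a b hab => Subtype.ext (funext fun F => ?_)
  by_cases hF : 𝒯.IsFace F
  · exact congrArg Subtype.val (congrFun hab ⟨F, (isFace_iff F).1 hF⟩)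
  · rw [a.2.2.2 F hF, b.2.2.2 F hF]

theorem IsLipschitzDomain.frontier_nonempty [NeZero d] (hΩ : IsLipschitzDomain Ω) :
    (frontier Ω).Nonempty := by
  have : Nonempty (Fin d) := ⟨0⟩
  exact nonempty_frontier_iff.2 ⟨hΩ.isConnected.nonempty,
    fun h => NormedSpace.unbounded_univ ℝ (Pt d) (h ▸ hΩ.isBounded)⟩

theorem eq_zero_of_forall_eq_const_on_cells [NeZero d] (hΩ : IsLipschitzDomain Ω) {w : Pt d → ℝ}
    (hw : Continuous w) (hw_frontier : ∀ x ∈ frontier Ω, w x = 0)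
    (hw_const : ∀ T ∈ 𝒯.cells, ∃ c, ∀ x ∈ hull T, w x = c) {x : Pt d} (hx : x ∈ closure Ω) :
    w x = 0 := by
  have finite_image : (w '' closure Ω).Finite := by
    choose! c hc using hw_const
    refine (𝒯.cells.finite_toSet.image c).subset ?_
    rintro _ ⟨x, hx, rfl⟩
    obtain ⟨T, hT, hxT⟩ := 𝒯.exists_cell hx
    exact ⟨T, hT, (hc T hT x hxT).symm⟩
  have image_subsingleton : (w '' closure Ω).Subsingleton :=
    finite_image.countable.isTotallyDisconnected _ subset_rfl
      (hΩ.isConnected.isPreconnected.closure.image w hw.continuousOn)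
  obtain ⟨y, hy⟩ := hΩ.frontier_nonempty
  rw [← hw_frontier y hy]
  exact image_subsingleton (Set.mem_image_of_mem w hx)
    (Set.mem_image_of_mem w (frontier_subset_closure hy))

namespace Method

variable (S : Method 𝒯 p k)

theorem vecVal_Q_eq_zero (hΩ : IsLipschitzDomain Ω) {lam : 𝒯.M p} (h : S.normQ lam = 0)
    {T : Finset (Pt d)} (hT : T ∈ 𝒯.cells) {x : Pt d} (hx : x ∈ interior (hull T)) :
    vecVal (S.Q lam T) x = 0 := by
  have sum_eq_zero := S.normQ_sq hΩ lam
  rw [h, zero_pow two_ne_zero, eq_comm, Finset.sum_eq_zero_iff_of_nonneg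
    fun T _ => integral_nonneg fun _ => by positivity] at sum_eq_zero
  have continuous_sq : Continuous fun x => ‖vecVal (S.Q lam T) x‖ ^ 2 :=
    (continuous_vecVal _).norm.pow 2
  have ae_eq_zero := (setIntegral_eq_zero_iff_of_nonneg_ae
    (Eventually.of_forall fun _ => by positivity)
    (integrableOn_hull continuous_sq.continuousOn)).1 (sum_eq_zero T hT)
  have sq_eq_zero := Measure.eqOn_open_of_ae_eq
    (ae_restrict_of_ae_restrict_of_subset interior_subset ae_eq_zero) isOpen_interior
    continuous_sq.continuousOn continuousOn_const hx
  simpa using sq_eq_zero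

theorem exists_eq_const_of_normQ_eq_zero (hΩ : IsLipschitzDomain Ω) (h4 : S.LS4) {w : Pt d → ℝ}
    {mu : 𝒯.M p} (hw : 𝒯.ConformingP1 w) (hw_cont : Continuous w)
    (hmu : (mu : Finset (Pt d) → Pt d → ℝ) = 𝒯.trace w) (h : S.normQ mu = 0)
    {T : Finset (Pt d)} (hT : T ∈ 𝒯.cells) : ∃ c, ∀ x ∈ hull T, w x = c := by
  obtain ⟨P, hP, hP_eq⟩ := hw.2 T hT
  obtain ⟨f, hf⟩ := exists_affineMap_of_mem_polyDeg_one hP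
  have differentiableOn_w : DifferentiableOn ℝ w (interior (hull T)) := by
    let g : Pt d →ᴬ[ℝ] ℝ := ⟨f, f.continuous_of_finiteDimensional⟩
    exact g.differentiable.differentiableOn.congr fun x hx =>
      (hP_eq x (interior_subset hx)).trans (hf x)
  have fderiv_eq_zero : (interior (hull T)).EqOn (fderiv ℝ w) 0 := fun x hx => by
    have Q_eq := (h4 w hw mu hmu T hT).1 x hx
    rw [S.vecVal_Q_eq_zero hΩ h hT hx, zero_eq_neg, gradient] at Q_eq
    simpa using Q_eq
  obtain ⟨c, hc⟩ := isOpen_interior.exists_is_const_of_fderiv_eq_zero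
    (convex_convexHull ℝ (T : Set (Pt d))).interior.isPreconnected differentiableOn_w fderiv_eq_zero
  refine ⟨c, fun x hx => ?_⟩
  rw [← (𝒯.isSimplex hT).closure_interior] at hx
  exact closure_minimal (t := {y | w y = c}) (fun y hy => hc y hy)
    (isClosed_eq hw_cont continuous_const) hx

theorem eq_zero_of_normQ_eq_zero [NeZero d] (hp : 1 ≤ p) (hΩ : IsLipschitzDomain Ω) {κ : ℝ}
    (hu : 𝒯.IsUniform κ) {c1 c3 : ℝ} (h1 : S.LS1 c1) (h3 : S.LS3 c3) (h4 : S.LS4) {lam : 𝒯.M p}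
    (h : S.normQ lam = 0) : lam = 0 := by
  let w := S.conformingApprox lam
  let mu : 𝒯.M p := ⟨𝒯.trace w, S.trace_conformingApprox_mem_M lam hΩ hp⟩
  have lam_eq_mu : lam = mu := by
    have normM_le := S.normM_sub_le lam hΩ hu (mu := mu) rfl h1 h3
    rw [h, mul_zero, mul_zero] at normM_le
    exact sub_eq_zero.1 (eq_zero_of_normM_eq_zero (normM_le.antisymm (normM_nonneg _)))
  have w_eq_zero : w = 0 := funext fun x => by
    by_cases hx : x ∈ closure Ω
    · exact eq_zero_of_forall_eq_const_on_cells hΩ (S.continuous_conformingApprox lam hΩ)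
        (fun y hy => S.conformingApprox_eq_zero lam hΩ (hΩ.isOpen.frontier_eq ▸ hy).2)
        (fun T hT => S.exists_eq_const_of_normQ_eq_zero hΩ h4
          (S.conformingP1_conformingApprox lam hΩ) (S.continuous_conformingApprox lam hΩ)
          (mu := mu) rfl (lam_eq_mu ▸ h) hT) hx
    · exact S.conformingApprox_eq_zero lam hΩ fun hxΩ => hx (subset_closure hxΩ)
  refine lam_eq_mu.trans (Subtype.ext (funext fun F => ?_))
  simp [mu, w_eq_zero, SimplicialMesh.trace]

theorem a_self_nonneg (hΩ : IsLipschitzDomain Ω) (lam : 𝒯.M p) : 0 ≤ S.a lam lam :=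
  (sq_nonneg _).trans (S.normQ_sq_le_a hΩ lam)

theorem eq_zero_of_a_self_eq_zero [NeZero d] (hp : 1 ≤ p) (hΩ : IsLipschitzDomain Ω) {κ : ℝ}
    (hu : 𝒯.IsUniform κ) {c1 c3 : ℝ} (h1 : S.LS1 c1) (h3 : S.LS3 c3) (h4 : S.LS4) {lam : 𝒯.M p}
    (h : S.a lam lam = 0) : lam = 0 :=
  S.eq_zero_of_normQ_eq_zero hp hΩ hu h1 h3 h4 <| pow_eq_zero_iff two_ne_zero |>.1 <|
    (h ▸ S.normQ_sq_le_a hΩ lam).antisymm (sq_nonneg _)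

theorem mul_sum_bdryIntegral_jump_sq_le [NeZero d] {κ : ℝ} (hu : 𝒯.IsUniform κ) {c1 : ℝ}
    (h1 : S.LS1 c1) (lam : 𝒯.M p) :
    volRatioConst d κ * ∑ T ∈ 𝒯.cells, bdryIntegral T (fun F x => S.jump lam T F x ^ 2) ≤
      c1 ^ 2 * 𝒯.h * S.normQ lam ^ 2 := by
  refine le_of_mul_le_mul_left ?_ hu.h_pos
  calc 𝒯.h * (volRatioConst d κ *
          ∑ T ∈ 𝒯.cells, bdryIntegral T (fun F x => S.jump lam T F x ^ 2))
      ≤ 𝒯.skelNorm (S.jump lam) ^ 2 := by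
        rw [𝒯.skelNorm_sq, ← mul_assoc, Finset.mul_sum]
        exact Finset.sum_le_sum fun T hT =>
          mul_le_mul_of_nonneg_right (hu.mul_volRatioConst_le_volRatio hT)
            (bdryIntegral_nonneg fun _ _ _ _ => sq_nonneg _)
    _ ≤ (c1 * 𝒯.h * S.normQ lam) ^ 2 := pow_le_pow_left₀ (𝒯.skelNorm_nonneg _) (h1 lam) 2
    _ = 𝒯.h * (c1 ^ 2 * 𝒯.h * S.normQ lam ^ 2) := by ring

end Method

/-- The constant in the bound of the condensed form by `‖𝒬 λ‖₀²`. -/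
def energyConst (d : ℕ) (κ c1 cτ : ℝ) : ℝ := 1 + |cτ| * c1 ^ 2 / volRatioConst d κ

theorem energyConst_pos (d : ℕ) {κ : ℝ} (hκ : 0 < κ) (c1 cτ : ℝ) : 0 < energyConst d κ c1 cτ := by
  have := volRatioConst_pos d hκ
  unfold energyConst
  positivity

theorem Method.a_self_le [NeZero d] (S : Method 𝒯 p k) (hΩ : IsLipschitzDomain Ω) {κ : ℝ}
    (hu : 𝒯.IsUniform κ) {c1 cτ : ℝ} (h1 : S.LS1 c1) (hτ : S.τ * 𝒯.h ≤ cτ) (lam : 𝒯.M p) :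
    S.a lam lam ≤ energyConst d κ c1 cτ * S.normQ lam ^ 2 := by
  have volRatioConst_pos := volRatioConst_pos d hu.κ_pos
  have penalty_le : S.τ * ∑ T ∈ 𝒯.cells, bdryIntegral T (fun F x => S.jump lam T F x ^ 2) ≤
      |cτ| * c1 ^ 2 / volRatioConst d κ * S.normQ lam ^ 2 := by
    calc S.τ * ∑ T ∈ 𝒯.cells, bdryIntegral T (fun F x => S.jump lam T F x ^ 2)
        ≤ S.τ * (c1 ^ 2 * 𝒯.h * S.normQ lam ^ 2 / volRatioConst d κ) :=
          mul_le_mul_of_nonneg_left ((le_div_iff₀' volRatioConst_pos).2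
            (S.mul_sum_bdryIntegral_jump_sq_le hu h1 lam)) S.τ_nonneg
      _ = S.τ * 𝒯.h * (c1 ^ 2 / volRatioConst d κ * S.normQ lam ^ 2) := by ring
      _ ≤ |cτ| * (c1 ^ 2 / volRatioConst d κ * S.normQ lam ^ 2) :=
          mul_le_mul_of_nonneg_right (hτ.trans (le_abs_self _)) (by positivity)
      _ = |cτ| * c1 ^ 2 / volRatioConst d κ * S.normQ lam ^ 2 := by ring
  rw [S.a_self hΩ, energyConst, one_add_mul]
  exact add_le_add_right penalty_le _

end Skeletal

/-! ### Two levels -/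

section TwoLevel

variable {Ω : Set (Pt d)} {𝒯 𝒯c 𝒯f : SimplicialMesh d Ω} {p k : ℕ}

theorem existsUnique_isRitz [NeZero d] (Sc : Method 𝒯c p k) (Sf : Method 𝒯f p k)
    (I : 𝒯c.M p →ₗ[ℝ] 𝒯f.M p) (hΩ : IsLipschitzDomain Ω)
    (a_definite : ∀ lam : 𝒯c.M p, Sc.a lam lam = 0 → lam = 0) :
    ∃! P : 𝒯f.M p →ₗ[ℝ] 𝒯c.M p, IsRitz Sc Sf I P := by
  have := finiteDimensional_M (𝒯 := 𝒯c) (p := p)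
  have aForm_injective : Function.Injective (Sc.aForm hΩ) :=
    (injective_iff_map_eq_zero _).2 fun lam h => a_definite lam (congrArg (fun g => g lam) h)
  let riesz : 𝒯c.M p ≃ₗ[ℝ] (𝒯c.M p →ₗ[ℝ] ℝ) :=
    (Sc.aForm hΩ).linearEquivOfInjective aForm_injective Subspace.dual_finrank_eq.symm
  have isRitz_iff (P : 𝒯f.M p →ₗ[ℝ] 𝒯c.M p) :
      IsRitz Sc Sf I P ↔ ∀ lam, riesz (P lam) = (Sf.aForm hΩ).compl₂ I lam :=
    forall_congr' fun lam =>
      (LinearMap.ext_iff (f := riesz (P lam)) (g := (Sf.aForm hΩ).compl₂ I lam)).symm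
  refine ⟨riesz.symm.toLinearMap ∘ₗ (Sf.aForm hΩ).compl₂ I,
    (isRitz_iff _).2 fun _ => riesz.apply_symm_apply _, fun P hP => ?_⟩
  exact LinearMap.ext fun lam => riesz.eq_symm_apply.2 ((isRitz_iff P).1 hP lam)

theorem Method.LS2.normQ_le_of_normM_le {S : Method 𝒯 p k} {c B : ℝ} (h2 : S.LS2 c)
    (h_pos : 0 < 𝒯.h) {mu : 𝒯.M p} (hmu : normM mu ≤ 𝒯.h * B) : S.normQ mu ≤ |c| * B := by
  calc S.normQ mu ≤ c * 𝒯.h⁻¹ * normM mu := (h2 mu).1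
    _ ≤ |c| * 𝒯.h⁻¹ * (𝒯.h * B) := by
        have := normM_nonneg mu
        gcongr
        exact le_abs_self c
    _ = |c| * B := by field_simp

theorem Method.LS2.l2norm_U_le {S : Method 𝒯 p k} {c : ℝ} (h2 : S.LS2 c) (mu : 𝒯.M p) :
    l2norm Ω (𝒯.fn (S.U mu)) ≤ |c| * normM mu :=
  (h2 mu).2.trans (mul_le_mul_of_nonneg_right (le_abs_self c) (normM_nonneg mu))

theorem IA1.normM_le {I : 𝒯c.M p →ₗ[ℝ] 𝒯f.M p} {c : ℝ} (hI : IA1 I c) (lam : 𝒯c.M p) :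
    normM (I lam) ≤ |c| * normM lam :=
  (hI lam).trans (mul_le_mul_of_nonneg_right (le_abs_self c) (normM_nonneg lam))

/-- The constant in the bound of `‖𝒬 I λ‖₀` by `‖𝒬 λ‖₀`, where `A` is the constant in the
approximation of `λ` by traces of conforming functions. -/
def stabilityConst (A cref cI c2 : ℝ) : ℝ := 1 + |c2| * A + |c2| * |cI| * A / cref

/-- The constant in the bound of `𝒰 λ - 𝒰 I λ` by `h ‖𝒬 λ‖₀` on the coarse level, with `A` as in
`stabilityConst`. -/
def solverConst (A cI c2 : ℝ) : ℝ := |c2| * (1 + |cI|) * A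

namespace Method

variable {S : Method 𝒯 p k} {Sc : Method 𝒯c p k} {Sf : Method 𝒯f p k} {I : 𝒯c.M p →ₗ[ℝ] 𝒯f.M p}
  {w : Pt d → ℝ}

theorem LS4.vecFn_Q_ae_eq (h4 : S.LS4) (hw : 𝒯.ConformingP1 w) {mu : 𝒯.M p}
    (hmu : (mu : Finset (Pt d) → Pt d → ℝ) = 𝒯.trace w) :
    𝒯.vecFn (S.Q mu) =ᵐ[volume.restrict Ω] fun x => -∇ w x := by
  filter_upwards [𝒯.ae_mem_interior] with x ⟨T, hT, hx⟩
  rw [𝒯.vecFn_eq _ hT hx, (h4 w hw mu hmu T hT).1 x hx]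

theorem LS4.fn_U_ae_eq (h4 : S.LS4) (hw : 𝒯.ConformingP1 w) {mu : 𝒯.M p}
    (hmu : (mu : Finset (Pt d) → Pt d → ℝ) = 𝒯.trace w) :
    𝒯.fn (S.U mu) =ᵐ[volume.restrict Ω] w := by
  filter_upwards [𝒯.ae_mem_interior] with x ⟨T, hT, hx⟩
  rw [𝒯.fn_eq _ hT hx, (h4 w hw mu hmu T hT).2 x (interior_subset hx)]

theorem LS4.normQ_eq (h4 : S.LS4) (hw : 𝒯.ConformingP1 w) {mu : 𝒯.M p}
    (hmu : (mu : Finset (Pt d) → Pt d → ℝ) = 𝒯.trace w) :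
    S.normQ mu = l2norm Ω fun x => -∇ w x :=
  l2norm_congr (h4.vecFn_Q_ae_eq hw hmu)

theorem normQ_injection_conforming (hr : 𝒯c.IsRefinedBy 𝒯f) (hI2 : IA2 I) (h4c : Sc.LS4)
    (h4f : Sf.LS4) (hw : 𝒯c.ConformingP1 w) {mu : 𝒯c.M p}
    (hmu : (mu : Finset (Pt d) → Pt d → ℝ) = 𝒯c.trace w) : Sf.normQ (I mu) = Sc.normQ mu := by
  rw [h4c.normQ_eq hw hmu, h4f.normQ_eq (hw.of_isRefinedBy hr) (hI2 w hw mu hmu)]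

variable [NeZero d] {A cref cI c2 : ℝ} {lam mu : 𝒯c.M p}

theorem normQ_injection_le (hA : 0 ≤ A) (hcref : 0 < cref) (hc_pos : 0 < 𝒯c.h) (hf_pos : 0 < 𝒯f.h)
    (hh : cref * 𝒯c.h ≤ 𝒯f.h) (hI1 : IA1 I cI) (h2c : Sc.LS2 c2) (h2f : Sf.LS2 c2)
    (hmu : Sf.normQ (I mu) = Sc.normQ mu)
    (hlam : normM (lam - mu) ≤ A * (𝒯c.h * Sc.normQ lam)) :
    Sf.normQ (I lam) ≤ stabilityConst A cref cI c2 * Sc.normQ lam := by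
  have normQ_nonneg := Sc.normQ_nonneg lam
  have coarse_le : Sc.normQ (lam - mu) ≤ |c2| * (A * Sc.normQ lam) :=
    h2c.normQ_le_of_normM_le hc_pos (hlam.trans_eq (by ring))
  have fine_le : Sf.normQ (I (lam - mu)) ≤ |c2| * (|cI| * (A * Sc.normQ lam) / cref) := by
    refine h2f.normQ_le_of_normM_le hf_pos ?_
    calc normM (I (lam - mu)) ≤ |cI| * (A * (𝒯c.h * Sc.normQ lam)) :=
          (hI1.normM_le _).trans (mul_le_mul_of_nonneg_left hlam (abs_nonneg cI))
      _ = cref * 𝒯c.h * (|cI| * (A * Sc.normQ lam) / cref) := by field_simp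
      _ ≤ 𝒯f.h * (|cI| * (A * Sc.normQ lam) / cref) := by gcongr
  calc Sf.normQ (I lam) = Sf.normQ (I (lam - mu) + I mu) := by rw [← map_add, sub_add_cancel]
    _ ≤ Sf.normQ (I (lam - mu)) + Sc.normQ mu := hmu ▸ Sf.normQ_add_le _ _
    _ = Sf.normQ (I (lam - mu)) + Sc.normQ (lam + -(lam - mu)) := by
        rw [← sub_eq_add_neg, sub_sub_cancel]
    _ ≤ Sf.normQ (I (lam - mu)) + (Sc.normQ lam + Sc.normQ (lam - mu)) :=
        add_le_add_right (Sc.normQ_neg (lam - mu) ▸ Sc.normQ_add_le _ _) _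
    _ ≤ stabilityConst A cref cI c2 * Sc.normQ lam := by
        unfold stabilityConst
        linear_combination fine_le + coarse_le

theorem fn_U_sub_ae_eq (hU : 𝒯c.fn (Sc.U mu) =ᵐ[volume.restrict Ω] 𝒯f.fn (Sf.U (I mu))) :
    (fun x => 𝒯c.fn (Sc.U lam) x - 𝒯f.fn (Sf.U (I lam)) x) =ᵐ[volume.restrict Ω]
      𝒯c.fn (Sc.U (lam - mu)) - 𝒯f.fn (Sf.U (I (lam - mu))) := by
  have coarse_add := Sc.fn_U_add (lam - mu) mu
  have fine_add := Sf.fn_U_add (I (lam - mu)) (I mu)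
  rw [sub_add_cancel] at coarse_add
  rw [← map_add, sub_add_cancel] at fine_add
  filter_upwards [coarse_add, fine_add, hU] with x coarse_eq fine_eq mu_eq
  rw [coarse_eq, fine_eq, Pi.add_apply, Pi.add_apply, Pi.sub_apply, mu_eq, add_sub_add_right_eq_sub]

theorem l2norm_fn_U_sub_le (hI1 : IA1 I cI) (h2c : Sc.LS2 c2) (h2f : Sf.LS2 c2)
    (hU : 𝒯c.fn (Sc.U mu) =ᵐ[volume.restrict Ω] 𝒯f.fn (Sf.U (I mu)))
    (hlam : normM (lam - mu) ≤ A * (𝒯c.h * Sc.normQ lam)) :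
    l2norm Ω (fun x => 𝒯c.fn (Sc.U lam) x - 𝒯f.fn (Sf.U (I lam)) x) ≤
      solverConst A cI c2 * 𝒯c.h * Sc.normQ lam := by
  rw [l2norm_congr (fn_U_sub_ae_eq hU)]
  calc l2norm Ω (𝒯c.fn (Sc.U (lam - mu)) - 𝒯f.fn (Sf.U (I (lam - mu))))
      ≤ |c2| * normM (lam - mu) + |c2| * (|cI| * normM (lam - mu)) :=
        (l2norm_sub_le (𝒯c.memLp_fn _) (𝒯f.memLp_fn _)).trans <| add_le_add
          (h2c.l2norm_U_le _) ((h2f.l2norm_U_le _).trans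
            (mul_le_mul_of_nonneg_left (hI1.normM_le _) (abs_nonneg c2)))
    _ = |c2| * (1 + |cI|) * normM (lam - mu) := by ring
    _ ≤ |c2| * (1 + |cI|) * (A * (𝒯c.h * Sc.normQ lam)) := by gcongr
    _ = solverConst A cI c2 * 𝒯c.h * Sc.normQ lam := by rw [solverConst]; ring

end Method

/-- A common constant for the stability of the injection in `𝒬` and its approximation property in
`𝒰` on both levels, with `A` as in `stabilityConst`. -/
def injectionConst (A cref cI c2 : ℝ) : ℝ :=
  stabilityConst A cref cI c2 + (solverConst A cI c2 + solverConst A cI c2 / cref)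

theorem injectionConst_pos {A cref : ℝ} (hA : 0 ≤ A) (hcref : 0 < cref) (cI c2 : ℝ) :
    0 < injectionConst A cref cI c2 := by
  unfold injectionConst stabilityConst solverConst
  positivity

namespace Method

variable [NeZero d] {Sc : Method 𝒯c p k} {Sf : Method 𝒯f p k} {I : 𝒯c.M p →ₗ[ℝ] 𝒯f.M p}

theorem injection_bounds (hp : 1 ≤ p) (hΩ : IsLipschitzDomain Ω) {κ : ℝ} (huc : 𝒯c.IsUniform κ)
    (huf : 𝒯f.IsUniform κ) (hr : 𝒯c.IsRefinedBy 𝒯f) {cref : ℝ} (hcref : 0 < cref)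
    (hh : cref * 𝒯c.h ≤ 𝒯f.h) {cI c1 c2 c3 : ℝ} (hI1 : IA1 I cI) (hI2 : IA2 I) (h1 : Sc.LS1 c1)
    (h3 : Sc.LS3 c3) (h2c : Sc.LS2 c2) (h2f : Sf.LS2 c2) (h4c : Sc.LS4) (h4f : Sf.LS4)
    (lam : 𝒯c.M p) :
    let C := injectionConst (approxConst d k κ c1 c3) cref cI c2
    let δU := fun x => 𝒯c.fn (Sc.U lam) x - 𝒯f.fn (Sf.U (I lam)) x
    Sf.normQ (I lam) ≤ C * Sc.normQ lam ∧ l2norm Ω δU ≤ C * 𝒯c.h * Sc.normQ lam ∧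
      l2norm Ω δU ≤ C * 𝒯f.h * Sc.normQ lam := by
  intro C δU
  let A := approxConst d k κ c1 c3
  let mu : 𝒯c.M p := ⟨𝒯c.trace (Sc.conformingApprox lam), Sc.trace_conformingApprox_mem_M lam hΩ hp⟩
  have hw := Sc.conformingP1_conformingApprox lam hΩ
  have hlam : normM (lam - mu) ≤ A * (𝒯c.h * Sc.normQ lam) :=
    Sc.normM_sub_le lam hΩ huc (mu := mu) rfl h1 h3
  have A_pos : 0 < A := approxConst_pos d k huc.κ_pos c1 c3
  have normQ_nonneg := Sc.normQ_nonneg lam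
  have normQ_le := normQ_injection_le A_pos.le hcref huc.h_pos huf.h_pos hh hI1 h2c h2f
    (normQ_injection_conforming hr hI2 h4c h4f hw rfl) hlam
  have l2norm_le : l2norm Ω δU ≤ solverConst A cI c2 * 𝒯c.h * Sc.normQ lam :=
    l2norm_fn_U_sub_le hI1 h2c h2f ((h4c.fn_U_ae_eq hw rfl).trans
      (h4f.fn_U_ae_eq (hw.of_isRefinedBy hr) (hI2 _ hw mu rfl)).symm) hlam
  have stabilityConst_nonneg : 0 ≤ stabilityConst A cref cI c2 := by
    unfold stabilityConst; positivity
  have solverConst_nonneg : 0 ≤ solverConst A cI c2 := by unfold solverConst; positivity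
  have solverConst_div_nonneg := div_nonneg solverConst_nonneg hcref.le
  have C_eq : C = stabilityConst A cref cI c2 +
    (solverConst A cI c2 + solverConst A cI c2 / cref) := rfl
  refine ⟨normQ_le.trans ?_, l2norm_le.trans ?_, l2norm_le.trans ?_⟩
  · gcongr; linarith
  · have := huc.h_pos.le
    gcongr; linarith
  · gcongr ?_ * _
    calc solverConst A cI c2 * 𝒯c.h = solverConst A cI c2 / cref * (cref * 𝒯c.h) := by field_simp
      _ ≤ C * 𝒯f.h :=
          mul_le_mul (by linarith) hh (mul_pos hcref huc.h_pos).le (by linarith)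

end Method

theorem a_injection_le (Sc : Method 𝒯c p k) (Sf : Method 𝒯f p k) {I : 𝒯c.M p →ₗ[ℝ] 𝒯f.M p}
    (hΩ : IsLipschitzDomain Ω) {C E : ℝ} (hE : 0 ≤ E)
    (hSf : ∀ mu, Sf.a mu mu ≤ E * Sf.normQ mu ^ 2) {lam : 𝒯c.M p}
    (hI : Sf.normQ (I lam) ≤ C * Sc.normQ lam) :
    Sf.a (I lam) (I lam) ≤ E * C ^ 2 * Sc.a lam lam :=
  calc Sf.a (I lam) (I lam) ≤ E * Sf.normQ (I lam) ^ 2 := hSf (I lam)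
    _ ≤ E * (C * Sc.normQ lam) ^ 2 :=
        mul_le_mul_of_nonneg_left (pow_le_pow_left₀ (Sf.normQ_nonneg _) hI 2) hE
    _ = E * C ^ 2 * Sc.normQ lam ^ 2 := by ring
    _ ≤ E * C ^ 2 * Sc.a lam lam :=
        mul_le_mul_of_nonneg_left (Sc.normQ_sq_le_a hΩ lam) (mul_nonneg hE (sq_nonneg C))

theorem IsRitz.a_le [NeZero d] {Sc : Method 𝒯c p k} {Sf : Method 𝒯f p k}
    {I : 𝒯c.M p →ₗ[ℝ] 𝒯f.M p} {P : 𝒯f.M p →ₗ[ℝ] 𝒯c.M p} (hP : IsRitz Sc Sf I P)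
    (hΩ : IsLipschitzDomain Ω) {C : ℝ} (hC : 0 ≤ C)
    (hI : ∀ lam, Sf.a (I lam) (I lam) ≤ C * Sc.a lam lam) (lam : 𝒯f.M p) :
    Sc.a (P lam) (P lam) ≤ C * Sf.a lam lam := by
  have a_nonneg := Sf.a_self_nonneg hΩ lam
  rcases (Sc.a_self_nonneg hΩ (P lam)).eq_or_lt with a_P_eq | a_P_pos
  · exact a_P_eq ▸ mul_nonneg hC a_nonneg
  · refine le_of_mul_le_mul_right ?_ a_P_pos
    calc Sc.a (P lam) (P lam) * Sc.a (P lam) (P lam) = Sf.a lam (I (P lam)) ^ 2 := by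
          rw [hP, sq]
      _ ≤ Sf.a lam lam * Sf.a (I (P lam)) (I (P lam)) := Sf.a_sq_le_a_mul_a hΩ _ _
      _ ≤ Sf.a lam lam * (C * Sc.a (P lam) (P lam)) := mul_le_mul_of_nonneg_left (hI _) a_nonneg
      _ = C * Sf.a lam lam * Sc.a (P lam) (P lam) := by ring

end TwoLevel

end HDG

end

theorem mainTheorem2 (d p k : ℕ) (hd : 1 ≤ d) (hp : 1 ≤ p)
    (cshape cunif cref : ℝ) (hcref : 0 < cref) (cI c1 c2 c3 : ℝ) :
    ∃ C : ℝ, 0 < C ∧ ∀ cτ : ℝ, ∃ C' : ℝ, 0 < C' ∧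
      ∀ (Ω : Set (HDG.Pt d)), HDG.IsLipschitzDomain Ω →
      ∀ (L : ℕ) (H : HDG.MeshHierarchy d Ω L),
        (∀ ℓ, (H.mesh ℓ).ShapeRegular cshape) →
        (∀ ℓ, (H.mesh ℓ).QuasiUniform cunif) →
        (∀ ℓ : Fin L, cref * (H.mesh ℓ.castSucc).h ≤ (H.mesh ℓ.succ).h) →
      ∀ (S : ∀ ℓ, HDG.Method (H.mesh ℓ) p k)
        (I : ∀ ℓ : Fin L, (H.mesh ℓ.castSucc).M p →ₗ[ℝ] (H.mesh ℓ.succ).M p),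
        (∀ ℓ, HDG.IA1 (I ℓ) cI) → (∀ ℓ, HDG.IA2 (I ℓ)) →
        (∀ ℓ, (S ℓ).LS1 c1) → (∀ ℓ, (S ℓ).LS2 c2) → (∀ ℓ, (S ℓ).LS3 c3) → (∀ ℓ, (S ℓ).LS4) →
      ∀ ℓ : Fin L,
        (∀ lam : (H.mesh ℓ.castSucc).M p,
          (S ℓ.succ).normQ (I ℓ lam) ≤ C * (S ℓ.castSucc).normQ lam ∧
          HDG.l2norm Ω (fun x => (H.mesh ℓ.castSucc).fn ((S ℓ.castSucc).U lam) x
              - (H.mesh ℓ.succ).fn ((S ℓ.succ).U (I ℓ lam)) x)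
            ≤ C * (H.mesh ℓ.castSucc).h * (S ℓ.castSucc).normQ lam ∧
          HDG.l2norm Ω (fun x => (H.mesh ℓ.castSucc).fn ((S ℓ.castSucc).U lam) x
              - (H.mesh ℓ.succ).fn ((S ℓ.succ).U (I ℓ lam)) x)
            ≤ C * (H.mesh ℓ.succ).h * (S ℓ.castSucc).normQ lam) ∧
        (∃! P : (H.mesh ℓ.succ).M p →ₗ[ℝ] (H.mesh ℓ.castSucc).M p,
          HDG.IsRitz (S ℓ.castSucc) (S ℓ.succ) (I ℓ) P) ∧
        ((S ℓ.succ).τ * (H.mesh ℓ.succ).h ≤ cτ →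
          (∀ lam : (H.mesh ℓ.castSucc).M p,
            (S ℓ.succ).a (I ℓ lam) (I ℓ lam) ≤ C' * (S ℓ.castSucc).a lam lam) ∧
          ∀ P : (H.mesh ℓ.succ).M p →ₗ[ℝ] (H.mesh ℓ.castSucc).M p,
            HDG.IsRitz (S ℓ.castSucc) (S ℓ.succ) (I ℓ) P →
            ∀ lam : (H.mesh ℓ.succ).M p,
              (S ℓ.castSucc).a (P lam) (P lam) ≤ C' * (S ℓ.succ).a lam lam) := by
  have : NeZero d := ⟨Nat.one_le_iff_ne_zero.1 hd⟩
  let κ := max 1 (cunif * cshape)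
  have κ_pos : 0 < κ := lt_max_of_lt_left one_pos
  let C := HDG.injectionConst (HDG.approxConst d k κ c1 c3) cref cI c2
  have C_pos : 0 < C :=
    HDG.injectionConst_pos (HDG.approxConst_pos d k κ_pos c1 c3).le hcref cI c2
  refine ⟨C, C_pos, fun cτ => ?_⟩
  let E := HDG.energyConst d κ c1 cτ
  have E_pos : 0 < E := HDG.energyConst_pos d κ_pos c1 cτ
  have C'_pos : 0 < E * C ^ 2 := mul_pos E_pos (pow_pos C_pos 2)
  refine ⟨E * C ^ 2, C'_pos, fun Ω hΩ L H hshape hunif href S I hI1 hI2 h1 h2 h3 h4 ℓ => ?_⟩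
  have uniform (j) : (H.mesh j).IsUniform κ :=
    (H.mesh j).isUniform_of_shapeRegular_of_quasiUniform hΩ (hshape j) (hunif j)
  have bounds := HDG.Method.injection_bounds hp hΩ (uniform _) (uniform _) (H.refined ℓ) hcref
    (href ℓ) (hI1 ℓ) (hI2 ℓ) (h1 _) (h3 _) (h2 _) (h2 _) (h4 _) (h4 _)
  have a_definite (lam) (h : (S ℓ.castSucc).a lam lam = 0) : lam = 0 :=
    (S ℓ.castSucc).eq_zero_of_a_self_eq_zero hp hΩ (uniform _) (h1 _) (h3 _) (h4 _) h
  refine ⟨bounds, HDG.existsUnique_isRitz _ _ _ hΩ a_definite, fun hτ => ?_⟩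
  have energy_bound (lam) := HDG.a_injection_le (S ℓ.castSucc) (S ℓ.succ) hΩ E_pos.le
    ((S ℓ.succ).a_self_le hΩ (uniform _) (h1 _) hτ) (bounds lam).1
  exact ⟨energy_bound, fun P hP => hP.a_le hΩ C'_pos.le energy_bound⟩
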